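/- Let $d\ge 1$, $\alpha\in(0,2)$, let $(\Omega,\mathcal F,\mathbb P)$ be a probability space and $\{\tau_x\}_{x\in\mathbb R^d}$ a group of transformations of $\Omega$ ($\tau_0=\mathrm{id}$, $\tau_x\circ\tau_y=\tau_{x+y}$) such that $(x,\omega)\mapsto\tau_x\omega$ is jointly measurable, $\mathbb P(\tau_xA)=\mathbb P(A)$ for all $A\in\mathcal F$ and $x\in\mathbb R^d$, and every $A\in\mathcal F$ with $\tau_xA=A$ for all $x$ has probability $0$ or $1$. Let $\Gamma\subset\mathbb R^d$ be a non-empty open set with $rx\in\Gamma$ for all $x\in\Gamma$ and $r\in\mathbb R\setminus\{0\}$. Write $B(\mathbb R^d)$ for the locally bounded measurable real functions on $\mathbb R^d$ and $B_c(\mathbb R^d)$ for the bounded measurable ones with compact support. (i) Let $\kappa:\mathbb R^d\times\mathbb R^d\times\Omega\to[0,\infty)$ be measurable with $\kappa(x,y;\omega)=\kappa(y,x;\omega)$ and $\kappa(x+z,y+z;\omega)=\kappa(x,y;\tau_z\omega)$ for all $x,y,z,\omega$. Suppose that (A1) holds: there are a measurable $\nu:\mathbb R^d\times\Omega\to[0,\infty)$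 and a measurable $\bar\nu:\mathbb R^d\to[0,\infty)$ such that - for a.s. $\omega$, $\kappa(x,y;\omega)=\nu(y-x;\tau_x\omega)+\nu(x-y;\tau_y\omega)$ for all $x,y\in\mathbb R^d$; - there is $l>0$ such that for every integer $n\ge1$ there is a constant $C_1(n)>0$ with, for $\nu_n=\nu\wedge n$ and all $x,z_1,z_2\in\mathbb R^d$, $$\big|\mathbb E[\nu_n(z_1;\cdot)\,\nu_n(z_2;\tau_x(\cdot))]-\mathbb E[\nu_n(z_1;\cdot)]\,\mathbb E[\nu_n(z_2;\cdot)]\big|\le C_1(n)\,(1\wedge|x|^{-l})$$ (the right side being $C_1(n)$ at $x=0$); - $z\mapsto\mathbb E[\nu(z/\varepsilon;\cdot)]$ converges weakly to $\bar\nu$ in $L^1_{loc}(\mathbb R^d;dx)$ as $\varepsilon\downarrow0$; that is, these functions are locally integrable and $\lim_{\varepsilon\to0}\int h(z)\,\mathbb E[\nu(z/\varepsilon;\cdot)]\,dz=\int h(z)\bar\nu(z)\,dz$ for every $h\in B_c(\mathbb R^d)$. Suppose also that there are $p>1$ and a non-negative random variable $\Lambda$ with $\mathbb E[\Lambda^p]<\infty$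 and $\kappa(x,y;\omega)\le\Lambda(\tau_x\omega)+\Lambda(\tau_y\omega)$ for all $\omega\in\Omega$ and $x,y\in\mathbb R^d$. Then there is a set $\Omega_1\subset\Omega$ of full probability such that for every $\omega\in\Omega_1$, every $\eta>0$, $f\in B(\mathbb R^d)$ and $g\in B_c(\mathbb R^d)$, the integrands below are (for every $\varepsilon>0$) integrable in $(x,z)$ and $$\lim_{\varepsilon\to0}\int_{\mathbb R^d}\int_{\{\eta<|z|<1/\eta,\,z\in\Gamma\}}\frac{(f(x+z)-f(x))(g(x+z)-g(x))}{|z|^{d+\alpha}}\,\kappa(x/\varepsilon,(x+z)/\varepsilon;\omega)\,dz\,dx$$ $$=\int_{\mathbb R^d}\int_{\{\eta<|z|<1/\eta,\,z\in\Gamma\}}\frac{(f(x+z)-f(x))(g(x+z)-g(x))}{|z|^{d+\alpha}}\,(\bar\nu(z)+\bar\nu(-z))\,dz\,dx.$$ (ii) Let $\nu_1,\nu_2$ be non-negative random variables with $\mathbb E[\nu_1^p+\nu_2^p]<\infty$ for some $p>1$. Then there is a set $\Omega_2\subset\Omega$ of full probability such that for every $\omega\in\Omega_2$, every $\eta>0$,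 $f\in B(\mathbb R^d)$ and $g\in B_c(\mathbb R^d)$, the integrands below are (for every $\varepsilon>0$) integrable in $(x,y)$ and $$\lim_{\varepsilon\to0}\int_{\mathbb R^d}\int_{\{\eta<|x-y|<1/\eta,\,x-y\in\Gamma\}}\frac{(f(y)-f(x))(g(y)-g(x))}{|x-y|^{d+\alpha}}\,\nu_1(\tau_{x/\varepsilon}\omega)\,\nu_2(\tau_{y/\varepsilon}\omega)\,dx\,dy$$ $$=\int_{\mathbb R^d}\int_{\{\eta<|x-y|<1/\eta,\,x-y\in\Gamma\}}\frac{(f(y)-f(x))(g(y)-g(x))}{|x-y|^{d+\alpha}}\,\mathbb E[\nu_1]\,\mathbb E[\nu_2]\,dx\,dy.$$ -/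

import Mathlib

open MeasureTheory Filter Topology

/-- The Euclidean space of dimension `d`. -/
abbrev Rd (d : ℕ) : Type := EuclideanSpace ℝ (Fin d)

/-- A stationary and ergodic measurable group of transformations `τ x`, `x ∈ ℝ^d`, of a
probability space. Each `τ x` is a bijection with measurable inverse `τ (-x)`, so invariance of
the measure and of sets may be expressed through preimages. -/
structure IsStationaryErgodicGroup {d : ℕ} {Ω : Type*} [MeasurableSpace Ω] (P : Measure Ω)
    (τ : Rd d → Ω → Ω) : Prop where
  map_zero : ∀ ω, τ 0 ω = ω
  map_add : ∀ x y ω, τ x (τ y ω) = τ (x + y) ω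
  measurable : Measurable (fun q : Rd d × Ω => τ q.1 q.2)
  stationary : ∀ x, MeasurePreserving (τ x) P P
  ergodic : ∀ A : Set Ω, MeasurableSet A → (∀ x, τ x ⁻¹' A = A) → P A = 0 ∨ P A = 1

/-- An infinite open cone, symmetric with respect to the origin (the vertex may or may not
belong to it). -/
structure IsSymmetricOpenCone {d : ℕ} (Γ : Set (Rd d)) : Prop where
  nonempty : Γ.Nonempty
  isOpen : IsOpen Γ
  smul_mem : ∀ x ∈ Γ, ∀ r : ℝ, r ≠ 0 → r • x ∈ Γ

/-- A non-negative random coefficient, symmetric in its two space variables and shift covariant. -/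
structure IsRandomCoefficient {d : ℕ} {Ω : Type*} [MeasurableSpace Ω] (τ : Rd d → Ω → Ω)
    (κ : Rd d → Rd d → Ω → ℝ) : Prop where
  nonneg : ∀ x y ω, 0 ≤ κ x y ω
  measurable : Measurable (fun q : (Rd d × Rd d) × Ω => κ q.1.1 q.1.2 q.2)
  symm : ∀ x y ω, κ x y ω = κ y x ω
  shift : ∀ x y z ω, κ (x + z) (y + z) ω = κ x y (τ z ω)

/-- Locally bounded (Lebesgue) measurable functions on `ℝ^d`. -/
structure IsLocallyBoundedMeasurable {d : ℕ} (f : Rd d → ℝ) : Prop where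
  aemeasurable : AEMeasurable f volume
  bounded_on : ∀ K : Set (Rd d), IsCompact K → ∃ M : ℝ, ∀ x ∈ K, |f x| ≤ M

/-- Bounded (Lebesgue) measurable functions on `ℝ^d` with compact support. -/
structure IsBoundedCompactlySupported {d : ℕ} (g : Rd d → ℝ) : Prop where
  aemeasurable : AEMeasurable g volume
  bounded : ∃ M : ℝ, ∀ x, |g x| ≤ M
  hasCompactSupport : HasCompactSupport g

/-- Weak convergence in `L^1_loc(ℝ^d; dx)` of `F ε` to `G` as `ε ↓ 0`, tested against bounded
functions of compact support. -/
structure WeaklyConvergesL1loc {d : ℕ} (F : ℝ → Rd d → ℝ) (G : Rd d → ℝ) : Prop where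
  locallyIntegrable : ∀ ε : ℝ, 0 < ε → LocallyIntegrable (F ε) volume
  locallyIntegrable_limit : LocallyIntegrable G volume
  tendsto : ∀ h : Rd d → ℝ, IsBoundedCompactlySupported h →
    Tendsto (fun ε : ℝ => ∫ z, h z * F ε z) (𝓝[>] 0) (𝓝 (∫ z, h z * G z))

/-- The function `1 ∧ |x|^{-l}` for `l > 0`, with the value `1` at the origin. -/
noncomputable def mixingDecay {d : ℕ} (l : ℝ) (x : Rd d) : ℝ :=
  open Classical in if x = 0 then 1 else min 1 (‖x‖ ^ (-l))

/-- The summation-form assumption on `κ`: it is generated by `ν`, whose truncations `ν ∧ n` have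
polynomially decaying covariances, uniformly in the jump variables, and whose rescaled mean
converges weakly to `νbar`. -/
structure SummationForm {d : ℕ} {Ω : Type*} [MeasurableSpace Ω] (P : Measure Ω)
    (τ : Rd d → Ω → Ω) (κ : Rd d → Rd d → Ω → ℝ) (ν : Rd d → Ω → ℝ) (νbar : Rd d → ℝ) :
    Prop where
  nonneg : ∀ z ω, 0 ≤ ν z ω
  measurable : Measurable (fun q : Rd d × Ω => ν q.1 q.2)
  representation : ∀ᵐ ω ∂P, ∀ x y, κ x y ω = ν (y - x) (τ x ω) + ν (x - y) (τ y ω)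
  mixing : ∃ l : ℝ, 0 < l ∧ ∀ n : ℕ, 0 < n → ∃ C : ℝ, 0 < C ∧ ∀ x z₁ z₂ : Rd d,
    |(∫ ω, min (ν z₁ ω) n * min (ν z₂ (τ x ω)) n ∂P)
        - (∫ ω, min (ν z₁ ω) n ∂P) * (∫ ω, min (ν z₂ ω) n ∂P)| ≤ C * mixingDecay l x
  limit_nonneg : ∀ z, 0 ≤ νbar z
  limit_measurable : Measurable νbar
  mean_converges : WeaklyConvergesL1loc (fun ε z => ∫ ω, ν (ε⁻¹ • z) ω ∂P) νbar

/-- The set of `z ∈ Γ` with `η < |z| < 1/η`. -/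
def truncatedCone {d : ℕ} (Γ : Set (Rd d)) (η : ℝ) : Set (Rd d) :=
  {z | η < ‖z‖ ∧ ‖z‖ < 1 / η ∧ z ∈ Γ}

/-! Because η < |z| < 1/η and g has compact support, the factor in front of the random coefficient
is a bounded measurable function of the pair of variables with bounded support
(`isBoundedTest_jumpKernel`). Both claims thus become weak convergence of rescaled random fields on
ℝ^d × ℝ^d against such functions K, on one event that serves every K.

The basic tool is the multiparameter pointwise ergodic theorem `ae_tendsto_orbitAverage`: for
integrable F ≥ 0 the field x ↦ F(τ_{x/ε} ω) converges weakly to E[F]. By ergodicity, constants and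
coboundaries span a dense subspace of L²; on it the theorem is elementary, and a maximal inequality
proved by Vitali covering carries it to L¹. Applied to F - F ∧ n, it also yields local uniform
integrability of the rescaled fields.

For (i), κ is the sum of ν(z/ε; τ_{x/ε} ω) and the same expression read from the other end point of
the jump; the involution `reverseJump` exchanges the two. Since ν(z; ω) ≤ Λ(ω) + Λ(τ_z ω), the error
of truncating ν is controlled by the tails of Λ at both end points. The truncated field still varies
with z/ε, which is out of reach of the ergodic theorem; instead, covariance decay gives its centred
integral against a continuous test function a variance of order ε^s (`ae_tendsto_of_mixing`). These
variances are summable along a polynomial sequence of scales, consecutive scales have ratio tending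
to 1, and a countable dense family of test functions makes the null set universal. The means
converge by assumption.

For (ii), integrating K in x against the first factor gives functions of y that converge pointwise
and boundedly, hence in L¹. The second factor is unbounded but locally uniformly integrable, which
is enough to multiply by it (`tendsto_integral_tensor`). -/

open scoped ENNReal

/-! ### Ergodicity and the L² decomposition. -/

namespace IsStationaryErgodicGroup

variable {d : ℕ} {Ω : Type*} [MeasurableSpace Ω] {P : Measure Ω} {τ : Rd d → Ω → Ω}

theorem measurable_apply (hτ : IsStationaryErgodicGroup P τ) (x : Rd d) : Measurable (τ x) :=
  hτ.measurable.comp measurable_prodMk_left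

theorem measurable_orbit (hτ : IsStationaryErgodicGroup P τ) (ω : Ω) :
    Measurable (fun x => τ x ω) :=
  hτ.measurable.comp measurable_prodMk_right

theorem apply_neg_apply (hτ : IsStationaryErgodicGroup P τ) (x : Rd d) (ω : Ω) :
    τ (-x) (τ x ω) = ω := by
  rw [hτ.map_add, neg_add_cancel, hτ.map_zero]

theorem apply_apply_neg (hτ : IsStationaryErgodicGroup P τ) (x : Rd d) (ω : Ω) :
    τ x (τ (-x) ω) = ω := by
  rw [hτ.map_add, add_neg_cancel, hτ.map_zero]

variable [IsProbabilityMeasure P]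

/-- A property that holds almost surely holds, almost surely, at almost every point of the
orbit. -/
theorem ae_orbit (hτ : IsStationaryErgodicGroup P τ) {p : Ω → Prop} (h : ∀ᵐ ω ∂P, p ω) :
    ∀ᵐ ω ∂P, ∀ᵐ x, p (τ x ω) := by
  have hN := measurableSet_toMeasurable P {ω | ¬ p ω}
  have h0 : ∀ᵐ ω ∂P, ω ∉ toMeasurable P {ω | ¬ p ω} := by
    rw [ae_iff]
    simp only [not_not, Set.ofPred_mem_eq, measure_toMeasurable]
    exact ae_iff.1 h
  have h1 : ∀ᵐ x : Rd d, ∀ᵐ ω ∂P, τ x ω ∉ toMeasurable P {ω | ¬ p ω} :=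
    ae_of_all _ fun x => (hτ.stationary x).quasiMeasurePreserving.ae h0
  rw [Measure.ae_ae_comm (p := fun x ω => τ x ω ∉ toMeasurable P {ω | ¬ p ω})
    (hτ.measurable hN.compl)] at h1
  filter_upwards [h1] with ω hω
  filter_upwards [hω] with x hx
  by_contra hp
  exact hx (subset_toMeasurable _ _ hp)

/-- An almost invariant set has probability zero or one. -/
theorem ae_mem_or_ae_notMem (hτ : IsStationaryErgodicGroup P τ) {A : Set Ω}
    (hA : MeasurableSet A) (h : ∀ x, τ x ⁻¹' A =ᵐ[P] A) :
    (∀ᵐ ω ∂P, ω ∈ A) ∨ ∀ᵐ ω ∂P, ω ∉ A := by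
  set S : Set (Rd d × Ω) := {q | τ q.1 q.2 ∈ A} with hS
  have hSm : MeasurableSet S := hτ.measurable hA
  -- Ergodicity concerns strictly invariant sets, so A is replaced by the set of ω whose orbit meets
  -- A at almost every x. It is strictly invariant because translations preserve Lebesgue null sets,
  -- and by Fubini it agrees with A almost surely.
  set A' : Set Ω := {ω | ∀ᵐ x : Rd d, τ x ω ∈ A} with hA'
  have hA'm : MeasurableSet A' := by
    have : A' = {ω | volume ((fun x => (x, ω)) ⁻¹' Sᶜ) = 0} := by
      ext ω; simp only [hA', Set.mem_ofPred_eq, ae_iff]; rfl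
    rw [this]
    exact (measurable_measure_prodMk_right hSm.compl) (measurableSet_singleton 0)
  have hinv : ∀ y, τ y ⁻¹' A' = A' := by
    intro y
    ext ω
    simp only [hA', Set.mem_preimage, Set.mem_ofPred_eq, hτ.map_add]
    simp_rw [add_comm _ y]
    exact eventually_add_left_iff volume y (p := fun x => τ x ω ∈ A)
  have hcomm : ∀ᵐ ω ∂P, ∀ᵐ x : Rd d, (τ x ω ∈ A ↔ ω ∈ A) := by
    rw [← Measure.ae_ae_comm (p := fun (x : Rd d) ω => (τ x ω ∈ A ↔ ω ∈ A))]
    · refine ae_of_all _ fun x => ?_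
      filter_upwards [h x] with ω hω
      exact iff_of_eq hω
    · exact (hτ.measurable hA).iff (measurable_snd hA)
  have hne : (volume : Measure (Rd d)) ≠ 0 := NeZero.ne _
  have : NeBot (ae (volume : Measure (Rd d))) := ae_neBot.2 hne
  rcases hτ.ergodic A' hA'm hinv with h0 | h1
  · right
    have h0' : ∀ᵐ ω ∂P, ω ∉ A' := by rw [ae_iff]; simpa using h0
    filter_upwards [hcomm, h0'] with ω hω h2 h3
    exact h2 (hω.mono fun x hx => hx.2 h3)
  · left
    have h1' : ∀ᵐ ω ∂P, ω ∈ A' := (prob_compl_eq_zero_iff hA'm).2 h1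
    filter_upwards [hcomm, h1'] with ω hω h2
    obtain ⟨x, hx, hx'⟩ := (hω.and h2).exists
    exact hx.1 hx'

theorem ae_eq_const (hτ : IsStationaryErgodicGroup P τ) {u : Ω → ℝ} (hu : Measurable u)
    (h : ∀ x, u ∘ τ x =ᵐ[P] u) : ∃ c, u =ᵐ[P] Function.const Ω c := by
  refine exists_eventuallyEq_const_of_forall_separating MeasurableSet fun U hU => ?_
  refine hτ.ae_mem_or_ae_notMem (hu hU) fun x => ?_
  refine ((h x).mono fun ω hω => ?_).set_eq
  change u (τ x ω) ∈ U ↔ u ω ∈ U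
  rw [← hω, Function.comp]

/-- The constant one and the differences of an indicator and its shift. -/
def coboundaries (hτ : IsStationaryErgodicGroup P τ) : Set (Lp ℝ 2 P) :=
  {v | v = indicatorConstLp 2 MeasurableSet.univ (measure_ne_top P _) (1 : ℝ) ∨
    ∃ (A : Set Ω) (hA : MeasurableSet A) (a : Rd d),
      v = indicatorConstLp 2 hA (measure_ne_top P _) (1 : ℝ)
        - indicatorConstLp 2 (hτ.measurable_apply a hA) (measure_ne_top P _) (1 : ℝ)}

/-- A vector orthogonal to all differences 1_A - 1_A ∘ τ_a has the same integral over A and over its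
shifts, so it is invariant, hence constant by ergodicity; orthogonality to 1 makes the constant
zero. -/
theorem topologicalClosure_span_coboundaries (hτ : IsStationaryErgodicGroup P τ) :
    (Submodule.span ℝ hτ.coboundaries).topologicalClosure = ⊤ := by
  rw [Submodule.topologicalClosure_eq_top_iff, Submodule.eq_bot_iff]
  intro u hu
  rw [Submodule.mem_orthogonal] at hu
  have hint : Integrable u P := (Lp.memLp u).integrable one_le_two
  have hone : ∫ ω, u ω ∂P = 0 := by
    have := hu _ (Submodule.subset_span (Or.inl rfl))
    rw [L2.inner_indicatorConstLp_one] at this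
    simpa using this
  have hshift : ∀ (a : Rd d) (A : Set Ω), MeasurableSet A →
      ∫ ω in τ a ⁻¹' A, u ω ∂P = ∫ ω in A, u ω ∂P := by
    intro a A hA
    have := hu _ (Submodule.subset_span (Or.inr ⟨A, hA, a, rfl⟩))
    rw [inner_sub_left, L2.inner_indicatorConstLp_one, L2.inner_indicatorConstLp_one] at this
    linarith
  have hinv : ∀ a, u ∘ τ a =ᵐ[P] u := by
    intro a
    refine Integrable.ae_eq_of_forall_setIntegral_eq _ _
      ((hτ.stationary a).integrable_comp_of_integrable hint) hint fun A hA _ => ?_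
    have he : MeasurableEmbedding (τ a) :=
      (MeasurableEquiv.mk ⟨τ a, τ (-a), hτ.apply_neg_apply a, hτ.apply_apply_neg a⟩
        (hτ.measurable_apply a) (hτ.measurable_apply (-a))).measurableEmbedding
    have hpre : τ a ⁻¹' (τ (-a) ⁻¹' A) = A := by
      ext ω; simp [hτ.apply_neg_apply]
    have h1 := (hτ.stationary a).setIntegral_preimage_emb he (fun ω => u ω) (τ (-a) ⁻¹' A)
    rw [hpre] at h1
    exact h1.trans (hshift (-a) A hA)
  have hae := (Lp.stronglyMeasurable u).measurable
  obtain ⟨c, hc⟩ := hτ.ae_eq_const hae hinv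
  have hc0 : c = 0 := by
    rw [integral_congr_ae hc] at hone
    simpa using hone
  subst hc0
  exact (Lp.eq_zero_iff_ae_eq_zero).2 hc

end IsStationaryErgodicGroup

/-! ### The maximal inequality. -/

theorem volume_closedBall_mul {d : ℕ} (x : Rd d) {a r : ℝ} (ha : 0 ≤ a) (hr : 0 ≤ r) :
    volume (Metric.closedBall x (a * r)) =
      ENNReal.ofReal a ^ d * volume (Metric.closedBall x r) := by
  rw [Measure.addHaar_closedBall_mul _ _ ha hr, finrank_euclideanSpace_fin,
    ENNReal.ofReal_pow ha, Measure.addHaar_closedBall_center volume x r]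

/-- A weak type estimate for averages over balls of integer radius, by Vitali covering. -/
theorem mul_volume_le_of_average_lt {d : ℕ} {φ : Rd d → ℝ≥0∞} {L : ℝ≥0∞} {N : ℕ} {R : ℝ}
    {S : Set (Rd d)} (hS : S ⊆ Metric.closedBall 0 R)
    (h : ∀ x ∈ S, ∃ n : ℕ, 1 ≤ n ∧ n ≤ N ∧
      L * volume (Metric.closedBall x (n : ℝ)) < ∫⁻ y in Metric.closedBall x n, φ y) :
    L * volume S ≤ 5 ^ d * ∫⁻ y in Metric.closedBall 0 (R + N), φ y := by
  choose! r hr1 hrN hr using h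
  -- The selected balls are disjoint, so their integrals add up, while their enlargements by 5 cover
  -- S; this is the source of 5^d. Vitali's lemma needs the radii bounded, here by N.
  obtain ⟨u, huS, hdisj, hcov⟩ := Vitali.exists_disjoint_subfamily_covering_enlargement_closedBall
    S (fun x => x) (fun x => (r x : ℝ)) N (fun x hx => by exact_mod_cast hrN x hx) 5 (by norm_num)
  have hcount : u.Countable := hdisj.countable_of_nonempty_interior fun x hx => by
    have : (0 : ℝ) < r x := by exact_mod_cast hr1 x (huS hx)
    exact ⟨x, Metric.ball_subset_interior_closedBall (Metric.mem_ball_self this)⟩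
  have hSsub : S ⊆ ⋃ b ∈ u, Metric.closedBall b (5 * (r b : ℝ)) := fun x hx => by
    obtain ⟨b, hb, hsub⟩ := hcov x hx
    exact Set.mem_biUnion hb (hsub (Metric.mem_closedBall_self (Nat.cast_nonneg _)))
  have := hcount.to_subtype
  calc L * volume S ≤ L * ∑' b : u, volume (Metric.closedBall (b : Rd d) (5 * (r b : ℝ))) := by
        gcongr
        exact (measure_mono hSsub).trans (measure_biUnion_le _ hcount _)
    _ = ∑' b : u, 5 ^ d * (L * volume (Metric.closedBall (b : Rd d) (r b : ℝ))) := by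
        rw [← ENNReal.tsum_mul_left]
        refine tsum_congr fun b => ?_
        rw [volume_closedBall_mul _ (by norm_num) (Nat.cast_nonneg _)]
        simp only [ENNReal.ofReal_ofNat]
        ring
    _ ≤ ∑' b : u, 5 ^ d * ∫⁻ y in Metric.closedBall (b : Rd d) (r b : ℝ), φ y := by
        gcongr with b
        exact (hr b (huS b.2)).le
    _ = 5 ^ d * ∫⁻ y in ⋃ b ∈ u, Metric.closedBall b (r b : ℝ), φ y := by
        rw [ENNReal.tsum_mul_left, lintegral_biUnion hcount
          (fun _ _ => Metric.isClosed_closedBall.measurableSet) hdisj]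
    _ ≤ 5 ^ d * ∫⁻ y in Metric.closedBall 0 (R + N), φ y := by
        gcongr
        refine (Set.iUnion₂_subset fun b hb => ?_)
        refine Metric.closedBall_subset_closedBall' ?_
        have h1 : dist b 0 ≤ R := hS (huS hb)
        have h2 : (r b : ℝ) ≤ N := by exact_mod_cast hrN b (huS hb)
        linarith

namespace IsStationaryErgodicGroup

variable {d : ℕ} {Ω : Type*} [MeasurableSpace Ω] {P : Measure Ω} [IsProbabilityMeasure P]
  {τ : Rd d → Ω → Ω}

theorem lintegral_setLIntegral_orbit (hτ : IsStationaryErgodicGroup P τ) {F : Ω → ℝ≥0∞}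
    (hF : Measurable F) (B : Set (Rd d)) :
    ∫⁻ ω, ∫⁻ x in B, F (τ x ω) ∂volume ∂P = volume B * ∫⁻ ω, F ω ∂P := by
  have hm : AEMeasurable (Function.uncurry fun ω x => F (τ x ω)) (P.prod (volume.restrict B)) :=
    (hF.comp (hτ.measurable.comp measurable_swap)).aemeasurable
  rw [lintegral_lintegral_swap hm]
  simp_rw [fun x => (hτ.stationary x).lintegral_comp hF]
  simp [mul_comm]

/-- **Maximal ergodic inequality** for averages over balls of integer radius. -/
theorem mul_measure_average_lt_le (hτ : IsStationaryErgodicGroup P τ) {F : Ω → ℝ≥0∞}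
    (hF : Measurable F) (L : ℝ≥0∞) :
    L * P {ω | ∃ n : ℕ, 1 ≤ n ∧ L * volume (Metric.closedBall (0 : Rd d) (n : ℝ)) <
      ∫⁻ y in Metric.closedBall 0 n, F (τ y ω)} ≤ 10 ^ d * ∫⁻ ω, F ω ∂P := by
  -- Radii are capped at N to allow covering; monotone convergence removes the cap. Integer radii
  -- keep the union countable and the sets measurable.
  set E : ℕ → Set Ω := fun N => {ω | ∃ n : ℕ, 1 ≤ n ∧ n ≤ N ∧
    L * volume (Metric.closedBall (0 : Rd d) (n : ℝ)) <
      ∫⁻ y in Metric.closedBall 0 n, F (τ y ω)} with hE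
  have hmeas : ∀ n : ℕ, Measurable fun ω => ∫⁻ y in Metric.closedBall (0 : Rd d) n, F (τ y ω) :=
    fun n => (hF.comp hτ.measurable).lintegral_prod_left'
  have hEm : ∀ N, MeasurableSet (E N) := fun N => by
    simp only [hE]
    refine measurableSet_setOfPred.2 (Measurable.exists fun n => ?_)
    exact (Measurable.and measurable_const (Measurable.and measurable_const
      (measurableSet_setOfPred.1 (measurableSet_lt measurable_const (hmeas n)))))
  have hEmono : Monotone E := fun N M h ω ⟨n, h1, h2, h3⟩ => ⟨n, h1, h2.trans h, h3⟩
  have hU : {ω | ∃ n : ℕ, 1 ≤ n ∧ L * volume (Metric.closedBall (0 : Rd d) (n : ℝ)) <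
      ∫⁻ y in Metric.closedBall 0 n, F (τ y ω)} = ⋃ N, E N := by
    ext ω
    simp only [hE, Set.mem_ofPred_eq, Set.mem_iUnion]
    exact ⟨fun ⟨n, h1, h2⟩ => ⟨n, n, h1, le_rfl, h2⟩, fun ⟨_, n, h1, _, h2⟩ => ⟨n, h1, h2⟩⟩
  rw [hU, hEmono.measure_iUnion, ENNReal.mul_iSup]
  refine iSup_le fun N => ?_
  rcases Nat.eq_zero_or_pos N with rfl | hN
  · have : E 0 = ∅ := by
      ext ω
      simp only [hE, Set.mem_ofPred_eq, Set.mem_empty_iff_false, iff_false]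
      rintro ⟨n, h1, h2, -⟩
      omega
    simp [this]
  have hN' : (0 : ℝ) < N := by exact_mod_cast hN
  have hshift : ∀ (x : Rd d) (n : ℕ) (ω : Ω),
      ∫⁻ y in Metric.closedBall 0 (n : ℝ), F (τ y (τ x ω)) =
        ∫⁻ y in Metric.closedBall x n, F (τ y ω) := by
    intro x n ω
    have h1 := (measurePreserving_add_right (volume : Measure (Rd d)) x).setLIntegral_comp_preimage
      (s := Metric.closedBall x n) Metric.isClosed_closedBall.measurableSet
      (hF.comp (hτ.measurable_orbit ω))
    rw [show ∫⁻ y in Metric.closedBall x n, F (τ y ω) = _ from h1.symm]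
    have : (fun y => y + x) ⁻¹' Metric.closedBall x (n : ℝ) = Metric.closedBall 0 n := by
      ext y; simp
    rw [this]
    simp [hτ.map_add]
  -- Transference: the covering estimate is applied along the orbit of ω, with centres in the ball
  -- of radius N. The integrals then live in the ball of radius 2N, and averaging over ω turns 5^d
  -- into 5^d · 2^d = 10^d.
  have key : ∀ ω, L * volume {x | x ∈ Metric.closedBall (0 : Rd d) N ∧ τ x ω ∈ E N} ≤
      5 ^ d * ∫⁻ y in Metric.closedBall (0 : Rd d) (N + N), F (τ y ω) := by
    intro ω
    refine mul_volume_le_of_average_lt (N := N) (fun x hx => hx.1) fun x hx => ?_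
    obtain ⟨n, h1, h2, h3⟩ := hx.2
    refine ⟨n, h1, h2, ?_⟩
    rwa [hshift, ← Measure.addHaar_closedBall_center volume x] at h3
  set V := volume (Metric.closedBall (0 : Rd d) (N : ℝ)) with hV
  have hV0 : V ≠ 0 := (Metric.measure_closedBall_pos volume _ hN').ne'
  have hVt : V ≠ ∞ := measure_closedBall_lt_top.ne
  have hfub : V * P (E N) =
      ∫⁻ ω, volume {x | x ∈ Metric.closedBall (0 : Rd d) N ∧ τ x ω ∈ E N} ∂P := by
    have h1 : P (E N) = ∫⁻ ω, (E N).indicator 1 ω ∂P := (lintegral_indicator_one (hEm N)).symm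
    rw [h1, hV, ← hτ.lintegral_setLIntegral_orbit (measurable_one.indicator (hEm N))]
    refine lintegral_congr fun ω => ?_
    have hm : MeasurableSet {x : Rd d | τ x ω ∈ E N} := hτ.measurable_orbit ω (hEm N)
    have : (fun x => (E N).indicator (1 : Ω → ℝ≥0∞) (τ x ω)) =
        {x : Rd d | τ x ω ∈ E N}.indicator 1 := rfl
    rw [this, lintegral_indicator_one hm, Measure.restrict_apply hm, Set.inter_comm]
    rfl
  have h2N : volume (Metric.closedBall (0 : Rd d) ((N : ℝ) + N)) = 2 ^ d * V := by
    rw [← two_mul, volume_closedBall_mul _ (by norm_num) hN'.le]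
    simp [hV]
  rw [← ENNReal.mul_le_mul_iff_right hV0 hVt]
  calc V * (L * P (E N)) = L * (V * P (E N)) := by ring
    _ = L * ∫⁻ ω, volume {x | x ∈ Metric.closedBall (0 : Rd d) N ∧ τ x ω ∈ E N} ∂P := by
      rw [hfub]
    _ = ∫⁻ ω, L * volume {x | x ∈ Metric.closedBall (0 : Rd d) N ∧ τ x ω ∈ E N} ∂P := by
      refine (lintegral_const_mul _ ?_).symm
      exact measurable_measure_prodMk_right
        (s := {q : Rd d × Ω | q.1 ∈ Metric.closedBall (0 : Rd d) N ∧ τ q.1 q.2 ∈ E N})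
        ((measurable_fst Metric.isClosed_closedBall.measurableSet).inter (hτ.measurable (hEm N)))
    _ ≤ ∫⁻ ω, 5 ^ d * (∫⁻ y in Metric.closedBall (0 : Rd d) (N + N), F (τ y ω)) ∂P :=
      lintegral_mono key
    _ = 5 ^ d * (2 ^ d * V * ∫⁻ ω, F ω ∂P) := by
      rw [lintegral_const_mul' _ _ (by finiteness), hτ.lintegral_setLIntegral_orbit hF, h2N]
    _ = V * (10 ^ d * ∫⁻ ω, F ω ∂P) := by
      rw [show (10 : ℝ≥0∞) = 5 * 2 by norm_num, mul_pow]; ring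

end IsStationaryErgodicGroup

/-! ### Bounded test functions and density in L¹. -/

section Analysis

variable {E : Type*} [NormedAddCommGroup E] [MeasurableSpace E] {μ : Measure E}

/-- Bounded almost everywhere measurable functions with bounded support. -/
structure IsBoundedTest (K : E → ℝ) (μ : Measure E) : Prop where
  aemeasurable : AEMeasurable K μ
  bounded : ∃ M : ℝ, ∀ x, |K x| ≤ M
  support : ∃ R : ℝ, ∀ x, K x ≠ 0 → ‖x‖ ≤ R

theorem IsBoundedTest.integrable_mul [ProperSpace E] [BorelSpace E] {K φ : E → ℝ}
    (hK : IsBoundedTest K μ) (hφ : LocallyIntegrable φ μ) : Integrable (fun x => K x * φ x) μ := by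
  obtain ⟨M, hM⟩ := hK.bounded
  obtain ⟨R, hR⟩ := hK.support
  have h1 : IntegrableOn φ (Metric.closedBall 0 R) μ :=
    hφ.integrableOn_isCompact (isCompact_closedBall 0 R)
  have h2 : IntegrableOn (fun x => K x * φ x) (Metric.closedBall 0 R) μ :=
    Integrable.bdd_mul h1 hK.aemeasurable.aestronglyMeasurable.restrict
      (ae_of_all _ fun x => hM x)
  refine (integrableOn_iff_integrable_of_support_subset fun x hx => ?_).1 h2
  rw [mem_closedBall_zero_iff]
  exact hR x (left_ne_zero_of_mul hx)

theorem IsBoundedTest.integrable [ProperSpace E] [BorelSpace E] [IsLocallyFiniteMeasure μ]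
    {K : E → ℝ} (hK : IsBoundedTest K μ) : Integrable K μ := by
  simpa using hK.integrable_mul (locallyIntegrable_const (1 : ℝ))

theorem IsBoundedTest.abs {K : E → ℝ} (hK : IsBoundedTest K μ) :
    IsBoundedTest (fun x => |K x|) μ :=
  ⟨hK.aemeasurable.abs, by simpa using hK.bounded, by simpa using hK.support⟩

theorem IsBoundedTest.of_continuous [BorelSpace E] {h : E → ℝ} (hc : Continuous h)
    (hs : HasCompactSupport h) : IsBoundedTest h μ := by
  refine ⟨hc.measurable.aemeasurable, hs.exists_bound_of_continuous hc, ?_⟩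
  obtain ⟨R, hR⟩ := hs.isCompact.isBounded.exists_norm_le
  exact ⟨R, fun x hx => hR x (subset_tsupport h hx)⟩

theorem LocallyIntegrable.comp_smul [NormedSpace ℝ E] [BorelSpace E] [FiniteDimensional ℝ E]
    [μ.IsAddHaarMeasure] {φ : E → ℝ} (hφ : LocallyIntegrable φ μ) {c : ℝ} (hc : c ≠ 0) :
    LocallyIntegrable (fun x => φ (c • x)) μ := by
  have := FiniteDimensional.proper_real E
  rw [locallyIntegrable_iff]
  intro k hk
  have hk' : IsCompact ((fun x => c • x) '' k) := hk.image (continuous_const_smul c)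
  have h1 := (integrable_indicator_iff hk'.measurableSet).2 (hφ.integrableOn_isCompact hk')
  have h2 := h1.comp_smul hc
  rw [← integrable_indicator_iff hk.measurableSet]
  refine h2.congr (ae_of_all _ fun x => ?_)
  dsimp only
  by_cases hx : x ∈ k
  · rw [Set.indicator_of_mem hx, Set.indicator_of_mem (Set.mem_image_of_mem _ hx)]
  · rw [Set.indicator_of_notMem hx, Set.indicator_of_notMem]
    rintro ⟨y, hy, hyx⟩
    exact hx (smul_right_injective E hc hyx ▸ hy)

theorem lintegral_comp_smul [NormedSpace ℝ E] [BorelSpace E] [FiniteDimensional ℝ E]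
    [μ.IsAddHaarMeasure] (f : E → ℝ≥0∞) {c : ℝ} (hc : c ≠ 0) :
    ∫⁻ x, f (c • x) ∂μ = ENNReal.ofReal |(c ^ Module.finrank ℝ E)⁻¹| * ∫⁻ x, f x ∂μ := by
  have he : MeasurableEmbedding (fun x : E => c • x) :=
    (Homeomorph.smulOfNeZero c hc).measurableEmbedding
  rw [← he.lintegral_map, Measure.map_addHaar_smul μ hc, lintegral_smul_measure, smul_eq_mul]

/-- If `T i` tends pointwise to the identity, then `h ∘ T i` tends to `h` in `L¹` for `h`
continuous with compact support. -/
theorem tendsto_integral_abs_comp_sub [ProperSpace E] [BorelSpace E] [IsFiniteMeasureOnCompacts μ]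
    {ι : Type*} {l : Filter ι} [l.IsCountablyGenerated] {h : E → ℝ} (hc : Continuous h)
    (hs : HasCompactSupport h) {T : ι → E → E} (hT : ∀ᶠ i in l, Continuous (T i))
    (hlim : ∀ x, Tendsto (fun i => T i x) l (𝓝 x))
    (hbd : ∀ R : ℝ, ∃ R' : ℝ, ∀ᶠ i in l, ∀ x, ‖T i x‖ ≤ R → ‖x‖ ≤ R') :
    Tendsto (fun i => ∫ x, |h (T i x) - h x| ∂μ) l (𝓝 0) := by
  obtain ⟨M, hM⟩ := hs.exists_bound_of_continuous hc
  obtain ⟨R, hR⟩ := hs.isCompact.isBounded.exists_norm_le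
  obtain ⟨R', hR'⟩ := hbd R
  have h0 : ∀ x, R < ‖x‖ → h x = 0 := fun x hx => by
    by_contra hne
    exact absurd (hR x (subset_tsupport h hne)) (not_le.2 hx)
  have key : Tendsto (fun i => ∫ x, |h (T i x) - h x| ∂μ) l (𝓝 (∫ _, (0 : ℝ) ∂μ)) := by
    refine tendsto_integral_filter_of_dominated_convergence
      -- Outside this ball both h x and h (T i x) vanish; the bound R' on preimages under T i
      -- provides the second.
      ((Metric.closedBall (0 : E) (max R R')).indicator fun _ => M + M) ?_ ?_ ?_ ?_
    · filter_upwards [hT] with i hi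
      exact ((hc.comp hi).sub hc).abs.aestronglyMeasurable
    · filter_upwards [hR'] with i hi
      refine ae_of_all _ fun x => ?_
      by_cases hx : x ∈ Metric.closedBall (0 : E) (max R R')
      · rw [Set.indicator_of_mem hx, Real.norm_eq_abs, abs_abs]
        exact (abs_sub _ _).trans (add_le_add (hM _) (hM _))
      · rw [Set.indicator_of_notMem hx]
        rw [mem_closedBall_zero_iff, not_le, max_lt_iff] at hx
        rw [h0 x hx.1, h0 (T i x) (not_le.1 fun hle => absurd (hi x hle) (not_le.2 hx.2))]
        simp
    · rw [integrable_indicator_iff Metric.isClosed_closedBall.measurableSet]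
      exact integrableOn_const (isCompact_closedBall _ _).measure_lt_top.ne
    · refine ae_of_all _ fun x => ?_
      have := ((hc.tendsto x).comp (hlim x)).sub_const (h x)
      simpa using this.abs
  simpa using key

/-- Countably many continuous compactly supported functions are dense in `L¹`. -/
theorem exists_seq_continuous_dense [ProperSpace E] [BorelSpace E] [SigmaFinite μ] [μ.Regular] :
    ∃ D : ℕ → E → ℝ, (∀ n, Continuous (D n) ∧ HasCompactSupport (D n)) ∧
      ∀ K : E → ℝ, Integrable K μ → ∀ δ : ℝ, 0 < δ → ∃ n, ∫ x, |K x - D n x| ∂μ ≤ δ := by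
  set S : Set (Lp ℝ 1 μ) := {u | ∃ h : E → ℝ, Continuous h ∧ HasCompactSupport h ∧ u =ᵐ[μ] h}
  have : Fact ((1 : ℝ≥0∞) ≠ ∞) := ⟨ENNReal.one_ne_top⟩
  -- The countable dense set is chosen inside S, so that each of its elements has a continuous
  -- compactly supported representative.
  obtain ⟨c, hcS, hcc, hcl⟩ := (TopologicalSpace.IsSeparable.of_separableSpace S
    ).exists_countable_dense_subset
  have hS0 : (0 : Lp ℝ 1 μ) ∈ S :=
    ⟨0, continuous_zero, HasCompactSupport.zero, Lp.coeFn_zero _ _ _⟩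
  have hcne : c.Nonempty := by
    rw [← closure_nonempty_iff]
    exact ⟨0, hcl hS0⟩
  obtain ⟨u, hu⟩ := hcc.exists_eq_range hcne
  have huS : ∀ n, u n ∈ S := fun n => hcS (hu ▸ Set.mem_range_self n)
  choose D hDc hDs hDu using huS
  refine ⟨D, fun n => ⟨hDc n, hDs n⟩, fun K hK δ hδ => ?_⟩
  obtain ⟨g, hgs, hgK, hgc, hgm⟩ := hK.exists_hasCompactSupport_integral_sub_le (half_pos hδ)
  have hgS : hgm.toL1 g ∈ S := ⟨g, hgc, hgs, hgm.coeFn_toL1⟩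
  obtain ⟨v, hvc, hv⟩ := Metric.mem_closure_iff.1 (hcl hgS) (δ / 2) (half_pos hδ)
  rw [hu] at hvc
  obtain ⟨n, rfl⟩ := hvc
  refine ⟨n, ?_⟩
  have hDi : Integrable (D n) μ := (hDc n).integrable_of_hasCompactSupport (hDs n)
  have h1 : ∫ x, |g x - D n x| ∂μ ≤ δ / 2 := by
    rw [dist_eq_norm, L1.norm_eq_integral_norm] at hv
    refine (integral_congr_ae ?_).le.trans hv.le
    filter_upwards [Lp.coeFn_sub (hgm.toL1 g) (u n), hgm.coeFn_toL1, hDu n] with x h1 h2 h3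
    rw [h1, Pi.sub_apply, h2, h3, Real.norm_eq_abs]
  calc ∫ x, |K x - D n x| ∂μ ≤ ∫ x, (|K x - g x| + |g x - D n x|) ∂μ :=
        integral_mono (hK.sub hDi).abs ((hK.sub hgm).abs.add (hgm.sub hDi).abs)
          fun x => abs_sub_le _ _ _
    _ = ∫ x, |K x - g x| ∂μ + ∫ x, |g x - D n x| ∂μ :=
        integral_add (hK.sub hgm).abs (hgm.sub hDi).abs
    _ ≤ δ := by
        have : ∫ x, |K x - g x| ∂μ ≤ δ / 2 := hgK
        linarith

end Analysis

/-- Weak-* convergence of a bounded family follows from convergence on a dense sequence. -/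
theorem tendsto_integral_mul_of_dense {E : Type*} [MeasurableSpace E] {μ : Measure E}
    {D : ℕ → E → ℝ} (hDi : ∀ n, Integrable (D n) μ)
    (hD : ∀ K : E → ℝ, Integrable K μ → ∀ δ : ℝ, 0 < δ → ∃ n, ∫ x, |K x - D n x| ∂μ ≤ δ)
    {ι : Type*} {l : Filter ι} {Φ : ι → E → ℝ} (hΦm : ∀ i, AEStronglyMeasurable (Φ i) μ) {M : ℝ}
    (hΦ : ∀ i x, |Φ i x| ≤ M)
    (hlim : ∀ n, Tendsto (fun i => ∫ x, D n x * Φ i x ∂μ) l (𝓝 0)) {K : E → ℝ}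
    (hK : Integrable K μ) : Tendsto (fun i => ∫ x, K x * Φ i x ∂μ) l (𝓝 0) := by
  rw [Metric.tendsto_nhds]
  intro δ hδ
  have hM : 0 < |M| + 1 := by positivity
  obtain ⟨n, hn⟩ := hD K hK (δ / 2 / (|M| + 1)) (by positivity)
  filter_upwards [Metric.tendsto_nhds.1 (hlim n) (δ / 2) (half_pos hδ)] with i hi
  rw [Real.dist_0_eq_abs] at hi ⊢
  have hb : ∀ᵐ x ∂μ, ‖Φ i x‖ ≤ M := ae_of_all _ fun x => hΦ i x
  have hKi : Integrable (fun x => K x * Φ i x) μ := hK.mul_bdd (hΦm i) hb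
  have hDi' : Integrable (fun x => D n x * Φ i x) μ := (hDi n).mul_bdd (hΦm i) hb
  have hd : |∫ x, K x * Φ i x ∂μ - ∫ x, D n x * Φ i x ∂μ| ≤ δ / 2 := by
    rw [← integral_sub hKi hDi']
    calc |∫ x, (K x * Φ i x - D n x * Φ i x) ∂μ|
        ≤ ∫ x, |K x - D n x| * (|M| + 1) ∂μ := by
          refine norm_integral_le_of_norm_le (G := ℝ) ((hK.sub (hDi n)).abs.mul_const _)
            (ae_of_all _ fun x => ?_)
          rw [← sub_mul, norm_mul]
          refine mul_le_mul_of_nonneg_left ?_ (abs_nonneg _)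
          exact (hΦ i x).trans ((le_abs_self M).trans (by linarith))
      _ = (∫ x, |K x - D n x| ∂μ) * (|M| + 1) := integral_mul_const _ _
      _ ≤ δ / 2 / (|M| + 1) * (|M| + 1) := by gcongr
      _ = δ / 2 := by field_simp
  have := abs_sub_abs_le_abs_sub (∫ x, K x * Φ i x ∂μ) (∫ x, D n x * Φ i x ∂μ)
  linarith

/-- Gives access to the scaling rule for dilations of pairs (x, z). -/
noncomputable instance {d : ℕ} : (volume : Measure (Rd d × Rd d)).IsAddHaarMeasure :=
  Measure.prod.instIsAddHaarMeasure _ _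

/-! ### The pointwise ergodic theorem for continuous test functions. -/

/-- The integral of the test function `h` against the rescaled field `x ↦ F (τ_{x/ε} ω)`. -/
noncomputable def orbitAverage {d : ℕ} {Ω : Type*} (τ : Rd d → Ω → Ω) (h : Rd d → ℝ) (F : Ω → ℝ)
    (ε : ℝ) (ω : Ω) : ℝ :=
  ∫ x, h x * F (τ (ε⁻¹ • x) ω)

namespace IsStationaryErgodicGroup

variable {d : ℕ} {Ω : Type*} [MeasurableSpace Ω] {P : Measure Ω} {τ : Rd d → Ω → Ω}

theorem integral_apply (hτ : IsStationaryErgodicGroup P τ) {g : Ω → ℝ} (hg : Measurable g)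
    (a : Rd d) : ∫ ω, g (τ a ω) ∂P = ∫ ω, g ω ∂P := by
  conv_rhs => rw [← (hτ.stationary a).map_eq]
  exact (integral_map (hτ.measurable_apply a).aemeasurable hg.aestronglyMeasurable).symm

/-- The conclusion of the ergodic theorem for the test function `h` and the random variable
`F`. -/
def SatisfiesErgodicTheorem (_ : IsStationaryErgodicGroup P τ) (h : Rd d → ℝ) (F : Ω → ℝ) : Prop :=
  ∀ᵐ ω ∂P, Tendsto (fun ε => orbitAverage τ h F ε ω) (𝓝[>] 0) (𝓝 ((∫ ω', F ω' ∂P) * ∫ x, h x))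

theorem SatisfiesErgodicTheorem.const_mul {hτ : IsStationaryErgodicGroup P τ} {h : Rd d → ℝ}
    {F : Ω → ℝ} (hF : hτ.SatisfiesErgodicTheorem h F) (c : ℝ) :
    hτ.SatisfiesErgodicTheorem h fun ω => c * F ω := by
  filter_upwards [hF] with ω hω
  have := hω.const_mul c
  simp only [orbitAverage, ← integral_const_mul, ← mul_assoc] at this ⊢
  simpa only [mul_comm _ c] using this

variable [IsProbabilityMeasure P]

/-- Dilations preserve Lebesgue null sets, so one exceptional set of ω serves all scales at once. -/
theorem ae_orbit_smul (hτ : IsStationaryErgodicGroup P τ) {p : Ω → Prop} (h : ∀ᵐ ω ∂P, p ω) :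
    ∀ᵐ ω ∂P, ∀ c : ℝ, c ≠ 0 → ∀ᵐ x : Rd d, p (τ (c • x) ω) := by
  filter_upwards [hτ.ae_orbit h] with ω hω c hc
  exact (Measure.quasiMeasurePreserving_smul volume hc).ae hω

theorem ae_locallyIntegrable (hτ : IsStationaryErgodicGroup P τ) {F : Ω → ℝ} (hFm : Measurable F)
    (hF : Integrable F P) : ∀ᵐ ω ∂P, LocallyIntegrable (fun x => F (τ x ω)) volume := by
  have h1 : ∀ n : ℕ, ∀ᵐ ω ∂P,
      ∫⁻ x in Metric.closedBall (0 : Rd d) n, ‖F (τ x ω)‖ₑ < ∞ := by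
    intro n
    refine ae_lt_top (f := fun ω => ∫⁻ x in Metric.closedBall (0 : Rd d) n, ‖F (τ x ω)‖ₑ)
      ((hFm.enorm.comp hτ.measurable).lintegral_prod_left') ?_
    rw [hτ.lintegral_setLIntegral_orbit hFm.enorm]
    exact ENNReal.mul_ne_top measure_closedBall_lt_top.ne hF.2.ne
  filter_upwards [ae_all_iff.2 h1] with ω hω
  rw [locallyIntegrable_iff]
  intro k hk
  obtain ⟨R, hR⟩ := hk.isBounded.exists_norm_le
  obtain ⟨n, hn⟩ := exists_nat_ge R
  have : IntegrableOn (fun x => F (τ x ω)) (Metric.closedBall 0 (n : ℝ)) :=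
    ⟨(hFm.comp (hτ.measurable_orbit ω)).aestronglyMeasurable, hω n⟩
  exact this.mono_set fun x hx => mem_closedBall_zero_iff.2 ((hR x hx).trans hn)

theorem SatisfiesErgodicTheorem.congr {hτ : IsStationaryErgodicGroup P τ} {h : Rd d → ℝ}
    {F G : Ω → ℝ} (hF : hτ.SatisfiesErgodicTheorem h F) (hFG : F =ᵐ[P] G) :
    hτ.SatisfiesErgodicTheorem h G := by
  filter_upwards [hF, hτ.ae_orbit_smul hFG] with ω hω h2
  rw [← integral_congr_ae hFG]
  refine hω.congr' ?_
  filter_upwards [self_mem_nhdsWithin] with ε hε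
  refine integral_congr_ae ?_
  filter_upwards [h2 ε⁻¹ (inv_ne_zero (ne_of_gt hε))] with x hx
  rw [hx]

theorem SatisfiesErgodicTheorem.const (hτ : IsStationaryErgodicGroup P τ) (h : Rd d → ℝ) (c : ℝ) :
    hτ.SatisfiesErgodicTheorem h fun _ => c := by
  refine ae_of_all _ fun ω => ?_
  simp only [orbitAverage, integral_mul_const, integral_const, probReal_univ, one_smul, mul_comm c]
  exact tendsto_const_nhds

theorem ae_integrable_mul_orbit (hτ : IsStationaryErgodicGroup P τ) {F : Ω → ℝ}
    (hFm : Measurable F) (hF : Integrable F P) :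
    ∀ᵐ ω ∂P, ∀ h : Rd d → ℝ, IsBoundedTest h volume → ∀ ε : ℝ, 0 < ε →
      Integrable fun x => h x * F (τ (ε⁻¹ • x) ω) := by
  filter_upwards [hτ.ae_locallyIntegrable hFm hF] with ω hω h hh ε hε
  exact hh.integrable_mul (LocallyIntegrable.comp_smul hω (inv_ne_zero hε.ne'))

theorem SatisfiesErgodicTheorem.add {hτ : IsStationaryErgodicGroup P τ} {h : Rd d → ℝ}
    (hh : IsBoundedTest h volume) {F G : Ω → ℝ} (hFm : Measurable F) (hFi : Integrable F P)
    (hGm : Measurable G) (hGi : Integrable G P) (hF : hτ.SatisfiesErgodicTheorem h F)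
    (hG : hτ.SatisfiesErgodicTheorem h G) :
    hτ.SatisfiesErgodicTheorem h fun ω => F ω + G ω := by
  filter_upwards [hF, hG, hτ.ae_integrable_mul_orbit hFm hFi,
    hτ.ae_integrable_mul_orbit hGm hGi] with ω h1 h2 h3 h4
  rw [integral_add hFi hGi, add_mul]
  refine (h1.add h2).congr' ?_
  filter_upwards [self_mem_nhdsWithin] with ε hε
  simp only [orbitAverage, mul_add]
  rw [integral_add (h3 h hh ε hε) (h4 h hh ε hε)]

/-- Averages of bounded coboundaries vanish in the limit. -/
theorem SatisfiesErgodicTheorem.coboundary (hτ : IsStationaryErgodicGroup P τ) {h : Rd d → ℝ}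
    (hc : Continuous h) (hs : HasCompactSupport h) {g : Ω → ℝ} (hgm : Measurable g) {M : ℝ}
    (hg : ∀ ω, |g ω| ≤ M) (a : Rd d) :
    hτ.SatisfiesErgodicTheorem h fun ω => g ω - g (τ a ω) := by
  have hh : IsBoundedTest h volume := IsBoundedTest.of_continuous hc hs
  have hgi : Integrable g P := Integrable.of_bound hgm.aestronglyMeasurable M (ae_of_all _ hg)
  have hE : ∫ ω, (g ω - g (τ a ω)) ∂P = 0 := by
    have hgi' : Integrable (fun ω => g (τ a ω)) P :=
      (hτ.stationary a).integrable_comp_of_integrable hgi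
    rw [integral_sub hgi hgi', hτ.integral_apply hgm, sub_self]
  refine ae_of_all _ fun ω => ?_
  rw [hE, zero_mul]
  -- Substituting x + ε • a for x moves the shift from g to h. The average is then at most M times
  -- this L¹ distance.
  have hlim : Tendsto (fun ε : ℝ => ∫ x, |h (x - ε • a) - h x|) (𝓝[>] 0) (𝓝 0) := by
    refine tendsto_integral_abs_comp_sub hc hs
      (Eventually.of_forall fun ε => continuous_id.sub continuous_const) (fun x => ?_) fun R => ?_
    · have : Tendsto (fun ε : ℝ => x - ε • a) (𝓝 0) (𝓝 (x - (0 : ℝ) • a)) :=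
        (Continuous.tendsto (by fun_prop) 0)
      rw [zero_smul, sub_zero] at this
      exact this.mono_left nhdsWithin_le_nhds
    · refine ⟨R + ‖a‖, ?_⟩
      filter_upwards [Ioo_mem_nhdsGT zero_lt_one] with ε hε x hx
      have h1 : ‖ε • a‖ ≤ ‖a‖ := by
        rw [norm_smul, Real.norm_eq_abs, abs_of_pos hε.1]
        exact mul_le_of_le_one_left (norm_nonneg _) hε.2.le
      calc ‖x‖ = ‖(x - ε • a) + ε • a‖ := by rw [sub_add_cancel]
        _ ≤ _ := (norm_add_le _ _).trans (add_le_add hx h1)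
  have hlim' : Tendsto (fun ε : ℝ => (∫ x, |h (x - ε • a) - h x|) * M) (𝓝[>] 0) (𝓝 0) := by
    simpa using hlim.mul_const M
  refine squeeze_zero_norm' ?_ hlim'
  filter_upwards [self_mem_nhdsWithin] with ε hε
  have hε' : ε ≠ 0 := ne_of_gt hε
  have hgmeas : Measurable fun x : Rd d => g (τ (ε⁻¹ • x) ω) :=
    hgm.comp ((hτ.measurable_orbit ω).comp (measurable_const_smul _))
  have hi : Integrable fun x => h x * g (τ (ε⁻¹ • x) ω) :=
    hh.integrable.mul_bdd hgmeas.aestronglyMeasurable (ae_of_all _ fun x => hg _)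
  have hi3 : Integrable fun x => h (x - ε • a) * g (τ (ε⁻¹ • x) ω) :=
    (hh.integrable.comp_sub_right (ε • a)).mul_bdd hgmeas.aestronglyMeasurable
      (ae_of_all _ fun x => hg _)
  have hshift : ∀ x, h x * g (τ a (τ (ε⁻¹ • x) ω)) =
      (fun x => h (x - ε • a) * g (τ (ε⁻¹ • x) ω)) (x + ε • a) := fun x => by
    simp only [add_sub_cancel_right, smul_add, smul_smul, inv_mul_cancel₀ hε', one_smul,
      hτ.map_add, add_comm a]
  have hi2 : Integrable fun x => h x * g (τ a (τ (ε⁻¹ • x) ω)) := by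
    simp_rw [hshift]
    exact hi3.comp_add_right (ε • a)
  have heq : orbitAverage τ h (fun ω => g ω - g (τ a ω)) ε ω =
      ∫ x, (h x * g (τ (ε⁻¹ • x) ω) - h (x - ε • a) * g (τ (ε⁻¹ • x) ω)) := by
    simp only [orbitAverage, mul_sub]
    rw [integral_sub hi hi2, integral_sub hi hi3]
    simp_rw [hshift]
    rw [integral_add_right_eq_self (fun x => h (x - ε • a) * g (τ (ε⁻¹ • x) ω)) (ε • a)]
  rw [heq, ← integral_mul_const]
  refine norm_integral_le_of_norm_le (G := ℝ)
    ((((hh.integrable.comp_sub_right (ε • a)).sub hh.integrable).abs).mul_const M)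
    (ae_of_all _ fun x => ?_)
  rw [← sub_mul, norm_mul, Real.norm_eq_abs, Real.norm_eq_abs, abs_sub_comm]
  exact mul_le_mul_of_nonneg_left (hg _) (abs_nonneg _)

end IsStationaryErgodicGroup

/-- Turns a bound on averages over integer balls into a bound uniform in ε ≤ 1. The orbit points
seen by h lie in the ball of radius R/ε; as R/ε ≥ 1, rounding this radius up to an integer at most
doubles it, and the powers of ε cancel by scaling. -/
theorem enorm_orbitAverage_le {d : ℕ} {Ω : Type*} {τ : Rd d → Ω → Ω} {h : Rd d → ℝ}
    {M R : ℝ} (hM : ∀ x, |h x| ≤ M)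
    (hR : ∀ x, h x ≠ 0 → ‖x‖ ≤ R) (hR1 : 1 ≤ R) {L : ℝ≥0∞} {F : Ω → ℝ} {ω : Ω}
    (hω : ∀ n : ℕ, 1 ≤ n → ∫⁻ y in Metric.closedBall (0 : Rd d) n, ‖F (τ y ω)‖ₑ ≤
      L * volume (Metric.closedBall (0 : Rd d) (n : ℝ))) {ε : ℝ} (hε : 0 < ε) (hε1 : ε ≤ 1) :
    ‖orbitAverage τ h F ε ω‖ₑ ≤
      ENNReal.ofReal M * (L * volume (Metric.closedBall (0 : Rd d) (2 * R))) := by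
  have hεi : 0 < ε⁻¹ := inv_pos.2 hε
  set n : ℕ := ⌈ε⁻¹ * R⌉₊ with hn
  have hRε : 1 ≤ ε⁻¹ * R := one_le_mul_of_one_le_of_one_le ((one_le_inv₀ hε).2 hε1) hR1
  have hn1 : 1 ≤ n := Nat.one_le_ceil_iff.2 (by linarith)
  have hn2 : (n : ℝ) ≤ ε⁻¹ * (2 * R) := by
    have := (Nat.ceil_lt_add_one (by linarith : 0 ≤ ε⁻¹ * R)).le
    linarith
  let f : Rd d → ℝ≥0∞ := fun y => ENNReal.ofReal M *
    (Metric.closedBall (0 : Rd d) n).indicator (fun y => ‖F (τ y ω)‖ₑ) y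
  have hpt : ∀ x : Rd d, ‖h x * F (τ (ε⁻¹ • x) ω)‖ₑ ≤ f (ε⁻¹ • x) := by
    intro x
    by_cases hx : h x = 0
    · simp [hx]
    · have hmem : ε⁻¹ • x ∈ Metric.closedBall (0 : Rd d) n := by
        rw [mem_closedBall_zero_iff, norm_smul, Real.norm_eq_abs, abs_of_pos hεi]
        exact (mul_le_mul_of_nonneg_left (hR x hx) hεi.le).trans (Nat.le_ceil _)
      simp only [f, Set.indicator_of_mem hmem, enorm_mul]
      gcongr
      rw [Real.enorm_eq_ofReal_abs]
      exact ENNReal.ofReal_le_ofReal (hM x)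
  have hmb : MeasurableSet (Metric.closedBall (0 : Rd d) (n : ℝ)) :=
    Metric.isClosed_closedBall.measurableSet
  have hεd : ENNReal.ofReal |(ε⁻¹ ^ d)⁻¹| * ENNReal.ofReal ε⁻¹ ^ d = 1 := by
    rw [← ENNReal.ofReal_pow hεi.le, ← ENNReal.ofReal_mul (abs_nonneg _),
      abs_of_pos (by positivity), inv_mul_cancel₀ (by positivity), ENNReal.ofReal_one]
  calc ‖orbitAverage τ h F ε ω‖ₑ ≤ ∫⁻ x, ‖h x * F (τ (ε⁻¹ • x) ω)‖ₑ :=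
        enorm_integral_le_lintegral_enorm _
    _ ≤ ∫⁻ x, f (ε⁻¹ • x) := lintegral_mono hpt
    _ = ENNReal.ofReal |(ε⁻¹ ^ d)⁻¹| * (ENNReal.ofReal M *
          ∫⁻ y in Metric.closedBall (0 : Rd d) n, ‖F (τ y ω)‖ₑ) := by
        rw [lintegral_comp_smul _ hεi.ne', finrank_euclideanSpace_fin,
          lintegral_const_mul' _ _ ENNReal.ofReal_ne_top, lintegral_indicator hmb]
    _ ≤ ENNReal.ofReal |(ε⁻¹ ^ d)⁻¹| * (ENNReal.ofReal M *
          (L * volume (Metric.closedBall (0 : Rd d) (ε⁻¹ * (2 * R))))) := by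
        gcongr
        exact (hω n hn1).trans (by gcongr)
    _ = (ENNReal.ofReal |(ε⁻¹ ^ d)⁻¹| * ENNReal.ofReal ε⁻¹ ^ d) * (ENNReal.ofReal M *
          (L * volume (Metric.closedBall (0 : Rd d) (2 * R)))) := by
        rw [volume_closedBall_mul _ hεi.le (by linarith)]; ring
    _ = _ := by rw [hεd, one_mul]

namespace IsStationaryErgodicGroup

variable {d : ℕ} {Ω : Type*} [MeasurableSpace Ω] {P : Measure Ω} {τ : Rd d → Ω → Ω}

variable [IsProbabilityMeasure P]

/-- The ergodic theorem is stable under approximation in `L¹`, by the maximal inequality. -/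
theorem SatisfiesErgodicTheorem.of_approx (hτ : IsStationaryErgodicGroup P τ) {h : Rd d → ℝ}
    (hh : IsBoundedTest h volume) {F : Ω → ℝ} (hFm : Measurable F) (hFi : Integrable F P)
    (happ : ∀ δ : ℝ, 0 < δ → ∃ G : Ω → ℝ, Measurable G ∧ Integrable G P ∧
      hτ.SatisfiesErgodicTheorem h G ∧ ∫ ω, |F ω - G ω| ∂P ≤ δ) :
    hτ.SatisfiesErgodicTheorem h F := by
  obtain ⟨M, hM⟩ := hh.bounded
  obtain ⟨R₀, hR₀⟩ := hh.support
  set R := max R₀ 1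
  have hR : ∀ x, h x ≠ 0 → ‖x‖ ≤ R := fun x hx => (hR₀ x hx).trans (le_max_left _ _)
  set V := (volume (Metric.closedBall (0 : Rd d) (2 * R))).toReal with hV
  have hM0 : 0 ≤ M := (abs_nonneg _).trans (hM 0)
  have hVE : volume (Metric.closedBall (0 : Rd d) (2 * R)) = ENNReal.ofReal V :=
    (ENNReal.ofReal_toReal measure_closedBall_lt_top.ne).symm
  have hV0 : 0 ≤ V := ENNReal.toReal_nonneg
  -- Tolerances are restricted to a sequence so that countably many null sets suffice.
  suffices hk : ∀ k : ℕ, ∀ᵐ ω ∂P, ∀ᶠ ε in 𝓝[>] (0 : ℝ),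
      |orbitAverage τ h F ε ω - (∫ ω', F ω' ∂P) * ∫ x, h x| < 1 / ((k : ℝ) + 1) by
    filter_upwards [ae_all_iff.2 hk] with ω hω
    rw [Metric.tendsto_nhds]
    intro ρ hρ
    obtain ⟨k, hk⟩ := exists_nat_one_div_lt hρ
    filter_upwards [hω k] with ε hε
    exact hε.trans hk
  intro k
  set lam : ℝ := 1 / ((k : ℝ) + 1) with hlam
  have hlam0 : 0 < lam := Nat.one_div_pos_of_nat
  -- Chosen so that M * (L * V) ≤ lam / 4; the `+ 1` keeps the denominator positive.
  set L : ℝ := lam / 4 / (M * V + 1) with hL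
  have hL0 : 0 < L := by positivity
  rw [ae_iff]
  set bad : Set Ω := {ω | ¬ ∀ᶠ ε in 𝓝[>] (0 : ℝ),
      |orbitAverage τ h F ε ω - (∫ ω', F ω' ∂P) * ∫ x, h x| < lam} with hbad
  set I := ∫ x, h x with hI
  -- The level L is independent of δ. Off the set where the maximal function of F - G exceeds L, the
  -- errors from F - G, from the convergence for G and from the two means are each at most lam / 4.
  -- Letting δ tend to 0 makes `bad` null.
  have key : ∀ δ : ℝ, 0 < δ → δ * (|I| + 1) ≤ lam / 4 →
      ENNReal.ofReal L * P bad ≤ 10 ^ d * ENNReal.ofReal δ := by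
    intro δ hδ hδ1
    obtain ⟨G, hGm, hGi, hG, hFG⟩ := happ δ hδ
    set S : Set Ω := {ω | ∃ n : ℕ, 1 ≤ n ∧
      ENNReal.ofReal L * volume (Metric.closedBall (0 : Rd d) (n : ℝ)) <
        ∫⁻ y in Metric.closedBall 0 n, ‖F (τ y ω) - G (τ y ω)‖ₑ}
    have hS : ENNReal.ofReal L * P S ≤ 10 ^ d * ENNReal.ofReal δ := by
      refine (hτ.mul_measure_average_lt_le (hFm.sub hGm).enorm (ENNReal.ofReal L)).trans ?_
      gcongr
      rw [← ofReal_integral_norm_eq_lintegral_enorm (hFi.sub hGi)]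
      exact ENNReal.ofReal_le_ofReal hFG
    have hsub : bad ≤ᵐ[P] S := by
      filter_upwards [hG, hτ.ae_integrable_mul_orbit hFm hFi,
        hτ.ae_integrable_mul_orbit hGm hGi] with ω h1 h2 h3 hω
      by_contra hωS
      refine hω ?_
      have hωS' : ∀ n : ℕ, 1 ≤ n →
          ∫⁻ y in Metric.closedBall (0 : Rd d) n, ‖(F - G) (τ y ω)‖ₑ ≤
            ENNReal.ofReal L * volume (Metric.closedBall (0 : Rd d) (n : ℝ)) := fun n hn => by
        by_contra hlt
        exact hωS ⟨n, hn, not_le.1 hlt⟩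
      filter_upwards [Metric.tendsto_nhds.1 h1 (lam / 4) (by positivity),
        Ioo_mem_nhdsGT zero_lt_one] with ε hε hε1
      have h4 := enorm_orbitAverage_le hM hR (le_max_right _ _) hωS' hε1.1 hε1.2.le
      rw [hVE, ← ENNReal.ofReal_mul hL0.le, ← ENNReal.ofReal_mul hM0,
        Real.enorm_eq_ofReal_abs, ENNReal.ofReal_le_ofReal_iff (by positivity)] at h4
      have h5 : orbitAverage τ h (F - G) ε ω =
          orbitAverage τ h F ε ω - orbitAverage τ h G ε ω := by
        simp only [orbitAverage, Pi.sub_apply, mul_sub]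
        exact integral_sub (h2 h hh ε hε1.1) (h3 h hh ε hε1.1)
      have h6 : M * (L * V) ≤ lam / 4 := by
        have : M * (L * V) = lam / 4 * (M * V / (M * V + 1)) := by rw [hL]; ring
        rw [this]
        refine mul_le_of_le_one_right (by positivity) ?_
        rw [div_le_one (by positivity)]
        linarith
      have h7 : |(∫ ω', G ω' ∂P) * I - (∫ ω', F ω' ∂P) * I| ≤ lam / 4 := by
        rw [← sub_mul, abs_mul, abs_sub_comm, ← integral_sub hFi hGi]
        calc |∫ ω', (F ω' - G ω') ∂P| * |I| ≤ δ * (|I| + 1) := by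
              refine mul_le_mul (abs_integral_le_integral_abs.trans hFG) (by linarith)
                (abs_nonneg _) hδ.le
          _ ≤ lam / 4 := hδ1
      rw [Real.dist_eq] at hε
      rw [h5] at h4
      have h8 : orbitAverage τ h F ε ω - (∫ ω', F ω' ∂P) * I =
        (orbitAverage τ h F ε ω - orbitAverage τ h G ε ω) +
        (orbitAverage τ h G ε ω - (∫ ω', G ω' ∂P) * I) +
        ((∫ ω', G ω' ∂P) * I - (∫ ω', F ω' ∂P) * I) := by ring
      rw [h8]
      have h9 := abs_add_three (orbitAverage τ h F ε ω - orbitAverage τ h G ε ω)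
        (orbitAverage τ h G ε ω - (∫ ω', G ω' ∂P) * I)
        ((∫ ω', G ω' ∂P) * I - (∫ ω', F ω' ∂P) * I)
      linarith
    calc ENNReal.ofReal L * P bad ≤ ENNReal.ofReal L * P S := by
          gcongr 1
          exact measure_mono_ae hsub
      _ ≤ _ := hS
  have hlim : Tendsto (fun δ : ℝ => 10 ^ d * ENNReal.ofReal δ) (𝓝[>] 0) (𝓝 0) := by
    have : Tendsto (fun δ : ℝ => 10 ^ d * ENNReal.ofReal δ) (𝓝 0)
        (𝓝 (10 ^ d * ENNReal.ofReal 0)) :=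
      ENNReal.Tendsto.const_mul (ENNReal.continuous_ofReal.tendsto 0) (Or.inr (by finiteness))
    simp only [ENNReal.ofReal_zero, mul_zero] at this
    exact this.mono_left nhdsWithin_le_nhds
  have hzero : ENNReal.ofReal L * P bad ≤ 0 := by
    refine ge_of_tendsto hlim ?_
    filter_upwards [Ioo_mem_nhdsGT (show 0 < lam / 4 / (|I| + 1) by positivity)] with δ hδ
    exact key δ hδ.1 ((le_div_iff₀ (by positivity)).1 hδ.2.le)
  have := nonpos_iff_eq_zero.1 hzero
  rcases mul_eq_zero.1 this with h0 | h0
  · exact absurd h0 (ENNReal.ofReal_pos.2 hL0).ne'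
  · exact h0

theorem integral_abs_le_norm_Lp_two (u : Lp ℝ 2 P) : ∫ ω, |u ω| ∂P ≤ ‖u‖ := by
  have hi : Integrable u P := (Lp.memLp u).integrable one_le_two
  have h1 : eLpNorm u 1 P ≤ eLpNorm u 2 P :=
    eLpNorm_le_eLpNorm_of_exponent_le one_le_two (Lp.aestronglyMeasurable u)
  rw [eLpNorm_one_eq_lintegral_enorm, ← ofReal_integral_norm_eq_lintegral_enorm hi] at h1
  rw [Lp.norm_def]
  have := ENNReal.toReal_mono (Lp.eLpNorm_ne_top u) h1
  rwa [ENNReal.toReal_ofReal (integral_nonneg fun _ => norm_nonneg _)] at this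

/-- The **pointwise ergodic theorem** tested against a continuous compactly supported function. -/
theorem satisfiesErgodicTheorem_of_continuous (hτ : IsStationaryErgodicGroup P τ) {h : Rd d → ℝ}
    (hc : Continuous h) (hs : HasCompactSupport h) {F : Ω → ℝ} (hFm : Measurable F)
    (hFi : Integrable F P) : hτ.SatisfiesErgodicTheorem h F := by
  have hh : IsBoundedTest h volume := IsBoundedTest.of_continuous hc hs
  have hmeas : ∀ u : Lp ℝ 2 P, Measurable u := fun u => (Lp.stronglyMeasurable u).measurable
  have hint : ∀ u : Lp ℝ 2 P, Integrable u P := fun u => (Lp.memLp u).integrable one_le_two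
  have hind : ∀ (A : Set Ω) (hA : MeasurableSet A),
      indicatorConstLp 2 hA (measure_ne_top P _) (1 : ℝ) =ᵐ[P] A.indicator 1 :=
    fun A hA => indicatorConstLp_coeFn
  have hspan : ∀ u ∈ Submodule.span ℝ hτ.coboundaries, hτ.SatisfiesErgodicTheorem h u := by
    intro u hu
    induction hu using Submodule.span_induction with
    | mem v hv =>
      rcases hv with rfl | ⟨A, hA, a, rfl⟩
      · refine (SatisfiesErgodicTheorem.const hτ h 1).congr ?_
        filter_upwards [hind _ MeasurableSet.univ] with ω hω
        rw [hω, Set.indicator_univ, Pi.one_apply]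
      · refine (SatisfiesErgodicTheorem.coboundary hτ hc hs (g := A.indicator 1) (M := 1)
          (measurable_one.indicator hA) (fun ω => ?_) a).congr ?_
        · by_cases hω : ω ∈ A <;> simp [hω]
        · filter_upwards [hind _ hA, hind _ (hτ.measurable_apply a hA),
            Lp.coeFn_sub (indicatorConstLp 2 hA (measure_ne_top P _) (1 : ℝ))
              (indicatorConstLp 2 (hτ.measurable_apply a hA) (measure_ne_top P _) (1 : ℝ))]
            with ω h1 h2 h3
          rw [h3, Pi.sub_apply, h1, h2]
          rfl
    | zero =>
      refine (SatisfiesErgodicTheorem.const hτ h 0).congr ?_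
      filter_upwards [Lp.coeFn_zero ℝ 2 P] with ω hω
      rw [hω, Pi.zero_apply]
    | add v w _ _ hv hw =>
      refine (SatisfiesErgodicTheorem.add hh (hmeas v) (hint v) (hmeas w) (hint w) hv hw).congr ?_
      filter_upwards [Lp.coeFn_add v w] with ω hω
      rw [hω, Pi.add_apply]
    | smul c v _ hv =>
      refine (hv.const_mul c).congr ?_
      filter_upwards [Lp.coeFn_smul c v] with ω hω
      rw [hω, Pi.smul_apply, smul_eq_mul]
  -- The L² norm dominates the L¹ norm, so density of the span in L² already gives L¹
  -- approximations; simple functions then lead from L² to L¹.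
  have hL2 : ∀ u : Lp ℝ 2 P, hτ.SatisfiesErgodicTheorem h u := by
    intro u
    refine SatisfiesErgodicTheorem.of_approx hτ hh (hmeas u) (hint u) fun δ hδ => ?_
    have hu : u ∈ (Submodule.span ℝ hτ.coboundaries).topologicalClosure := by
      rw [hτ.topologicalClosure_span_coboundaries]; trivial
    obtain ⟨v, hv, huv⟩ := Metric.mem_closure_iff.1 hu δ hδ
    refine ⟨v, hmeas v, hint v, hspan v hv, ?_⟩
    rw [dist_eq_norm] at huv
    refine le_trans (le_of_eq (integral_congr_ae ?_))
      ((integral_abs_le_norm_Lp_two (u - v)).trans huv.le)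
    filter_upwards [Lp.coeFn_sub u v] with ω hω
    rw [hω, Pi.sub_apply]
  refine SatisfiesErgodicTheorem.of_approx hτ hh hFm hFi fun δ hδ => ?_
  obtain ⟨s, hs1, -⟩ := (memLp_one_iff_integrable.2 hFi).exists_simpleFunc_eLpNorm_sub_lt
    ENNReal.one_ne_top (ENNReal.ofReal_pos.2 hδ).ne'
  have hs2 : MemLp s 2 P := s.memLp_of_isFiniteMeasure 2 P
  have hsi : Integrable s P := hs2.integrable one_le_two
  refine ⟨s, s.measurable, hsi, (hL2 (hs2.toLp s)).congr hs2.coeFn_toLp, ?_⟩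
  rw [eLpNorm_one_eq_lintegral_enorm, ← ofReal_integral_norm_eq_lintegral_enorm (hFi.sub hsi)]
    at hs1
  exact ((ENNReal.ofReal_lt_ofReal_iff hδ).1 hs1).le

end IsStationaryErgodicGroup

/-! ### One event for all test functions, and tails of the rescaled fields. -/

/-- A continuous function with values in `[0, 1]`, equal to one on the ball of radius `R`. -/
noncomputable def cutoff {E : Type*} [NormedAddCommGroup E] (R : ℝ) (x : E) : ℝ :=
  max 0 (min 1 (R + 1 - ‖x‖))

section Cutoff

variable {E : Type*} [NormedAddCommGroup E]

theorem continuous_cutoff (R : ℝ) : Continuous (cutoff R : E → ℝ) := by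
  unfold cutoff; fun_prop

theorem hasCompactSupport_cutoff [ProperSpace E] (R : ℝ) :
    HasCompactSupport (cutoff R : E → ℝ) := by
  refine HasCompactSupport.of_support_subset_isCompact (isCompact_closedBall 0 (R + 1)) ?_
  intro x hx
  rw [mem_closedBall_zero_iff]
  by_contra hlt
  refine hx ?_
  rw [cutoff, max_eq_left]
  exact (min_le_right _ _).trans (by linarith)

theorem cutoff_nonneg (R : ℝ) (x : E) : 0 ≤ cutoff R x := le_max_left _ _

theorem cutoff_eq_one {R : ℝ} {x : E} (hx : ‖x‖ ≤ R) : cutoff R x = 1 := by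
  rw [cutoff, min_eq_left (by linarith), max_eq_right zero_le_one]

end Cutoff

theorem abs_sub_min_natCast_le {a : ℝ} (ha : 0 ≤ a) (n : ℕ) : |a - min a n| ≤ a := by
  have h1 : 0 ≤ min a n := le_min ha (Nat.cast_nonneg n)
  rw [abs_of_nonneg (sub_nonneg.2 (min_le_left _ _))]
  linarith

theorem abs_min_natCast_le {a : ℝ} (ha : 0 ≤ a) (n : ℕ) : |min a n| ≤ n := by
  rw [abs_of_nonneg (le_min ha (Nat.cast_nonneg n))]
  exact min_le_right _ _

section Truncation

variable {Ω : Type*} [MeasurableSpace Ω] {P : Measure Ω}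

theorem MeasureTheory.Integrable.min_natCast {F : Ω → ℝ} (hFi : Integrable F P) (hFm : Measurable F)
    (hF : ∀ ω, 0 ≤ F ω) (n : ℕ) : Integrable (fun ω => min (F ω) n) P := by
  refine hFi.mono' (hFm.min measurable_const).aestronglyMeasurable (ae_of_all _ fun ω => ?_)
  rw [Real.norm_eq_abs, abs_of_nonneg (le_min (hF ω) (Nat.cast_nonneg n))]
  exact min_le_left _ _

theorem tendsto_integral_sub_min {F : Ω → ℝ} (hFm : Measurable F) (hFi : Integrable F P)
    (hF : ∀ ω, 0 ≤ F ω) : Tendsto (fun n : ℕ => ∫ ω, (F ω - min (F ω) n) ∂P) atTop (𝓝 0) := by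
  have : Tendsto (fun n : ℕ => ∫ ω, (F ω - min (F ω) n) ∂P) atTop (𝓝 (∫ _, (0 : ℝ) ∂P)) := by
    refine tendsto_integral_of_dominated_convergence F
      (fun n => (hFm.sub (hFm.min measurable_const)).aestronglyMeasurable) hFi
      (fun n => ae_of_all _ fun ω => abs_sub_min_natCast_le (hF ω) n) (ae_of_all _ fun ω => ?_)
    refine tendsto_const_nhds.congr' ?_
    obtain ⟨N, hN⟩ := exists_nat_ge (F ω)
    filter_upwards [eventually_ge_atTop N] with n hn
    rw [min_eq_left (hN.trans (by exact_mod_cast hn)), sub_self]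
  simpa using this

end Truncation

theorem IsBoundedTest.indicator_closedBall {E : Type*} [NormedAddCommGroup E] [MeasurableSpace E]
    [BorelSpace E] (μ : Measure E) (R : ℝ) :
    IsBoundedTest ((Metric.closedBall (0 : E) R).indicator (fun _ => (1 : ℝ))) μ := by
  refine ⟨(measurable_const.indicator Metric.isClosed_closedBall.measurableSet).aemeasurable,
    ⟨1, fun x => ?_⟩, ⟨R, fun x hx => ?_⟩⟩
  · by_cases h : x ∈ Metric.closedBall (0 : E) R <;> simp [h]
  · exact mem_closedBall_zero_iff.1 (Set.mem_of_indicator_ne_zero hx)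

/-- The integral of the rescaled field over a ball. -/
theorem orbitAverage_indicator {d : ℕ} {Ω : Type*} (τ : Rd d → Ω → Ω) (F : Ω → ℝ)
    (R ε : ℝ) (ω : Ω) :
    orbitAverage τ ((Metric.closedBall 0 R).indicator fun _ => 1) F ε ω =
      ∫ x in Metric.closedBall (0 : Rd d) R, F (τ (ε⁻¹ • x) ω) := by
  rw [orbitAverage, ← integral_indicator Metric.isClosed_closedBall.measurableSet]
  refine integral_congr_ae (ae_of_all _ fun x => ?_)
  by_cases hx : x ∈ Metric.closedBall (0 : Rd d) R <;> simp [hx]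

namespace IsStationaryErgodicGroup

variable {d : ℕ} {Ω : Type*} [MeasurableSpace Ω] {P : Measure Ω} [IsProbabilityMeasure P]
  {τ : Rd d → Ω → Ω}

/-- For bounded F the averages are Lipschitz in h for the L¹ norm, uniformly in ε. The null sets of
a countable dense family therefore suffice for every integrable h. -/
theorem ae_tendsto_of_bounded (hτ : IsStationaryErgodicGroup P τ) {F : Ω → ℝ} (hFm : Measurable F)
    {M : ℝ} (hF : ∀ ω, |F ω| ≤ M) : ∀ᵐ ω ∂P, ∀ h : Rd d → ℝ, Integrable h →
      Tendsto (fun ε => orbitAverage τ h F ε ω) (𝓝[>] 0) (𝓝 ((∫ ω', F ω' ∂P) * ∫ x, h x)) := by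
  have hFi : Integrable F P := Integrable.of_bound hFm.aestronglyMeasurable M (ae_of_all _ hF)
  obtain ⟨D, hD, hdense⟩ := exists_seq_continuous_dense (μ := (volume : Measure (Rd d)))
  have hDi : ∀ n, Integrable (D n) volume :=
    fun n => (hD n).1.integrable_of_hasCompactSupport (hD n).2
  have h1 := fun n => hτ.satisfiesErgodicTheorem_of_continuous (hD n).1 (hD n).2 hFm hFi
  set m := ∫ ω', F ω' ∂P with hm
  have hmM : |m| ≤ M := by
    have := norm_integral_le_of_norm_le_const (f := F) (μ := P) (C := M) (ae_of_all P hF)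
    simpa using this
  filter_upwards [ae_all_iff.2 h1] with ω hω h hh
  have hmeas : ∀ ε : ℝ, AEStronglyMeasurable (fun x : Rd d => F (τ (ε⁻¹ • x) ω) - m) volume :=
    fun ε => ((hFm.comp ((hτ.measurable_orbit ω).comp
      (measurable_const_smul _))).sub_const m).aestronglyMeasurable
  have heq : ∀ (h : Rd d → ℝ), Integrable h → ∀ ε,
      orbitAverage τ h F ε ω - m * ∫ x, h x = ∫ x, h x * (F (τ (ε⁻¹ • x) ω) - m) := by
    intro h hh ε
    simp only [orbitAverage, mul_sub]
    rw [integral_sub, integral_mul_const, mul_comm m]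
    · refine hh.mul_bdd (c := M) ?_ (ae_of_all _ fun x => hF _)
      exact (hFm.comp ((hτ.measurable_orbit ω).comp
        (measurable_const_smul _))).aestronglyMeasurable
    · exact hh.mul_const m
  have key : Tendsto (fun ε : ℝ => ∫ x, h x * (F (τ (ε⁻¹ • x) ω) - m)) (𝓝[>] 0) (𝓝 0) := by
    refine tendsto_integral_mul_of_dense hDi hdense hmeas (M := M + M)
      (fun ε x => (abs_sub _ _).trans (add_le_add (hF _) hmM)) (fun n => ?_) hh
    simp_rw [← heq (D n) (hDi n)]
    exact tendsto_sub_nhds_zero_iff.2 (hω n)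
  simp_rw [← heq h hh] at key
  exact tendsto_sub_nhds_zero_iff.1 key

/-- The **pointwise ergodic theorem** as weak convergence of the rescaled field, on an event that
does not depend on the test function. -/
theorem ae_tendsto_orbitAverage (hτ : IsStationaryErgodicGroup P τ) {F : Ω → ℝ}
    (hFm : Measurable F) (hFi : Integrable F P) (hF : ∀ ω, 0 ≤ F ω) :
    ∀ᵐ ω ∂P, ∀ h : Rd d → ℝ, IsBoundedTest h volume →
      Tendsto (fun ε => orbitAverage τ h F ε ω) (𝓝[>] 0) (𝓝 ((∫ ω', F ω' ∂P) * ∫ x, h x)) := by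
  have hTm : ∀ n : ℕ, Measurable fun ω => min (F ω) n := fun n => hFm.min measurable_const
  have hTi : ∀ n : ℕ, Integrable (fun ω => min (F ω) n) P := hFi.min_natCast hFm hF
  have htm : ∀ n : ℕ, Measurable fun ω => F ω - min (F ω) n := fun n => hFm.sub (hTm n)
  have hti : ∀ n : ℕ, Integrable (fun ω => F ω - min (F ω) n) P := fun n => hFi.sub (hTi n)
  have ht0 : ∀ (n : ℕ) ω, 0 ≤ F ω - min (F ω) n := fun n ω => sub_nonneg.2 (min_le_left _ _)
  have h1 := fun n : ℕ => hτ.ae_tendsto_of_bounded (hTm n) (fun ω => abs_min_natCast_le (hF ω) n)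
  -- The tail F - F ∧ n is tested only against cutoffs of integer radius: they dominate every
  -- bounded test function up to a factor, so again countably many events are enough.
  have h2 := fun n : ℕ => ae_all_iff.2 fun R : ℕ => hτ.satisfiesErgodicTheorem_of_continuous
    (continuous_cutoff (R : ℝ)) (hasCompactSupport_cutoff (R : ℝ)) (htm n) (hti n)
  filter_upwards [ae_all_iff.2 h1, ae_all_iff.2 h2, hτ.ae_integrable_mul_orbit hFm hFi,
    ae_all_iff.2 fun n => hτ.ae_integrable_mul_orbit (hTm n) (hTi n)] with ω h1 h2 h3 h4 h hh
  obtain ⟨M, hM⟩ := hh.bounded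
  obtain ⟨R₀, hR₀⟩ := hh.support
  obtain ⟨R, hR⟩ := exists_nat_ge R₀
  have hM0 : 0 ≤ M := (abs_nonneg _).trans (hM 0)
  set C : ℝ := M * ∫ x : Rd d, cutoff (R : ℝ) x with hC
  have hC0 : 0 ≤ C := mul_nonneg hM0 (integral_nonneg (cutoff_nonneg _))
  have hcut : IsBoundedTest (cutoff (R : ℝ) : Rd d → ℝ) volume :=
    IsBoundedTest.of_continuous (continuous_cutoff _) (hasCompactSupport_cutoff _)
  have hhc : ∀ x, |h x| ≤ M * cutoff (R : ℝ) x := fun x => by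
    by_cases hx : h x = 0
    · rw [hx, abs_zero]
      exact mul_nonneg hM0 (cutoff_nonneg _ _)
    · rw [cutoff_eq_one ((hR₀ x hx).trans hR), mul_one]
      exact hM x
  have hhC : |∫ x, h x| ≤ C := by
    rw [hC, ← integral_const_mul]
    exact norm_integral_le_of_norm_le (G := ℝ) (hcut.integrable.const_mul M) (ae_of_all _ hhc)
  rw [Metric.tendsto_nhds]
  intro δ hδ
  obtain ⟨n, hn⟩ := ((tendsto_order.1 (tendsto_integral_sub_min hFm hFi hF)).2
    (δ / 4 / (C + 1)) (by positivity)).exists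
  set t := ∫ ω, (F ω - min (F ω) n) ∂P with ht
  have ht0' : 0 ≤ t := integral_nonneg (ht0 n)
  have htC : t * C ≤ δ / 4 := by
    have := (lt_div_iff₀ (by positivity)).1 hn
    nlinarith
  have hFt : ∫ ω, F ω ∂P = ∫ ω, min (F ω) n ∂P + t := by
    rw [ht, integral_sub hFi (hTi n)]; ring
  have h2' := (h2 n R).const_mul M
  rw [show M * (t * ∫ x : Rd d, cutoff (R : ℝ) x) = t * C by rw [hC]; ring] at h2'
  filter_upwards [Metric.tendsto_nhds.1 (h1 n h hh.integrable) (δ / 4) (by positivity),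
    (tendsto_order.1 h2').2 (δ / 2) (by linarith), self_mem_nhdsWithin] with ε hε1 hε2 hε
  have e1 : orbitAverage τ h F ε ω - orbitAverage τ h (fun ω => min (F ω) n) ε ω =
      ∫ x, h x * (F (τ (ε⁻¹ • x) ω) - min (F (τ (ε⁻¹ • x) ω)) n) := by
    simp only [orbitAverage, mul_sub]
    exact (integral_sub (h3 h hh ε hε) (h4 n h hh ε hε)).symm
  have e2 : |∫ x, h x * (F (τ (ε⁻¹ • x) ω) - min (F (τ (ε⁻¹ • x) ω)) n)| ≤
      M * orbitAverage τ (cutoff (R : ℝ)) (fun ω => F ω - min (F ω) n) ε ω := by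
    rw [orbitAverage, ← integral_const_mul]
    refine norm_integral_le_of_norm_le (G := ℝ) ?_ (ae_of_all _ fun x => ?_)
    · simp only [mul_sub]
      exact ((h3 _ hcut ε hε).const_mul M).sub ((h4 n _ hcut ε hε).const_mul M)
    · rw [norm_mul, Real.norm_eq_abs, Real.norm_eq_abs, abs_of_nonneg (ht0 n _), ← mul_assoc]
      exact mul_le_mul_of_nonneg_right (hhc x) (ht0 n _)
  have e3 : |t * ∫ x, h x| ≤ δ / 4 := by
    rw [abs_mul, abs_of_nonneg ht0']
    exact (mul_le_mul_of_nonneg_left hhC ht0').trans htC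
  rw [Real.dist_eq] at hε1 ⊢
  rw [hFt, show orbitAverage τ h F ε ω - (∫ ω, min (F ω) n ∂P + t) * ∫ x, h x =
    (orbitAverage τ h F ε ω - orbitAverage τ h (fun ω => min (F ω) n) ε ω) +
    (orbitAverage τ h (fun ω => min (F ω) n) ε ω - (∫ ω, min (F ω) n ∂P) * ∫ x, h x) +
    (-(t * ∫ x, h x)) by ring]
  have e4 := abs_add_three
    (orbitAverage τ h F ε ω - orbitAverage τ h (fun ω => min (F ω) n) ε ω)
    (orbitAverage τ h (fun ω => min (F ω) n) ε ω - (∫ ω, min (F ω) n ∂P) * ∫ x, h x)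
    (-(t * ∫ x, h x))
  rw [abs_neg] at e4
  rw [e1] at e4 ⊢
  linarith

/-- Local uniform integrability of the rescaled fields. -/
theorem ae_eventually_tail_le (hτ : IsStationaryErgodicGroup P τ) {F : Ω → ℝ}
    (hFm : Measurable F) (hFi : Integrable F P) (hF : ∀ ω, 0 ≤ F ω) :
    ∀ᵐ ω ∂P, ∀ R δ : ℝ, 0 < δ → ∀ᶠ n : ℕ in atTop, ∀ᶠ ε in 𝓝[>] (0 : ℝ),
      ∫ x in Metric.closedBall (0 : Rd d) R,
        (F (τ (ε⁻¹ • x) ω) - min (F (τ (ε⁻¹ • x) ω)) n) ≤ δ := by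
  have h1 := fun n : ℕ => hτ.ae_tendsto_orbitAverage (hFm.sub (hFm.min measurable_const))
    (hFi.sub (hFi.min_natCast hFm hF n)) (fun ω => sub_nonneg.2 (min_le_left (F ω) (n : ℝ)))
  filter_upwards [ae_all_iff.2 h1] with ω hω R δ hδ
  have h2 := (tendsto_integral_sub_min hFm hFi hF).mul_const
    (∫ x : Rd d, (Metric.closedBall (0 : Rd d) R).indicator (fun _ => (1 : ℝ)) x)
  rw [zero_mul] at h2
  filter_upwards [(tendsto_order.1 h2).2 δ hδ] with n hn
  have h3 := hω n _ (IsBoundedTest.indicator_closedBall volume R)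
  simp only [orbitAverage_indicator] at h3
  exact ((tendsto_order.1 h3).2 δ hn).mono fun ε hε => hε.le

theorem ae_eventually_bounded (hτ : IsStationaryErgodicGroup P τ) {F : Ω → ℝ}
    (hFm : Measurable F) (hFi : Integrable F P) (hF : ∀ ω, 0 ≤ F ω) :
    ∀ᵐ ω ∂P, ∀ R : ℝ, ∃ C : ℝ, ∀ᶠ ε in 𝓝[>] (0 : ℝ),
      ∫ x in Metric.closedBall (0 : Rd d) R, F (τ (ε⁻¹ • x) ω) ≤ C := by
  filter_upwards [hτ.ae_tendsto_orbitAverage hFm hFi hF] with ω hω R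
  have h3 := hω _ (IsBoundedTest.indicator_closedBall volume R)
  simp only [orbitAverage_indicator] at h3
  exact ⟨_, ((tendsto_order.1 h3).2 _ (lt_add_one _)).mono fun ε hε => hε.le⟩

end IsStationaryErgodicGroup

/-! ### Almost sure convergence from decaying covariances. -/

/-- By Tonelli the series of squares has finite expectation, so it converges almost surely and its
terms vanish in the limit. -/
theorem ae_tendsto_zero_of_summable_integral_sq {Ω : Type*} [MeasurableSpace Ω] {P : Measure Ω}
    {X : ℕ → Ω → ℝ} (hXi : ∀ k, Integrable (fun ω => X k ω ^ 2) P)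
    (hs : Summable fun k => ∫ ω, X k ω ^ 2 ∂P) :
    ∀ᵐ ω ∂P, Tendsto (fun k => X k ω) atTop (𝓝 0) := by
  have h1 : ∫⁻ ω, ∑' k, ENNReal.ofReal (X k ω ^ 2) ∂P ≠ ∞ := by
    rw [lintegral_tsum fun k => (hXi k).aemeasurable.ennreal_ofReal]
    simp_rw [← fun k => ofReal_integral_eq_lintegral_ofReal (hXi k)
      (ae_of_all _ fun ω => sq_nonneg _)]
    exact hs.tsum_ofReal_ne_top
  filter_upwards [ae_lt_top' (AEMeasurable.tsum fun k =>
    (hXi k).aemeasurable.ennreal_ofReal) h1] with ω hω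
  have h2 := ENNReal.tendsto_atTop_zero_of_tsum_ne_top hω.ne
  have h3 := (ENNReal.tendsto_toReal ENNReal.zero_ne_top).comp h2
  simp only [Function.comp_def, ENNReal.toReal_ofReal (sq_nonneg _), ENNReal.toReal_zero] at h3
  have h4 := (Real.continuous_sqrt.tendsto 0).comp h3
  simp only [Function.comp_def, Real.sqrt_sq_eq_abs, Real.sqrt_zero] at h4
  exact tendsto_zero_iff_abs_tendsto_zero _ |>.2 h4

/-- The second moment of an integral of a random field against a test function. -/
theorem integral_sq_integral_mul_le {Ω E : Type*} [MeasurableSpace Ω] [MeasurableSpace E]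
    {P : Measure Ω} [IsProbabilityMeasure P] {μ : Measure E} [SigmaFinite μ] {W : Ω → E → ℝ}
    (hWm : Measurable (Function.uncurry W)) {B : ℝ} (hW : ∀ ω q, |W ω q| ≤ B) {h : E → ℝ}
    (hh : Integrable h μ) {c : E × E → ℝ}
    (hcov : ∀ q q', |∫ ω, W ω q * W ω q' ∂P| ≤ c (q, q'))
    (hc : Integrable (fun r : E × E => |h r.1| * |h r.2| * c r) (μ.prod μ)) :
    ∫ ω, (∫ q, h q * W ω q ∂μ) ^ 2 ∂P ≤ ∫ r : E × E, |h r.1| * |h r.2| * c r ∂(μ.prod μ) := by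
  have hhh : Integrable (fun r : E × E => h r.1 * h r.2) (μ.prod μ) := hh.mul_prod hh
  have hWW : Measurable fun s : Ω × (E × E) => W s.1 s.2.1 * W s.1 s.2.2 :=
    (hWm.comp (measurable_fst.prodMk (measurable_fst.comp measurable_snd))).mul
      (hWm.comp (measurable_fst.prodMk (measurable_snd.comp measurable_snd)))
  have hWWb : ∀ ω q q', |W ω q * W ω q'| ≤ B * B := fun ω q q' => by
    rw [abs_mul]
    exact mul_le_mul (hW _ _) (hW _ _) (abs_nonneg _) ((abs_nonneg _).trans (hW ω q))
  have hint : Integrable (Function.uncurry fun (ω : Ω) (r : E × E) =>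
      (h r.1 * h r.2) * (W ω r.1 * W ω r.2)) (P.prod (μ.prod μ)) :=
    (hhh.comp_snd P).mul_bdd (c := B * B) hWW.aestronglyMeasurable
      (ae_of_all _ fun s => hWWb _ _ _)
  have hsq : ∀ ω, (∫ q, h q * W ω q ∂μ) ^ 2 =
      ∫ r : E × E, (h r.1 * h r.2) * (W ω r.1 * W ω r.2) ∂(μ.prod μ) := fun ω => by
    rw [sq, ← integral_prod_mul]
    refine integral_congr_ae (ae_of_all _ fun r => ?_)
    dsimp only
    ring
  simp_rw [hsq]
  rw [integral_integral_swap hint]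
  refine (le_abs_self _).trans (norm_integral_le_of_norm_le (G := ℝ) hc (ae_of_all _ fun r => ?_))
  rw [integral_const_mul, norm_mul, norm_mul]
  exact mul_le_mul_of_nonneg_left (hcov _ _) (by positivity)

/-- The split is at |x| = √ε: inside, the trivial bound 1 is kept; outside, |x/ε| ≥ ε^(-1/2) and the
decay is at most ε^(l/2). -/
theorem mixingDecay_inv_smul_le {d : ℕ} {l : ℝ} (hl : 0 < l) {ε : ℝ} (hε : 0 < ε) (x : Rd d) :
    mixingDecay l (ε⁻¹ • x) ≤
      (Metric.closedBall (0 : Rd d) (ε ^ (1 / 2 : ℝ))).indicator (fun _ => 1) x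
        + ε ^ (l / 2) := by
  have hp : 0 < ε ^ (l / 2) := Real.rpow_pos_of_pos hε _
  have h1 : mixingDecay l (ε⁻¹ • x) ≤ 1 := by
    unfold mixingDecay
    split_ifs
    · exact le_rfl
    · exact min_le_left _ _
  by_cases hx : x ∈ Metric.closedBall (0 : Rd d) (ε ^ (1 / 2 : ℝ))
  · rw [Set.indicator_of_mem hx]
    linarith
  · rw [Set.indicator_of_notMem hx, zero_add]
    rw [mem_closedBall_zero_iff, not_le] at hx
    have hx0 : ε⁻¹ • x ≠ 0 := by
      refine smul_ne_zero (inv_ne_zero hε.ne') (norm_pos_iff.1 (lt_trans ?_ hx))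
      exact Real.rpow_pos_of_pos hε _
    unfold mixingDecay
    rw [if_neg hx0]
    refine (min_le_right _ _).trans ?_
    have h2 : ε ^ (-(1 / 2) : ℝ) ≤ ‖ε⁻¹ • x‖ := by
      rw [norm_smul, norm_inv, Real.norm_eq_abs, abs_of_pos hε]
      calc ε ^ (-(1 / 2) : ℝ) = ε⁻¹ * ε ^ (1 / 2 : ℝ) := by
            rw [← Real.rpow_neg_one, ← Real.rpow_add hε]; norm_num
        _ ≤ ε⁻¹ * ‖x‖ := by gcongr
    calc ‖ε⁻¹ • x‖ ^ (-l) ≤ (ε ^ (-(1 / 2) : ℝ)) ^ (-l) :=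
          Real.rpow_le_rpow_of_nonpos (Real.rpow_pos_of_pos hε _) h2 (by linarith)
      _ = ε ^ (l / 2) := by
          rw [← Real.rpow_mul hε.le]; congr 1; ring

/-- Convergence to zero along a polynomial sequence of dilations implies convergence along all
dilations. -/
theorem tendsto_integral_mul_comp_smul {E : Type*} [NormedAddCommGroup E] [NormedSpace ℝ E]
    [FiniteDimensional ℝ E] [MeasurableSpace E] [BorelSpace E] {μ : Measure E}
    [μ.IsAddHaarMeasure] {h : E → ℝ} (hc : Continuous h) (hs : HasCompactSupport h) {W : E → ℝ}
    (hWm : Measurable W) {B : ℝ} (hW : ∀ q, |W q| ≤ B) {m : ℕ} (hm : m ≠ 0)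
    (hlim : Tendsto (fun k : ℕ => ∫ q, h q * W (((k : ℝ) ^ m) • q) ∂μ) atTop (𝓝 0)) :
    Tendsto (fun t : ℝ => ∫ q, h q * W (t • q) ∂μ) atTop (𝓝 0) := by
  have := FiniteDimensional.proper_real E
  -- The integer part of the m-th root of t, so that k^m / t tends to 1.
  set k : ℝ → ℕ := fun t => ⌊t ^ ((m : ℝ)⁻¹)⌋₊
  set ρ : ℝ → ℝ := fun t => (k t : ℝ) ^ m / t
  have hroot : Tendsto (fun t : ℝ => t ^ ((m : ℝ)⁻¹)) atTop atTop :=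
    tendsto_rpow_atTop (by positivity)
  have hk : Tendsto k atTop atTop := tendsto_nat_floor_atTop.comp hroot
  have hρ : Tendsto ρ atTop (𝓝 1) := by
    have h1 := (tendsto_nat_floor_div_atTop.comp hroot).pow m
    rw [one_pow] at h1
    refine h1.congr' ?_
    filter_upwards [eventually_ge_atTop 0] with t ht
    simp only [Function.comp, div_pow, ρ, k, Real.rpow_inv_natCast_pow ht hm]
  -- W is merely bounded and measurable, so a change of variables transfers the residual dilation ρ
  -- to h, which is continuous under dilation in L¹.
  have hdil : Tendsto (fun t => ∫ q, |h (ρ t • q) - h q| ∂μ) atTop (𝓝 0) := by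
    refine tendsto_integral_abs_comp_sub hc hs
      (Eventually.of_forall fun t => continuous_const_smul _) (fun x => ?_) fun R => ?_
    · simpa using hρ.smul_const x
    · refine ⟨2 * R, ?_⟩
      filter_upwards [(tendsto_order.1 hρ).1 (1 / 2) (by norm_num)] with t ht x hx
      rw [norm_smul, Real.norm_eq_abs, abs_of_pos (by linarith)] at hx
      nlinarith [norm_nonneg x]
  have hbound : Tendsto (fun t => |ρ t ^ Module.finrank ℝ E| *
      (|∫ q, h q * W (((k t : ℝ) ^ m) • q) ∂μ| + (∫ q, |h (ρ t • q) - h q| ∂μ) * B))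
      atTop (𝓝 0) := by
    have h1 := (hρ.pow (Module.finrank ℝ E)).abs.mul
      ((hlim.comp hk).abs.add (hdil.mul_const B))
    simpa using h1
  refine squeeze_zero_norm' ?_ hbound
  filter_upwards [eventually_gt_atTop 0, (tendsto_order.1 hρ).1 0 zero_lt_one] with t ht hρt
  have hhi : Integrable h μ := hc.integrable_of_hasCompactSupport hs
  have hhρ : Integrable (fun q => h (ρ t • q)) μ := hhi.comp_smul hρt.ne'
  have hsub : Integrable (fun q => h (ρ t • q) - h q) μ := hhρ.sub hhi
  have hWk : AEStronglyMeasurable (fun q => W (((k t : ℝ) ^ m) • q)) μ :=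
    (hWm.comp (measurable_const_smul _)).aestronglyMeasurable
  have hWb : ∀ᵐ q ∂μ, ‖W (((k t : ℝ) ^ m) • q)‖ ≤ B := ae_of_all _ fun q => hW _
  have h1 := Measure.integral_comp_smul μ (fun q => h q * W (t • q)) (ρ t)
  have h2 : ∀ q : E, t • ρ t • q = ((k t : ℝ) ^ m) • q := fun q => by
    rw [smul_smul, mul_div_cancel₀ _ ht.ne']
  simp only [h2, smul_eq_mul] at h1
  have hpow : ρ t ^ Module.finrank ℝ E ≠ 0 := (pow_pos hρt _).ne'
  have h3 : ∫ q, h q * W (t • q) ∂μ =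
      |ρ t ^ Module.finrank ℝ E| * ∫ q, h (ρ t • q) * W (((k t : ℝ) ^ m) • q) ∂μ := by
    rw [h1, abs_inv, mul_inv_cancel_left₀ (abs_ne_zero.2 hpow)]
  rw [h3, norm_mul, Real.norm_eq_abs, abs_abs]
  refine mul_le_mul_of_nonneg_left ?_ (abs_nonneg _)
  have h4 : ∫ q, h (ρ t • q) * W (((k t : ℝ) ^ m) • q) ∂μ =
      ∫ q, h q * W (((k t : ℝ) ^ m) • q) ∂μ +
        ∫ q, (h (ρ t • q) - h q) * W (((k t : ℝ) ^ m) • q) ∂μ := by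
    rw [← integral_add (hhi.mul_bdd hWk hWb) (hsub.mul_bdd hWk hWb)]
    refine integral_congr_ae (ae_of_all _ fun q => ?_)
    dsimp only
    ring
  rw [h4, Real.norm_eq_abs]
  refine (abs_add_le _ _).trans (add_le_add_right ?_ _)
  rw [← integral_mul_const]
  refine norm_integral_le_of_norm_le (G := ℝ) (hsub.abs.mul_const B)
    (ae_of_all _ fun q => ?_)
  rw [norm_mul]
  exact mul_le_mul_of_nonneg_left (hW _) (norm_nonneg _)

theorem volume_inter_closedBall_prod_le {d : ℕ} (a : Rd d) {r R : ℝ} (hr : 0 ≤ r) :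
    (volume : Measure (Rd d × Rd d)).real (Metric.closedBall a r ×ˢ Metric.closedBall 0 R) ≤
      r ^ d * ((volume : Measure (Rd d)).real (Metric.closedBall 0 1) *
        (volume : Measure (Rd d)).real (Metric.closedBall 0 R)) := by
  rw [Measure.volume_eq_prod, measureReal_prod_prod, ← mul_assoc]
  gcongr
  rw [Measure.real, ← mul_one r, volume_closedBall_mul a hr zero_le_one, ENNReal.toReal_mul,
    Measure.addHaar_closedBall_center]
  simp [hr, Measure.real]

/-- Decay in `ε` of the variance integral of a field with polynomially decaying correlations. -/
theorem exists_integral_mul_decay_le {d : ℕ} (hd : 1 ≤ d) {l : ℝ} (hl : 0 < l)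
    {h : Rd d × Rd d → ℝ} (hh : IsBoundedTest h volume) :
    ∃ s : ℝ, 0 < s ∧ ∃ C : ℝ, ∀ ε : ℝ, 0 < ε → ε ≤ 1 →
      Integrable (fun r : (Rd d × Rd d) × (Rd d × Rd d) => |h r.1| * |h r.2| *
        ((Metric.closedBall (0 : Rd d) (ε ^ (1 / 2 : ℝ))).indicator (fun _ => 1) (r.2.1 - r.1.1)
          + ε ^ (l / 2))) (volume.prod volume) ∧
      ∫ r : (Rd d × Rd d) × (Rd d × Rd d), |h r.1| * |h r.2| *
        ((Metric.closedBall (0 : Rd d) (ε ^ (1 / 2 : ℝ))).indicator (fun _ => 1) (r.2.1 - r.1.1)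
          + ε ^ (l / 2)) ∂(volume.prod volume) ≤ C * ε ^ s := by
  obtain ⟨M, hM⟩ := hh.bounded
  obtain ⟨R, hR⟩ := hh.support
  have hM0 : 0 ≤ M := (abs_nonneg _).trans (hM 0)
  have hhi := hh.integrable
  set A := ∫ q, |h q| with hA
  have hA0 : 0 ≤ A := integral_nonneg fun _ => abs_nonneg _
  set V := (volume : Measure (Rd d)).real (Metric.closedBall 0 1) *
    (volume : Measure (Rd d)).real (Metric.closedBall 0 R) with hV
  have hV0 : 0 ≤ V := by positivity
  -- The ball of radius √ε contributes a volume of order ε^(d/2), at most ε^(1/2) because d ≥ 1 and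
  -- ε ≤ 1; the far part contributes ε^(l/2).
  set s : ℝ := min (1 / 2) (l / 2) with hs
  have hs0 : 0 < s := lt_min (by norm_num) (by positivity)
  refine ⟨s, hs0, A * (M * V) + A * A, fun ε hε hε1 => ?_⟩
  set ρ : ℝ := ε ^ (1 / 2 : ℝ) with hρ
  have hρ0 : 0 < ρ := Real.rpow_pos_of_pos hε _
  have hρ1 : ρ ≤ 1 := Real.rpow_le_one hε.le hε1 (by norm_num)
  have hρs : ρ ≤ ε ^ s := Real.rpow_le_rpow_of_exponent_ge hε hε1 (min_le_left _ _)
  have hls : ε ^ (l / 2) ≤ ε ^ s := Real.rpow_le_rpow_of_exponent_ge hε hε1 (min_le_right _ _)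
  have hl0 : 0 ≤ ε ^ (l / 2) := Real.rpow_nonneg hε.le _
  have hρd : ρ ^ d ≤ ε ^ s :=
    (pow_le_of_le_one hρ0.le hρ1 (Nat.one_le_iff_ne_zero.1 hd)).trans hρs
  set J : (Rd d × Rd d) × (Rd d × Rd d) → ℝ := fun r =>
    (Metric.closedBall (0 : Rd d) ρ).indicator (fun _ => 1) (r.2.1 - r.1.1) + ε ^ (l / 2) with hJ
  have hJm : Measurable J := by
    refine Measurable.add_const (Measurable.comp
      (measurable_const.indicator Metric.isClosed_closedBall.measurableSet) ?_) _
    exact (measurable_fst.comp measurable_snd).sub (measurable_fst.comp measurable_fst)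
  have hind : ∀ x, |(Metric.closedBall (0 : Rd d) ρ).indicator (fun _ => (1 : ℝ)) x| ≤ 1 := by
    intro x
    by_cases hx : x ∈ Metric.closedBall (0 : Rd d) ρ <;> simp [hx]
  have hJb : ∀ r, ‖J r‖ ≤ 1 + ε ^ (l / 2) := fun r =>
    (abs_add_le _ _).trans (add_le_add (hind _) (abs_of_nonneg hl0).le)
  have hint : Integrable (fun r : (Rd d × Rd d) × (Rd d × Rd d) => |h r.1| * |h r.2| * J r)
      (volume.prod volume) :=
    (hhi.abs.mul_prod hhi.abs).mul_bdd hJm.aestronglyMeasurable (ae_of_all _ hJb)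
  refine ⟨hint, ?_⟩
  have hinner : ∀ q : Rd d × Rd d, ∫ q', |h q'| * J (q, q') ≤ (M * V + A) * ε ^ s := by
    intro q
    have hi1 : Integrable (fun q' : Rd d × Rd d =>
        (Metric.closedBall q.1 ρ ×ˢ Metric.closedBall (0 : Rd d) R).indicator (fun _ => M) q') := by
      rw [integrable_indicator_iff (Metric.isClosed_closedBall.measurableSet.prod
        Metric.isClosed_closedBall.measurableSet)]
      exact integrableOn_const
        ((isCompact_closedBall _ _).prod (isCompact_closedBall _ _)).measure_lt_top.ne
    have hi2 : Integrable (fun q' => |h q'| * ε ^ (l / 2)) := hhi.abs.mul_const _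
    calc ∫ q', |h q'| * J (q, q') ≤ ∫ q' : Rd d × Rd d,
          ((Metric.closedBall q.1 ρ ×ˢ Metric.closedBall (0 : Rd d) R).indicator (fun _ => M) q' +
            |h q'| * ε ^ (l / 2)) := by
          refine integral_mono ?_ (hi1.add hi2) fun q' => ?_
          · exact hhi.abs.mul_bdd (hJm.comp measurable_prodMk_left).aestronglyMeasurable
              (ae_of_all _ fun q' => hJb _)
          · simp only [hJ, mul_add]
            gcongr
            by_cases hq' : h q' = 0
            · rw [hq', abs_zero, zero_mul]
              exact Set.indicator_nonneg (fun _ _ => hM0) _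
            · by_cases hb : q'.1 - q.1 ∈ Metric.closedBall (0 : Rd d) ρ
              · rw [Set.indicator_of_mem hb, mul_one, Set.indicator_of_mem]
                · exact hM q'
                · refine ⟨?_, ?_⟩
                  · rwa [Metric.mem_closedBall, dist_eq_norm, ← mem_closedBall_zero_iff]
                  · rw [mem_closedBall_zero_iff]
                    exact (norm_snd_le q').trans (hR q' hq')
              · rw [Set.indicator_of_notMem hb, mul_zero]
                exact Set.indicator_nonneg (fun _ _ => hM0) _
      _ = (volume : Measure (Rd d × Rd d)).real
            (Metric.closedBall q.1 ρ ×ˢ Metric.closedBall (0 : Rd d) R) * M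
            + A * ε ^ (l / 2) := by
          rw [integral_add hi1 hi2, integral_mul_const, integral_indicator_const _
            (Metric.isClosed_closedBall.measurableSet.prod
              Metric.isClosed_closedBall.measurableSet), smul_eq_mul]
      _ ≤ (ε ^ s * V) * M + A * ε ^ s := by
          gcongr
          exact (volume_inter_closedBall_prod_le _ hρ0.le).trans (by gcongr)
      _ = (M * V + A) * ε ^ s := by ring
  rw [integral_prod _ hint]
  calc ∫ q, ∫ q', |h q| * |h q'| * J (q, q') ≤ ∫ q, |h q| * ((M * V + A) * ε ^ s) := by
        refine integral_mono hint.integral_prod_left (hhi.abs.mul_const _) fun q => ?_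
        simp only [mul_assoc, integral_const_mul]
        simpa only [mul_assoc] using mul_le_mul_of_nonneg_left (hinner q) (abs_nonneg (h q))
    _ = (A * (M * V) + A * A) * ε ^ s := by
        rw [integral_mul_const]; ring

namespace IsStationaryErgodicGroup

variable {d : ℕ} {Ω : Type*} [MeasurableSpace Ω] {P : Measure Ω} [IsProbabilityMeasure P]
  {τ : Rd d → Ω → Ω}

/-- A bounded stationary field with polynomially decaying correlations converges weakly to its
mean under rescaling, uniformly in the extra parameter. -/
theorem ae_tendsto_of_mixing (hd : 1 ≤ d) (hτ : IsStationaryErgodicGroup P τ)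
    {φ : Rd d → Ω → ℝ} (hφm : Measurable fun q : Rd d × Ω => φ q.1 q.2) {B : ℝ}
    (hφ : ∀ z ω, |φ z ω| ≤ B) {l : ℝ} (hl : 0 < l) {C : ℝ} (hC : 0 < C)
    (hmix : ∀ x z₁ z₂ : Rd d, |∫ ω, φ z₁ ω * φ z₂ (τ x ω) ∂P - (∫ ω, φ z₁ ω ∂P) * ∫ ω, φ z₂ ω ∂P|
      ≤ C * mixingDecay l x) :
    ∀ᵐ ω ∂P, ∀ K : Rd d × Rd d → ℝ, Integrable K →
      Tendsto (fun ε : ℝ => ∫ q : Rd d × Rd d, K q *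
        (φ (ε⁻¹ • q.2) (τ (ε⁻¹ • q.1) ω) - ∫ ω', φ (ε⁻¹ • q.2) ω' ∂P)) (𝓝[>] 0) (𝓝 0) := by
  set m : Rd d → ℝ := fun z => ∫ ω, φ z ω ∂P with hm
  set W : Ω → Rd d × Rd d → ℝ := fun ω q => φ q.2 (τ q.1 ω) - m q.2 with hW
  have hmm : Measurable m := (hφm.stronglyMeasurable.integral_prod_right).measurable
  have hφz : ∀ z, Measurable (φ z) := fun z => hφm.comp measurable_prodMk_left
  have hmB : ∀ z, |m z| ≤ B := fun z => by
    simpa using norm_integral_le_of_norm_le_const (f := φ z) (μ := P) (C := B)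
      (ae_of_all P fun ω => hφ z ω)
  have hτ' : Measurable fun s : Ω × (Rd d × Rd d) => τ s.2.1 s.1 :=
    hτ.measurable.comp ((measurable_fst.comp measurable_snd).prodMk measurable_fst)
  have hWm : Measurable (Function.uncurry W) :=
    (hφm.comp ((measurable_snd.comp measurable_snd).prodMk hτ')).sub
      (hmm.comp (measurable_snd.comp measurable_snd))
  have hWω : ∀ ω, Measurable (W ω) := fun ω => hWm.comp measurable_prodMk_left
  have hWB : ∀ ω q, |W ω q| ≤ B + B := fun ω q =>
    (abs_sub _ _).trans (add_le_add (hφ _ _) (hmB _))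
  -- By stationarity the covariance depends on the base points through their difference alone; the
  -- mixing bound is uniform in the jump variables.
  have hcov : ∀ q q' : Rd d × Rd d,
      |∫ ω, W ω q * W ω q' ∂P| ≤ C * mixingDecay l (q'.1 - q.1) := by
    intro q q'
    have hi : ∀ r : Rd d × Rd d, Integrable (fun ω => φ r.2 (τ r.1 ω)) P := fun r =>
      Integrable.of_bound ((hφz _).comp (hτ.measurable_apply _)).aestronglyMeasurable B
        (ae_of_all _ fun ω => hφ _ _)
    have hE : ∀ r : Rd d × Rd d, ∫ ω, φ r.2 (τ r.1 ω) ∂P = m r.2 := fun r =>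
      hτ.integral_apply (hφz _) _
    have hii : Integrable (fun ω => φ q.2 (τ q.1 ω) * φ q'.2 (τ q'.1 ω)) P :=
      (hi q).mul_bdd ((hφz _).comp (hτ.measurable_apply _)).aestronglyMeasurable
        (ae_of_all _ fun ω => hφ _ _)
    have h1 : ∫ ω, φ q.2 (τ q.1 ω) * φ q'.2 (τ q'.1 ω) ∂P =
        ∫ ω, φ q.2 ω * φ q'.2 (τ (q'.1 - q.1) ω) ∂P := by
      have := hτ.integral_apply (g := fun ω => φ q.2 ω * φ q'.2 (τ (q'.1 - q.1) ω))
        ((hφz _).mul ((hφz _).comp (hτ.measurable_apply _))) q.1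
      simpa only [hτ.map_add, sub_add_cancel] using this
    have h2 : ∫ ω, W ω q * W ω q' ∂P =
        ∫ ω, φ q.2 (τ q.1 ω) * φ q'.2 (τ q'.1 ω) ∂P - m q.2 * m q'.2 := by
      have h3 : ∀ ω, W ω q * W ω q' = φ q.2 (τ q.1 ω) * φ q'.2 (τ q'.1 ω) -
          (φ q.2 (τ q.1 ω) * m q'.2 + (φ q'.2 (τ q'.1 ω) * m q.2 - m q.2 * m q'.2)) := by
        intro ω; simp only [hW]; ring
      simp_rw [h3]
      have hi1 := (hi q).mul_const (m q'.2)
      have hi2 := (hi q').mul_const (m q.2)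
      have hi3 : Integrable (fun _ : Ω => m q.2 * m q'.2) P := integrable_const _
      have hi4 : Integrable (fun ω => φ q'.2 (τ q'.1 ω) * m q.2 - m q.2 * m q'.2) P := hi2.sub hi3
      have hi5 : Integrable (fun ω => φ q.2 (τ q.1 ω) * m q'.2 +
        (φ q'.2 (τ q'.1 ω) * m q.2 - m q.2 * m q'.2)) P := hi1.add hi4
      rw [integral_sub hii hi5, integral_add hi1 hi4, integral_sub hi2 hi3, integral_mul_const,
        integral_mul_const, hE, hE, integral_const, probReal_univ, one_smul]
      ring
    rw [h2, h1]
    exact hmix _ _ _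
  have hcont : ∀ h : Rd d × Rd d → ℝ, Continuous h → HasCompactSupport h →
      ∀ᵐ ω ∂P, Tendsto (fun t : ℝ => ∫ q, h q * W ω (t • q)) atTop (𝓝 0) := by
    intro h hc hs
    have hh : IsBoundedTest h volume := IsBoundedTest.of_continuous hc hs
    obtain ⟨s, hs0, C', hC'⟩ := exists_integral_mul_decay_le hd hl hh
    -- With p * s ≥ 2, the variance at scale ε = (k + 1)^(-p) is of order (k + 1)^(-2), hence
    -- summable. The shift by one avoids the degenerate scale k = 0.
    obtain ⟨p, hp⟩ := exists_nat_ge (2 / s)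
    have hps : 2 ≤ p * s := (div_le_iff₀ hs0).1 hp
    have hp0 : p ≠ 0 := by
      rintro rfl
      norm_num at hps
    have hX : ∀ t : ℝ, Measurable fun ω => ∫ q, h q * W ω (t • q) := fun t =>
      (StronglyMeasurable.integral_prod_right (f := fun ω q => h q * W ω (t • q))
        (((hc.measurable.comp measurable_snd).mul (hWm.comp (measurable_fst.prodMk
          (measurable_snd.const_smul t)))).stronglyMeasurable)).measurable
    have hXb : ∀ (t : ℝ) ω, |∫ q, h q * W ω (t • q)| ≤ (∫ q, |h q|) * (B + B) := fun t ω => by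
      rw [← integral_mul_const]
      refine norm_integral_le_of_norm_le (G := ℝ) (hh.integrable.abs.mul_const _)
        (ae_of_all _ fun q => ?_)
      rw [norm_mul]
      exact mul_le_mul_of_nonneg_left (hWB _ _) (norm_nonneg _)
    have hvar : ∀ k : ℕ, ∫ ω, (∫ q, h q * W ω ((((k + 1 : ℕ) : ℝ) ^ p) • q)) ^ 2 ∂P ≤
        C * |C'| * (1 / ((k : ℝ) + 1) ^ 2) := by
      intro k
      have hk1 : (1 : ℝ) ≤ ((k + 1 : ℕ) : ℝ) := by exact_mod_cast Nat.le_add_left 1 k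
      set t : ℝ := ((k + 1 : ℕ) : ℝ) ^ p with ht
      have ht1 : 1 ≤ t := one_le_pow₀ hk1
      have hε0 : 0 < t⁻¹ := by positivity
      obtain ⟨hi, hle⟩ := hC' t⁻¹ hε0 (inv_le_one_of_one_le₀ ht1)
      have hpow : (t⁻¹ : ℝ) ^ s ≤ 1 / ((k : ℝ) + 1) ^ 2 := by
        have h1 : (t⁻¹ : ℝ) ^ s = ((k + 1 : ℕ) : ℝ) ^ (-(p * s)) := by
          rw [ht, ← Real.rpow_natCast, ← Real.rpow_neg (by positivity),
            ← Real.rpow_mul (by positivity), neg_mul]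
        rw [h1]
        calc ((k + 1 : ℕ) : ℝ) ^ (-(p * s)) ≤ ((k + 1 : ℕ) : ℝ) ^ (-2 : ℝ) :=
              Real.rpow_le_rpow_of_exponent_le hk1 (by linarith)
          _ = 1 / ((k : ℝ) + 1) ^ 2 := by
              rw [Real.rpow_neg (by positivity), one_div]
              norm_num
      have hWt : Measurable (Function.uncurry fun ω q => W ω (t • q)) :=
        hWm.comp (measurable_fst.prodMk (measurable_snd.const_smul t))
      have hsm := integral_sq_integral_mul_le (P := P) (μ := (volume : Measure (Rd d × Rd d))) hWt
        (fun ω q => hWB ω (t • q)) hh.integrable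
        (c := fun r => C * ((Metric.closedBall (0 : Rd d) ((t⁻¹) ^ (1 / 2 : ℝ))).indicator
          (fun _ => 1) (r.2.1 - r.1.1) + (t⁻¹) ^ (l / 2)))
        (fun q q' => by
          refine (hcov _ _).trans (mul_le_mul_of_nonneg_left ?_ hC.le)
          have := mixingDecay_inv_smul_le hl hε0 (q'.1 - q.1)
          rwa [inv_inv, smul_sub] at this)
        ((hi.const_mul C).congr (ae_of_all _ fun r => by dsimp only; ring))
      refine hsm.trans ?_
      have : ∀ r : (Rd d × Rd d) × (Rd d × Rd d), |h r.1| * |h r.2| * (C *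
          ((Metric.closedBall (0 : Rd d) ((t⁻¹) ^ (1 / 2 : ℝ))).indicator
          (fun _ => 1) (r.2.1 - r.1.1) + (t⁻¹) ^ (l / 2))) = C * (|h r.1| * |h r.2| *
          ((Metric.closedBall (0 : Rd d) ((t⁻¹) ^ (1 / 2 : ℝ))).indicator
          (fun _ => 1) (r.2.1 - r.1.1) + (t⁻¹) ^ (l / 2))) := fun r => by ring
      simp_rw [this]
      rw [integral_const_mul, mul_assoc]
      refine mul_le_mul_of_nonneg_left (hle.trans ?_) hC.le
      exact mul_le_mul (le_abs_self _) hpow (by positivity) (abs_nonneg _)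
    have hBC := ae_tendsto_zero_of_summable_integral_sq
      (X := fun k ω => ∫ q, h q * W ω ((((k + 1 : ℕ) : ℝ) ^ p) • q)) (P := P)
      (fun k => Integrable.of_bound ((hX _).pow_const 2).aestronglyMeasurable
        (((∫ q, |h q|) * (B + B)) ^ 2) (ae_of_all _ fun ω => by
          rw [norm_pow]
          exact pow_le_pow_left₀ (norm_nonneg _) (hXb _ _) 2))
      (Summable.of_nonneg_of_le (fun k => integral_nonneg fun ω => sq_nonneg _) hvar
        (Summable.mul_left _ (by
          have := (summable_nat_add_iff 1).2 (Real.summable_one_div_nat_pow.2 one_lt_two)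
          simpa using this)))
    filter_upwards [hBC] with ω hω
    refine tendsto_integral_mul_comp_smul hc hs (hWω ω) (hWB ω) hp0 ?_
    exact (tendsto_add_atTop_iff_nat (f := fun k : ℕ => ∫ q, h q * W ω (((k : ℝ) ^ p) • q)) 1).1 hω
  obtain ⟨D, hD, hdense⟩ := exists_seq_continuous_dense (μ := (volume : Measure (Rd d × Rd d)))
  filter_upwards [ae_all_iff.2 fun n => hcont (D n) (hD n).1 (hD n).2] with ω hω K hK
  refine tendsto_integral_mul_of_dense
    (fun n => (hD n).1.integrable_of_hasCompactSupport (hD n).2) hdense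
    (Φ := fun (ε : ℝ) q => W ω (ε⁻¹ • q)) (M := B + B)
    (fun ε => ((hWω ω).comp (measurable_const_smul _)).aestronglyMeasurable)
    (fun ε q => hWB _ _) (fun n => ?_) hK
  exact (hω n).comp tendsto_inv_nhdsGT_zero

end IsStationaryErgodicGroup

/-! ### Reversal of jumps and integrals over pairs. -/

section ProductSpace

variable {d : ℕ}

/-- The involution `(x, z) ↦ (x + z, -z)`, exchanging the end points of a jump. -/
def reverseJump (q : Rd d × Rd d) : Rd d × Rd d := (q.1 + q.2, -q.2)

theorem reverseJump_reverseJump (q : Rd d × Rd d) : reverseJump (reverseJump q) = q := by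
  simp [reverseJump]

theorem measurePreserving_reverseJump :
    MeasurePreserving (reverseJump : Rd d × Rd d → Rd d × Rd d) volume volume :=
  ((MeasurePreserving.id (volume : Measure (Rd d))).prod
    (Measure.measurePreserving_neg (volume : Measure (Rd d)))).comp
    (measurePreserving_add_prod (volume : Measure (Rd d)) volume)

theorem measurableEmbedding_reverseJump :
    MeasurableEmbedding (reverseJump : Rd d × Rd d → Rd d × Rd d) :=
  (MeasurableEquiv.mk ⟨reverseJump, reverseJump, reverseJump_reverseJump, reverseJump_reverseJump⟩
    measurePreserving_reverseJump.measurable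
    measurePreserving_reverseJump.measurable).measurableEmbedding

theorem integral_reverseJump (f : Rd d × Rd d → ℝ) : ∫ q, f (reverseJump q) = ∫ q, f q :=
  measurePreserving_reverseJump.integral_comp measurableEmbedding_reverseJump f

theorem integrable_comp_reverseJump {f : Rd d × Rd d → ℝ} :
    Integrable (fun q => f (reverseJump q)) ↔ Integrable f :=
  measurePreserving_reverseJump.integrable_comp_emb measurableEmbedding_reverseJump

theorem norm_le_of_norm_reverseJump_le {q : Rd d × Rd d} {R : ℝ} (h : ‖reverseJump q‖ ≤ R) :
    ‖q‖ ≤ 2 * R := by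
  have h1 : ‖q.1 + q.2‖ ≤ R := (norm_fst_le (reverseJump q)).trans h
  have h2 : ‖q.2‖ ≤ R := by
    simpa [reverseJump] using (norm_snd_le (reverseJump q)).trans h
  have h3 : ‖q.1‖ ≤ ‖q.1 + q.2‖ + ‖q.2‖ := by
    simpa using norm_sub_le (q.1 + q.2) q.2
  exact norm_prod_le_iff.2 ⟨by linarith, by linarith [norm_nonneg q.2]⟩

theorem IsBoundedTest.comp_reverseJump {K : Rd d × Rd d → ℝ} (hK : IsBoundedTest K volume) :
    IsBoundedTest (fun q => K (reverseJump q)) volume := by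
  obtain ⟨M, hM⟩ := hK.bounded
  obtain ⟨R, hR⟩ := hK.support
  exact ⟨hK.aemeasurable.comp_quasiMeasurePreserving
    measurePreserving_reverseJump.quasiMeasurePreserving, ⟨M, fun q => hM _⟩,
    ⟨2 * R, fun q hq => norm_le_of_norm_reverseJump_le (hR _ hq)⟩⟩

theorem exists_subset_closedBall_prod {k : Set (Rd d × Rd d)} (hk : IsCompact k) :
    ∃ R : ℝ, k ⊆ Metric.closedBall (0 : Rd d) R ×ˢ Metric.closedBall (0 : Rd d) R := by
  obtain ⟨R, hR⟩ := hk.isBounded.exists_norm_le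
  exact ⟨R, fun q hq => ⟨mem_closedBall_zero_iff.2 ((norm_fst_le q).trans (hR q hq)),
    mem_closedBall_zero_iff.2 ((norm_snd_le q).trans (hR q hq))⟩⟩

theorem LocallyIntegrable.mul_prod {f g : Rd d → ℝ} (hf : LocallyIntegrable f volume)
    (hg : LocallyIntegrable g volume) :
    LocallyIntegrable (fun q : Rd d × Rd d => f q.1 * g q.2) volume := by
  rw [locallyIntegrable_iff]
  intro k hk
  obtain ⟨R, hR⟩ := exists_subset_closedBall_prod hk
  refine IntegrableOn.mono_set ?_ hR
  rw [IntegrableOn, Measure.volume_eq_prod, ← Measure.prod_restrict]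
  exact (hf.integrableOn_isCompact (isCompact_closedBall 0 R)).mul_prod
    (hg.integrableOn_isCompact (isCompact_closedBall 0 R))

theorem LocallyIntegrable.comp_fst {f : Rd d → ℝ} (hf : LocallyIntegrable f volume) :
    LocallyIntegrable (fun q : Rd d × Rd d => f q.1) volume := by
  simpa using LocallyIntegrable.mul_prod hf (locallyIntegrable_const (1 : ℝ))

theorem LocallyIntegrable.comp_snd {f : Rd d → ℝ} (hf : LocallyIntegrable f volume) :
    LocallyIntegrable (fun q : Rd d × Rd d => f q.2) volume := by
  simpa using LocallyIntegrable.mul_prod (locallyIntegrable_const (1 : ℝ)) hf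

theorem integral_abs_mul_prod_le {K : Rd d × Rd d → ℝ} (hK : IsBoundedTest K volume) {M R : ℝ}
    (hM : ∀ q, |K q| ≤ M) (hR : ∀ q, K q ≠ 0 → ‖q‖ ≤ R) {f g : Rd d → ℝ}
    (hf : LocallyIntegrable f volume) (hg : LocallyIntegrable g volume) (hf0 : ∀ x, 0 ≤ f x)
    (hg0 : ∀ x, 0 ≤ g x) :
    ∫ q : Rd d × Rd d, |K q| * (f q.1 * g q.2) ≤
      M * ((∫ x in Metric.closedBall (0 : Rd d) R, f x) *
        ∫ x in Metric.closedBall (0 : Rd d) R, g x) := by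
  have hM0 : 0 ≤ M := (abs_nonneg _).trans (hM 0)
  have hB : MeasurableSet (Metric.closedBall (0 : Rd d) R) :=
    Metric.isClosed_closedBall.measurableSet
  have hfi := (integrable_indicator_iff hB).2 (hf.integrableOn_isCompact (isCompact_closedBall 0 R))
  have hgi := (integrable_indicator_iff hB).2 (hg.integrableOn_isCompact (isCompact_closedBall 0 R))
  rw [← integral_indicator hB, ← integral_indicator hB, ← integral_prod_mul, ← integral_const_mul]
  refine integral_mono (hK.abs.integrable_mul (LocallyIntegrable.mul_prod hf hg))
    ((hfi.mul_prod hgi).const_mul M) fun q => ?_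
  have hfg : 0 ≤ f q.1 * g q.2 := mul_nonneg (hf0 _) (hg0 _)
  by_cases hq : K q = 0
  · rw [hq, abs_zero, zero_mul]
    exact mul_nonneg hM0 (mul_nonneg (Set.indicator_nonneg (fun _ _ => hf0 _) _)
      (Set.indicator_nonneg (fun _ _ => hg0 _) _))
  · have h1 : q.1 ∈ Metric.closedBall (0 : Rd d) R :=
      mem_closedBall_zero_iff.2 ((norm_fst_le q).trans (hR q hq))
    have h2 : q.2 ∈ Metric.closedBall (0 : Rd d) R :=
      mem_closedBall_zero_iff.2 ((norm_snd_le q).trans (hR q hq))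
    rw [Set.indicator_of_mem h1, Set.indicator_of_mem h2]
    exact mul_le_mul_of_nonneg_right (hM q) hfg

/-- Controls tails of Λ at the starting point of a jump; applied to K composed with `reverseJump`,
it controls them at the end point too. -/
theorem integral_abs_mul_fst_le {K : Rd d × Rd d → ℝ} (hK : IsBoundedTest K volume) {M R : ℝ}
    (hM : ∀ q, |K q| ≤ M) (hR : ∀ q, K q ≠ 0 → ‖q‖ ≤ R) {f : Rd d → ℝ}
    (hf : LocallyIntegrable f volume) (hf0 : ∀ x, 0 ≤ f x) :
    ∫ q : Rd d × Rd d, |K q| * f q.1 ≤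
      M * (volume : Measure (Rd d)).real (Metric.closedBall 0 R) *
        ∫ x in Metric.closedBall (0 : Rd d) R, f x := by
  have := integral_abs_mul_prod_le hK hM hR hf (locallyIntegrable_const (1 : ℝ)) hf0
    (fun _ => zero_le_one)
  simp only [mul_one, integral_const, smul_eq_mul, measureReal_restrict_apply_univ] at this
  linarith

/-- The marginal of a bounded test function with respect to the jump variable. -/
theorem IsBoundedTest.isBoundedCompactlySupported_marginal {K : Rd d × Rd d → ℝ}
    (hK : IsBoundedTest K volume) : IsBoundedCompactlySupported fun z => ∫ x, K (x, z) := by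
  obtain ⟨M, hM⟩ := hK.bounded
  obtain ⟨R, hR⟩ := hK.support
  refine ⟨?_, ⟨M * (volume : Measure (Rd d)).real (Metric.closedBall 0 R), fun z => ?_⟩, ?_⟩
  · exact (hK.aemeasurable.aestronglyMeasurable.prod_swap.integral_prod_right').aemeasurable
  · have h0 : ∫ x, K (x, z) = ∫ x in Metric.closedBall 0 R, K (x, z) := by
      refine (setIntegral_eq_integral_of_forall_compl_eq_zero fun x hx => ?_).symm
      by_contra hne
      exact hx (mem_closedBall_zero_iff.2 ((norm_fst_le (x, z)).trans (hR _ hne)))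
    rw [h0]
    exact norm_setIntegral_le_of_norm_le_const (f := fun x => K (x, z)) measure_closedBall_lt_top
      fun x _ => hM (x, z)
  · refine HasCompactSupport.of_support_subset_isCompact (isCompact_closedBall 0 R) fun z hz => ?_
    rw [mem_closedBall_zero_iff]
    by_contra hlt
    refine hz ?_
    have : ∀ x, K (x, z) = 0 := fun x => by
      by_contra hne
      exact hlt ((norm_snd_le (x, z)).trans (hR _ hne))
    simp [this]

end ProductSpace

/-- The truncated terms b ∧ m and c ∧ m sum to at most 2m, so cutting a at 2m removes no more than
cutting b and c at m. -/
theorem sub_min_le_add {a b c : ℝ} {m : ℕ} (h : a ≤ b + c) :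
    a - min a ((2 * m : ℕ) : ℝ) ≤ (b - min b m) + (c - min c m) := by
  have h1 : 0 ≤ b - min b m := sub_nonneg.2 (min_le_left _ _)
  have h2 : 0 ≤ c - min c m := sub_nonneg.2 (min_le_left _ _)
  have h3 : min b (m : ℝ) ≤ m := min_le_right _ _
  have h4 : min c (m : ℝ) ≤ m := min_le_right _ _
  push_cast
  rcases le_total a (2 * (m : ℝ)) with h5 | h5
  · rw [min_eq_left h5]; linarith
  · rw [min_eq_right h5]; linarith

/-! ### Weak convergence of the field ν. -/

section SummationForm

variable {d : ℕ} {Ω : Type*} [MeasurableSpace Ω] {P : Measure Ω} {τ : Rd d → Ω → Ω}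
  {κ : Rd d → Rd d → Ω → ℝ} {ν : Rd d → Ω → ℝ} {νbar : Rd d → ℝ} {Λ : Ω → ℝ}

/-- The other summand of κ is non-negative and may be dropped. The representation holds for all
pairs on one event, so the bound does as well. -/
theorem SummationForm.ae_le (hs : SummationForm P τ κ ν νbar)
    (hbd : ∀ ω x y, κ x y ω ≤ Λ (τ x ω) + Λ (τ y ω)) :
    ∀ᵐ ω ∂P, ∀ x z, ν z (τ x ω) ≤ Λ (τ x ω) + Λ (τ (x + z) ω) := by
  filter_upwards [hs.representation] with ω hω x z
  have h1 := hω x (x + z)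
  rw [add_sub_cancel_left] at h1
  have h2 := hs.nonneg (x - (x + z)) (τ (x + z) ω)
  linarith [hbd ω x (x + z)]

/-- By stationarity the tails of Λ at both end points have equal mean, hence the factor 2. The bound
is uniform in z and so survives the rescaling z/ε. -/
theorem SummationForm.mean_tail_le (hτ : IsStationaryErgodicGroup P τ)
    (hs : SummationForm P τ κ ν νbar) (hΛm : Measurable Λ) (hΛ0 : ∀ ω, 0 ≤ Λ ω)
    (hΛi : Integrable Λ P) (hbd : ∀ ω x y, κ x y ω ≤ Λ (τ x ω) + Λ (τ y ω)) (m : ℕ) (z : Rd d) :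
    0 ≤ ∫ ω, ν z ω ∂P - ∫ ω, min (ν z ω) ((2 * m : ℕ) : ℝ) ∂P ∧
      ∫ ω, ν z ω ∂P - ∫ ω, min (ν z ω) ((2 * m : ℕ) : ℝ) ∂P ≤
        2 * ∫ ω, (Λ ω - min (Λ ω) m) ∂P := by
  have hνm : Measurable (ν z) := hs.measurable.comp measurable_prodMk_left
  have hle : ∀ᵐ ω ∂P, ν z ω ≤ Λ ω + Λ (τ z ω) := by
    filter_upwards [hs.ae_le hbd] with ω hω
    simpa [hτ.map_zero] using hω 0 z
  have hΛz : Integrable (fun ω => Λ (τ z ω)) P :=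
    (hτ.stationary z).integrable_comp_of_integrable hΛi
  have hνi : Integrable (ν z) P := (hΛi.add hΛz).mono' hνm.aestronglyMeasurable (by
    filter_upwards [hle] with ω hω
    rwa [Real.norm_eq_abs, abs_of_nonneg (hs.nonneg z ω)])
  have hmin := hνi.min_natCast hνm (hs.nonneg z) (2 * m)
  have htm : Measurable fun ω => Λ ω - min (Λ ω) m := hΛm.sub (hΛm.min measurable_const)
  have hti : Integrable (fun ω => Λ ω - min (Λ ω) m) P := hΛi.sub (hΛi.min_natCast hΛm hΛ0 m)
  have htz : Integrable (fun ω => Λ (τ z ω) - min (Λ (τ z ω)) m) P :=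
    (hτ.stationary z).integrable_comp_of_integrable hti
  rw [← integral_sub hνi hmin]
  refine ⟨integral_nonneg fun ω => sub_nonneg.2 (min_le_left _ _), ?_⟩
  have h1 := hτ.integral_apply htm z
  calc ∫ ω, (ν z ω - min (ν z ω) ((2 * m : ℕ) : ℝ)) ∂P
      ≤ ∫ ω, ((Λ ω - min (Λ ω) m) + (Λ (τ z ω) - min (Λ (τ z ω)) m)) ∂P := by
        refine integral_mono_ae (hνi.sub hmin) (hti.add htz) ?_
        filter_upwards [hle] with ω hω
        exact sub_min_le_add hω
    _ = 2 * ∫ ω, (Λ ω - min (Λ ω) m) ∂P := by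
        rw [integral_add hti htz, h1]; ring

/-- Convergence of the means against functions of both variables. -/
theorem WeaklyConvergesL1loc.tendsto_integral_prod {F : ℝ → Rd d → ℝ} {G : Rd d → ℝ}
    (h : WeaklyConvergesL1loc F G) {K : Rd d × Rd d → ℝ} (hK : IsBoundedTest K volume) :
    Tendsto (fun ε => ∫ q : Rd d × Rd d, K q * F ε q.2) (𝓝[>] 0)
      (𝓝 (∫ q : Rd d × Rd d, K q * G q.2)) := by
  have key : ∀ g : Rd d → ℝ, LocallyIntegrable g volume →
      ∫ q : Rd d × Rd d, K q * g q.2 = ∫ z, (∫ x, K (x, z)) * g z := by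
    intro g hg
    rw [Measure.volume_eq_prod, integral_prod_symm _ (hK.integrable_mul
      (LocallyIntegrable.comp_snd hg))]
    simp_rw [integral_mul_const]
  rw [key G h.locallyIntegrable_limit]
  refine (h.tendsto _ hK.isBoundedCompactlySupported_marginal).congr' ?_
  filter_upwards [self_mem_nhdsWithin] with ε hε
  exact (key _ (h.locallyIntegrable ε hε)).symm

/-- Truncation at 2m splits the difference between ν and its mean into three parts: the tail of ν,
dominated by tails of Λ along the orbit; the centred truncated field, which vanishes weakly by
mixing; and the tail of the mean. The mean itself converges by assumption. -/
theorem SummationForm.ae_tendsto [IsProbabilityMeasure P] (hd : 1 ≤ d)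
    (hτ : IsStationaryErgodicGroup P τ)
    (hs : SummationForm P τ κ ν νbar) (hΛm : Measurable Λ) (hΛ0 : ∀ ω, 0 ≤ Λ ω)
    (hΛi : Integrable Λ P) (hbd : ∀ ω x y, κ x y ω ≤ Λ (τ x ω) + Λ (τ y ω)) :
    ∀ᵐ ω ∂P, ∀ K : Rd d × Rd d → ℝ, IsBoundedTest K volume →
      (∀ ε : ℝ, 0 < ε →
        Integrable fun q : Rd d × Rd d => K q * ν (ε⁻¹ • q.2) (τ (ε⁻¹ • q.1) ω)) ∧
      Tendsto (fun ε : ℝ => ∫ q : Rd d × Rd d, K q * ν (ε⁻¹ • q.2) (τ (ε⁻¹ • q.1) ω)) (𝓝[>] 0)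
        (𝓝 (∫ q : Rd d × Rd d, K q * νbar q.2)) := by
  obtain ⟨l, hl, hmix⟩ := hs.mixing
  have hweak : ∀ n : ℕ, ∀ᵐ ω ∂P, 0 < n → ∀ K : Rd d × Rd d → ℝ, Integrable K →
      Tendsto (fun ε : ℝ => ∫ q : Rd d × Rd d, K q *
        (min (ν (ε⁻¹ • q.2) (τ (ε⁻¹ • q.1) ω)) n - ∫ ω', min (ν (ε⁻¹ • q.2) ω') n ∂P))
        (𝓝[>] 0) (𝓝 0) := by
    intro n
    rcases Nat.eq_zero_or_pos n with rfl | hn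
    · exact ae_of_all _ fun ω h => absurd h (lt_irrefl 0)
    · obtain ⟨C, hC, hCov⟩ := hmix n hn
      filter_upwards [hτ.ae_tendsto_of_mixing hd (φ := fun z ω => min (ν z ω) n)
        (hs.measurable.min measurable_const)
        (fun z ω => abs_min_natCast_le (hs.nonneg z ω) n) hl hC hCov] with ω hω _
      exact hω
  filter_upwards [ae_all_iff.2 hweak, hs.ae_le hbd, hτ.ae_locallyIntegrable hΛm hΛi,
    hτ.ae_eventually_tail_le hΛm hΛi hΛ0] with ω hweak hle hLI htail K hK
  have hjoint : ∀ ε : ℝ, Measurable fun q : Rd d × Rd d => ν (ε⁻¹ • q.2) (τ (ε⁻¹ • q.1) ω) :=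
    fun ε => hs.measurable.comp ((measurable_snd.const_smul ε⁻¹).prodMk
      ((hτ.measurable_orbit ω).comp (measurable_fst.const_smul ε⁻¹)))
  have hdom : ∀ f : Ω → ℝ, Measurable f → (∀ a, |f a| ≤ Λ a) → ∀ ε : ℝ, 0 < ε →
      LocallyIntegrable (fun x : Rd d => f (τ (ε⁻¹ • x) ω)) volume := by
    intro f hfm hf ε hε
    refine (LocallyIntegrable.comp_smul hLI (inv_ne_zero hε.ne')).mono
      (hfm.comp ((hτ.measurable_orbit ω).comp
        (measurable_const_smul _))).aestronglyMeasurable (ae_of_all _ fun x => ?_)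
    rw [Real.norm_eq_abs, Real.norm_eq_abs, abs_of_nonneg (hΛ0 _)]
    exact hf _
  have hΛLI := hdom Λ hΛm fun a => (abs_of_nonneg (hΛ0 a)).le
  -- A function of x + z is a function of the first coordinate of the reversed jump. Writing K as
  -- its double reversal puts the integrand in the form to which invariance under `reverseJump`
  -- applies.
  have hrev : ∀ (f : Rd d → ℝ) (q : Rd d × Rd d),
      |K (reverseJump (reverseJump q))| * f (reverseJump q).1 = |K q| * f (q.1 + q.2) :=
    fun f q => by rw [reverseJump_reverseJump]; rfl
  have hKr := hK.comp_reverseJump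
  have hfst : ∀ f : Rd d → ℝ, LocallyIntegrable f volume →
      Integrable fun q : Rd d × Rd d => |K q| * f q.1 := fun f hf =>
    hK.abs.integrable_mul (LocallyIntegrable.comp_fst hf)
  have hsum : ∀ f : Rd d → ℝ, LocallyIntegrable f volume →
      Integrable fun q : Rd d × Rd d => |K q| * f (q.1 + q.2) := fun f hf => by
    have h1 := hKr.abs.integrable_mul (LocallyIntegrable.comp_fst hf)
    have h2 := integrable_comp_reverseJump.2 h1
    simpa only [hrev] using h2
  have hint : ∀ ε : ℝ, 0 < ε →
      Integrable fun q : Rd d × Rd d => K q * ν (ε⁻¹ • q.2) (τ (ε⁻¹ • q.1) ω) := by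
    intro ε hε
    refine ((hfst _ (hΛLI ε hε)).add (hsum _ (hΛLI ε hε))).mono'
      (hK.aemeasurable.aestronglyMeasurable.mul (hjoint ε).aestronglyMeasurable)
      (ae_of_all _ fun q => ?_)
    rw [norm_mul, Real.norm_eq_abs, Real.norm_eq_abs, abs_of_nonneg (hs.nonneg _ _), Pi.add_apply,
      ← mul_add, smul_add]
    exact mul_le_mul_of_nonneg_left (hle _ _) (abs_nonneg _)
  refine ⟨hint, ?_⟩
  obtain ⟨M, hM⟩ := hK.bounded
  obtain ⟨R₀, hR₀⟩ := hK.support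
  have hM0 : 0 ≤ M := (abs_nonneg _).trans (hM 0)
  -- Covers the supports of both K and K composed with `reverseJump`.
  set R := max R₀ (2 * R₀) with hRdef
  have hR : ∀ q, K q ≠ 0 → ‖q‖ ≤ R := fun q hq => (hR₀ q hq).trans (le_max_left _ _)
  have hRr : ∀ q, K (reverseJump q) ≠ 0 → ‖q‖ ≤ R := fun q hq =>
    (norm_le_of_norm_reverseJump_le (hR₀ _ hq)).trans (le_max_right _ _)
  set V := (volume : Measure (Rd d)).real (Metric.closedBall 0 R) with hV
  have hV0 : 0 ≤ V := measureReal_nonneg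
  set A := ∫ q, |K q| with hA
  have hA0 : 0 ≤ A := integral_nonneg fun _ => abs_nonneg _
  set mean : ℝ → Rd d × Rd d → ℝ := fun ε q => ∫ ω', ν (ε⁻¹ • q.2) ω' ∂P with hmean
  suffices hdiff : Tendsto (fun ε : ℝ =>
      (∫ q : Rd d × Rd d, K q * ν (ε⁻¹ • q.2) (τ (ε⁻¹ • q.1) ω)) - ∫ q, K q * mean ε q)
      (𝓝[>] 0) (𝓝 0) by
    have := hdiff.add (hs.mean_converges.tendsto_integral_prod hK)
    rw [zero_add] at this
    exact this.congr fun ε => sub_add_cancel _ _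
  rw [Metric.tendsto_nhds]
  intro δ hδ
  have hEt : ∀ᶠ m : ℕ in atTop, ∫ ω, (Λ ω - min (Λ ω) m) ∂P < δ / 8 / (A + 1) :=
    (tendsto_order.1 (tendsto_integral_sub_min hΛm hΛi hΛ0)).2 _ (by positivity)
  -- The level m is fixed before ε. Each end point of the jump costs δ/8, the mean tail δ/4 and the
  -- centred truncated field δ/4.
  obtain ⟨m, hm1, hm2, hm3⟩ := ((htail R (δ / 8 / (M * V + 1)) (by positivity)).and
    (hEt.and (eventually_ge_atTop 1))).exists
  set t : ℝ := ∫ ω, (Λ ω - min (Λ ω) m) ∂P with ht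
  have ht0 : 0 ≤ t := integral_nonneg fun ω => sub_nonneg.2 (min_le_left _ _)
  have htA : A * (2 * t) ≤ δ / 4 := by
    have := (lt_div_iff₀ (by positivity)).1 hm2
    nlinarith
  filter_upwards [hm1, Metric.tendsto_nhds.1
    (hweak (2 * m) (by omega) K hK.integrable) (δ / 4) (by positivity), self_mem_nhdsWithin]
    with ε h1 h2 hε
  have hε' : 0 < ε := hε
  set ψ : Rd d → ℝ := fun x => Λ (τ (ε⁻¹ • x) ω) - min (Λ (τ (ε⁻¹ • x) ω)) m with hψ
  have hψ0 : ∀ x, 0 ≤ ψ x := fun x => sub_nonneg.2 (min_le_left _ _)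
  have hψLI : LocallyIntegrable ψ volume := hdom (fun a => Λ a - min (Λ a) m)
    (hΛm.sub (hΛm.min measurable_const)) (fun a => abs_sub_min_natCast_le (hΛ0 a) m) ε hε
  set trunc : Rd d × Rd d → ℝ :=
    fun q => min (ν (ε⁻¹ • q.2) (τ (ε⁻¹ • q.1) ω)) ((2 * m : ℕ) : ℝ) with htrunc
  set meant : Rd d × Rd d → ℝ :=
    fun q => ∫ ω', min (ν (ε⁻¹ • q.2) ω') ((2 * m : ℕ) : ℝ) ∂P with hmeant
  have hi1 := hint ε hε
  have hi2 : Integrable fun q => K q * trunc q := hK.integrable.mul_bdd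
    (c := ((2 * m : ℕ) : ℝ)) ((hjoint ε).min measurable_const).aestronglyMeasurable
    (ae_of_all _ fun q => abs_min_natCast_le (hs.nonneg _ _) _)
  have hi3 : Integrable fun q => K q * mean ε q :=
    hK.integrable_mul (LocallyIntegrable.comp_snd (hs.mean_converges.locallyIntegrable ε hε))
  have hi4 : Integrable fun q => K q * meant q := by
    have hm' : Measurable fun z : Rd d => ∫ ω', min (ν z ω') ((2 * m : ℕ) : ℝ) ∂P :=
      ((hs.measurable.min measurable_const).stronglyMeasurable.integral_prod_right).measurable
    refine hK.integrable.mul_bdd (c := ((2 * m : ℕ) : ℝ))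
      (hm'.comp (measurable_snd.const_smul ε⁻¹)).aestronglyMeasurable (ae_of_all _ fun q => ?_)
    have := norm_integral_le_of_norm_le_const (μ := P)
      (f := fun ω' => min (ν (ε⁻¹ • q.2) ω') ((2 * m : ℕ) : ℝ)) (C := ((2 * m : ℕ) : ℝ))
      (ae_of_all P fun ω' => abs_min_natCast_le (hs.nonneg _ _) _)
    rwa [probReal_univ, mul_one] at this
  have e1 : |∫ q : Rd d × Rd d, (K q * ν (ε⁻¹ • q.2) (τ (ε⁻¹ • q.1) ω) - K q * trunc q)| ≤
      δ / 4 := by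
    have hb : |∫ q : Rd d × Rd d, (K q * ν (ε⁻¹ • q.2) (τ (ε⁻¹ • q.1) ω) - K q * trunc q)| ≤
        ∫ q : Rd d × Rd d, (|K q| * ψ q.1 + |K q| * ψ (q.1 + q.2)) := by
      refine norm_integral_le_of_norm_le (G := ℝ) ((hfst ψ hψLI).add (hsum ψ hψLI))
        (ae_of_all _ fun q => ?_)
      rw [← mul_sub, norm_mul, Real.norm_eq_abs, Real.norm_eq_abs,
        abs_of_nonneg (sub_nonneg.2 (min_le_left _ _)), ← mul_add]
      refine mul_le_mul_of_nonneg_left ?_ (abs_nonneg _)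
      have := sub_min_le_add (m := m) (hle (ε⁻¹ • q.1) (ε⁻¹ • q.2))
      simpa only [hψ, smul_add] using this
    have hb1 := integral_abs_mul_fst_le hK hM hR hψLI hψ0
    have hb2 := integral_abs_mul_fst_le hKr (fun q => hM _) hRr hψLI hψ0
    rw [← integral_reverseJump] at hb2
    simp only [hrev] at hb2
    rw [integral_add (hfst ψ hψLI) (hsum ψ hψLI)] at hb
    have hb3 : M * V * ∫ x in Metric.closedBall (0 : Rd d) R, ψ x ≤ δ / 8 := by
      calc M * V * ∫ x in Metric.closedBall (0 : Rd d) R, ψ x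
          ≤ M * V * (δ / 8 / (M * V + 1)) := by gcongr
        _ = δ / 8 * (M * V / (M * V + 1)) := by ring
        _ ≤ δ / 8 := by
          refine mul_le_of_le_one_right (by positivity) ?_
          rw [div_le_one (by positivity)]
          linarith
    linarith
  have e2 : |∫ q : Rd d × Rd d, (K q * mean ε q - K q * meant q)| ≤ δ / 4 := by
    refine le_trans ?_ htA
    rw [hA, ← integral_mul_const]
    refine norm_integral_le_of_norm_le (G := ℝ) (hK.integrable.abs.mul_const _)
      (ae_of_all _ fun q => ?_)
    have := hs.mean_tail_le hτ hΛm hΛ0 hΛi hbd m (ε⁻¹ • q.2)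
    rw [← mul_sub, norm_mul, Real.norm_eq_abs, Real.norm_eq_abs, abs_of_nonneg this.1]
    exact mul_le_mul_of_nonneg_left this.2 (abs_nonneg _)
  rw [Real.dist_0_eq_abs] at h2 ⊢
  have e3 : ∫ q : Rd d × Rd d, K q * (trunc q - meant q) =
      (∫ q, K q * trunc q) - ∫ q, K q * meant q := by
    simp only [mul_sub]
    exact integral_sub hi2 hi4
  rw [show ∫ q : Rd d × Rd d, K q * (min (ν (ε⁻¹ • q.2) (τ (ε⁻¹ • q.1) ω)) ((2 * m : ℕ) : ℝ) -
    ∫ ω', min (ν (ε⁻¹ • q.2) ω') ((2 * m : ℕ) : ℝ) ∂P) = _ from e3] at h2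
  rw [integral_sub hi1 hi2] at e1
  rw [integral_sub hi3 hi4] at e2
  have e4 := abs_add_three
    ((∫ q : Rd d × Rd d, K q * ν (ε⁻¹ • q.2) (τ (ε⁻¹ • q.1) ω)) - ∫ q, K q * trunc q)
    ((∫ q, K q * trunc q) - ∫ q, K q * meant q)
    (-((∫ q, K q * mean ε q) - ∫ q, K q * meant q))
  rw [abs_neg, show (∫ q : Rd d × Rd d, K q * ν (ε⁻¹ • q.2) (τ (ε⁻¹ • q.1) ω)) -
    (∫ q, K q * trunc q) + ((∫ q, K q * trunc q) - ∫ q, K q * meant q) +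
    -((∫ q, K q * mean ε q) - ∫ q, K q * meant q) =
    (∫ q : Rd d × Rd d, K q * ν (ε⁻¹ • q.2) (τ (ε⁻¹ • q.1) ω)) - ∫ q, K q * mean ε q by ring] at e4
  linarith

end SummationForm

theorem IsBoundedCompactlySupported.isBoundedTest {d : ℕ} {g : Rd d → ℝ}
    (hg : IsBoundedCompactlySupported g) : IsBoundedTest g volume := by
  refine ⟨hg.aemeasurable, hg.bounded, ?_⟩
  obtain ⟨R, hR⟩ := hg.hasCompactSupport.isCompact.isBounded.exists_norm_le
  exact ⟨R, fun x hx => hR x (subset_tsupport g hx)⟩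

/-! ### The jump kernel as a test function. -/

section Kernel

variable {d : ℕ}

theorem measurableSet_truncatedCone {Γ : Set (Rd d)} (hΓ : IsOpen Γ) (η : ℝ) :
    MeasurableSet (truncatedCone Γ η) :=
  ((isOpen_lt continuous_const continuous_norm).inter
    ((isOpen_lt continuous_norm continuous_const).inter hΓ)).measurableSet

/-- The kernel `(f (x + z) - f x) (g (x + z) - g x) / |z| ^ s`, restricted to jumps in `T`. -/
noncomputable def jumpKernel (f g : Rd d → ℝ) (s : ℝ) (T : Set (Rd d)) : Rd d × Rd d → ℝ :=
  {q : Rd d × Rd d | q.2 ∈ T}.indicator fun q =>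
    (f (q.1 + q.2) - f q.1) * (g (q.1 + q.2) - g q.1) / ‖q.2‖ ^ s

/-- The bound |z| > η removes the singularity. If the increment of g is nonzero, one end point lies
in its support, and |z| < 1/η confines the other to a ball on which f is bounded. -/
theorem isBoundedTest_jumpKernel {f g : Rd d → ℝ} (hf : IsLocallyBoundedMeasurable f)
    (hg : IsBoundedCompactlySupported g) {s : ℝ} (hs : 0 ≤ s) {Γ : Set (Rd d)} (hΓ : IsOpen Γ)
    {η : ℝ} (hη : 0 < η) : IsBoundedTest (jumpKernel f g s (truncatedCone Γ η)) volume := by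
  obtain ⟨G, hG⟩ := hg.bounded
  have hG0 : 0 ≤ G := (abs_nonneg _).trans (hG 0)
  obtain ⟨-, -, R, hR⟩ := hg.isBoundedTest
  set R' := R + 1 / η with hR'
  obtain ⟨F, hF⟩ := hf.bounded_on (Metric.closedBall 0 R') (isCompact_closedBall _ _)
  have hsupp : ∀ q : Rd d × Rd d, q.2 ∈ truncatedCone Γ η → g (q.1 + q.2) - g q.1 ≠ 0 →
      ‖q.1‖ ≤ R' ∧ ‖q.1 + q.2‖ ≤ R' := by
    intro q hq hne
    have h2 : ‖q.2‖ ≤ 1 / η := hq.2.1.le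
    have hη' : 0 ≤ 1 / η := by positivity
    by_cases h1 : g q.1 = 0
    · have h3 : g (q.1 + q.2) ≠ 0 := fun h => hne (by rw [h, h1, sub_zero])
      have h4 := hR _ h3
      have h5 : ‖q.1‖ ≤ ‖q.1 + q.2‖ + ‖q.2‖ := by simpa using norm_sub_le (q.1 + q.2) q.2
      exact ⟨by linarith, by linarith⟩
    · have h4 := hR _ h1
      have h5 := norm_add_le q.1 q.2
      exact ⟨by linarith, by linarith⟩
  refine ⟨?_, ⟨2 * |F| * (2 * G) / η ^ s, fun q => ?_⟩, ⟨max R' (1 / η), fun q hq => ?_⟩⟩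
  · have hadd : Measure.QuasiMeasurePreserving (fun q : Rd d × Rd d => q.1 + q.2) volume volume :=
      Measure.quasiMeasurePreserving_fst.comp
        (measurePreserving_add_prod (volume : Measure (Rd d)) volume).quasiMeasurePreserving
    have hfst : Measure.QuasiMeasurePreserving (fun q : Rd d × Rd d => q.1) volume volume :=
      Measure.quasiMeasurePreserving_fst
    refine AEMeasurable.indicator ?_ (measurable_snd (measurableSet_truncatedCone hΓ η))
    exact (((hf.aemeasurable.comp_quasiMeasurePreserving hadd).sub
      (hf.aemeasurable.comp_quasiMeasurePreserving hfst)).mul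
      ((hg.aemeasurable.comp_quasiMeasurePreserving hadd).sub
      (hg.aemeasurable.comp_quasiMeasurePreserving hfst))).div
      ((measurable_snd.norm.pow_const s).aemeasurable)
  · unfold jumpKernel
    by_cases hq : q.2 ∈ truncatedCone Γ η
    · rw [Set.indicator_of_mem (by exact hq), abs_div, abs_mul]
      have hη2 : η ^ s ≤ |‖q.2‖ ^ s| :=
        (Real.rpow_le_rpow hη.le hq.1.le hs).trans (le_abs_self _)
      by_cases hne : g (q.1 + q.2) - g q.1 = 0
      · rw [hne, abs_zero, mul_zero, zero_div]
        positivity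
      · obtain ⟨h1, h2⟩ := hsupp q hq hne
        have hfb : |f (q.1 + q.2) - f q.1| ≤ 2 * |F| := by
          have e1 := hF _ (mem_closedBall_zero_iff.2 h1)
          have e2 := hF _ (mem_closedBall_zero_iff.2 h2)
          have e3 := abs_sub (f (q.1 + q.2)) (f q.1)
          have e4 := le_abs_self F
          linarith
        have hgb : |g (q.1 + q.2) - g q.1| ≤ 2 * G := by
          have e3 := abs_sub (g (q.1 + q.2)) (g q.1)
          linarith [hG (q.1 + q.2), hG q.1]
        have hηs : 0 < η ^ s := Real.rpow_pos_of_pos hη s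
        gcongr
    · rw [Set.indicator_of_notMem (by exact hq), abs_zero]
      positivity
  · have hmem : q ∈ {q : Rd d × Rd d | q.2 ∈ truncatedCone Γ η} :=
      Set.mem_of_indicator_ne_zero hq
    have hne : g (q.1 + q.2) - g q.1 ≠ 0 := by
      intro h
      refine hq ?_
      rw [jumpKernel, Set.indicator_of_mem (by exact hmem), h, mul_zero, zero_div]
    exact norm_prod_le_iff.2 ⟨(hsupp q hmem hne).1.trans (le_max_left _ _),
      hmem.2.1.le.trans (le_max_right _ _)⟩

/-- Passes from (base point, jump) to the pair (x, y), with base point y and jump x - y. -/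
theorem IsBoundedTest.comp_swap_sub {K : Rd d × Rd d → ℝ} (hK : IsBoundedTest K volume) :
    IsBoundedTest (fun q : Rd d × Rd d => K (q.2, q.1 - q.2)) volume := by
  obtain ⟨M, hM⟩ := hK.bounded
  obtain ⟨R, hR⟩ := hK.support
  refine ⟨?_, ⟨M, fun q => hM _⟩, ⟨2 * R, fun q hq => ?_⟩⟩
  · have h := (measurePreserving_prod_neg_add_swap (volume : Measure (Rd d))
      (volume : Measure (Rd d))).quasiMeasurePreserving
    have := hK.aemeasurable.comp_quasiMeasurePreserving h
    simp only [Function.comp_def, neg_add_eq_sub] at this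
    exact this
  · have h1 : ‖q.2‖ ≤ R := (norm_fst_le (q.2, q.1 - q.2)).trans (hR _ hq)
    have h2 : ‖q.1 - q.2‖ ≤ R := (norm_snd_le (q.2, q.1 - q.2)).trans (hR _ hq)
    have h3 : ‖q.1‖ ≤ ‖q.1 - q.2‖ + ‖q.2‖ := by simpa using norm_add_le (q.1 - q.2) q.2
    exact norm_prod_le_iff.2 ⟨by linarith, by linarith [norm_nonneg q.2]⟩

end Kernel

/-! ### Tensor products of weakly convergent fields. -/

/-- Weak convergence of a tensor product. -/
theorem tendsto_integral_tensor {d : ℕ} {a b : ℝ → Rd d → ℝ} {A B : ℝ}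
    (ha0 : ∀ ε x, 0 ≤ a ε x) (hb0 : ∀ ε x, 0 ≤ b ε x)
    (haLI : ∀ ε, 0 < ε → LocallyIntegrable (a ε) volume)
    (hbm : ∀ ε, Measurable (b ε)) (hbLI : ∀ ε, 0 < ε → LocallyIntegrable (b ε) volume)
    (ha : ∀ h : Rd d → ℝ, IsBoundedTest h volume →
      Tendsto (fun ε => ∫ x, h x * a ε x) (𝓝[>] 0) (𝓝 (A * ∫ x, h x)))
    (hb : ∀ h : Rd d → ℝ, IsBoundedTest h volume →
      Tendsto (fun ε => ∫ x, h x * b ε x) (𝓝[>] 0) (𝓝 (B * ∫ x, h x)))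
    (habd : ∀ R : ℝ, ∃ C : ℝ, ∀ᶠ ε in 𝓝[>] (0 : ℝ),
      ∫ x in Metric.closedBall (0 : Rd d) R, a ε x ≤ C)
    (hbtail : ∀ R δ : ℝ, 0 < δ → ∀ᶠ n : ℕ in atTop, ∀ᶠ ε in 𝓝[>] (0 : ℝ),
      ∫ x in Metric.closedBall (0 : Rd d) R, (b ε x - min (b ε x) n) ≤ δ)
    {K : Rd d × Rd d → ℝ} (hK : IsBoundedTest K volume) :
    Tendsto (fun ε => ∫ q : Rd d × Rd d, K q * (a ε q.1 * b ε q.2)) (𝓝[>] 0)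
      (𝓝 (∫ q : Rd d × Rd d, K q * (A * B))) := by
  obtain ⟨M, hM⟩ := hK.bounded
  obtain ⟨R, hR⟩ := hK.support
  have hM0 : 0 ≤ M := (abs_nonneg _).trans (hM 0)
  obtain ⟨C, hC⟩ := habd R
  have hball : MeasurableSet (Metric.closedBall (0 : Rd d) R) :=
    Metric.isClosed_closedBall.measurableSet
  have hKfst : ∀ x y, K (x, y) ≠ 0 → x ∈ Metric.closedBall (0 : Rd d) R := fun x y h =>
    mem_closedBall_zero_iff.2 ((norm_fst_le (x, y)).trans (hR _ h))
  have hKsnd : ∀ x y, K (x, y) ≠ 0 → y ∈ Metric.closedBall (0 : Rd d) R := fun x y h =>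
    mem_closedBall_zero_iff.2 ((norm_snd_le (x, y)).trans (hR _ h))
  set h : Rd d → ℝ := fun y => ∫ x, K (x, y) with hh
  have hhT : IsBoundedTest h volume := hK.isBoundedCompactlySupported_marginal.isBoundedTest
  obtain ⟨H, hH⟩ := hhT.bounded
  have hH0 : 0 ≤ H := (abs_nonneg _).trans (hH 0)
  set G : ℝ → Rd d → ℝ := fun ε y => ∫ x, K (x, y) * a ε x with hG
  -- K is only almost everywhere measurable on the product, so its sections are admissible test
  -- functions for almost every y.
  have hsec : ∀ᵐ y : Rd d, IsBoundedTest (fun x => K (x, y)) volume := by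
    filter_upwards [hK.aemeasurable.aestronglyMeasurable.prod_swap.prodMk_left] with y hy
    exact ⟨hy.aemeasurable, ⟨M, fun x => hM _⟩,
      ⟨R, fun x hx => (norm_fst_le (x, y)).trans (hR _ hx)⟩⟩
  have hpt : ∀ᵐ y : Rd d, Tendsto (fun ε => G ε y) (𝓝[>] 0) (𝓝 (A * h y)) := by
    filter_upwards [hsec] with y hy
    exact ha _ hy
  have hout : ∀ y, y ∉ Metric.closedBall (0 : Rd d) R → ∀ x, K (x, y) = 0 := fun y hy x => by
    by_contra hne
    exact hy (hKsnd x y hne)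
  have hGm : ∀ ε, 0 < ε → AEStronglyMeasurable (G ε) volume := fun ε hε =>
    ((hK.integrable_mul (LocallyIntegrable.comp_fst
      (haLI ε hε))).aestronglyMeasurable.prod_swap).integral_prod_right'
  set C' : ℝ := M * C + |A| * H with hC'
  have hGb : ∀ᶠ ε in 𝓝[>] (0 : ℝ), ∀ y, |G ε y - A * h y| ≤
      (Metric.closedBall (0 : Rd d) R).indicator (fun _ => C') y := by
    filter_upwards [hC, self_mem_nhdsWithin] with ε h1 hε y
    by_cases hy : y ∈ Metric.closedBall (0 : Rd d) R
    · rw [Set.indicator_of_mem hy]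
      refine (abs_sub _ _).trans (add_le_add ?_ ?_)
      · calc |G ε y| ≤ ∫ x, (Metric.closedBall (0 : Rd d) R).indicator (fun x => M * a ε x) x := by
              refine norm_integral_le_of_norm_le (G := ℝ) ?_ (ae_of_all _ fun x => ?_)
              · rw [integrable_indicator_iff hball]
                exact ((haLI ε hε).integrableOn_isCompact (isCompact_closedBall 0 R)).const_mul M
              · by_cases hx : K (x, y) = 0
                · rw [hx, zero_mul, norm_zero]
                  exact Set.indicator_nonneg (fun x _ => mul_nonneg hM0 (ha0 ε x)) x
                · rw [Set.indicator_of_mem (hKfst x y hx), norm_mul, Real.norm_eq_abs,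
                    Real.norm_eq_abs, abs_of_nonneg (ha0 ε x)]
                  exact mul_le_mul_of_nonneg_right (hM _) (ha0 ε x)
          _ = M * ∫ x in Metric.closedBall (0 : Rd d) R, a ε x := by
              rw [integral_indicator hball, integral_const_mul]
          _ ≤ M * C := by gcongr
      · rw [abs_mul]
        exact mul_le_mul_of_nonneg_left (hH y) (abs_nonneg A)
    · rw [Set.indicator_of_notMem hy]
      simp [hG, hh, hout y hy]
  have hind : Integrable ((Metric.closedBall (0 : Rd d) R).indicator fun _ => C') volume := by
    rw [integrable_indicator_iff hball]
    exact integrableOn_const (isCompact_closedBall _ _).measure_lt_top.ne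
  -- Integration in x upgrades weak convergence of a to strong L¹ convergence of G ε: pointwise
  -- limits are dominated through the local bound on a.
  have hL1 : Tendsto (fun ε => ∫ y, |G ε y - A * h y|) (𝓝[>] 0) (𝓝 0) := by
    have h0 : Tendsto (fun ε => ∫ y, |G ε y - A * h y|) (𝓝[>] 0) (𝓝 (∫ _ : Rd d, (0 : ℝ))) := by
      refine tendsto_integral_filter_of_dominated_convergence _ ?_ ?_ hind ?_
      · filter_upwards [self_mem_nhdsWithin] with ε hε
        exact ((hGm ε hε).sub
          (hhT.aemeasurable.aestronglyMeasurable.const_mul A)).norm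
      · filter_upwards [hGb] with ε hε
        refine ae_of_all _ fun y => ?_
        rw [Real.norm_eq_abs, abs_abs]
        exact hε y
      · filter_upwards [hpt] with y hy
        have := (hy.sub_const (A * h y)).abs
        simpa using this
    simpa using h0
  have hfub : ∀ ε, 0 < ε → ∫ q : Rd d × Rd d, K q * (a ε q.1 * b ε q.2) = ∫ y, G ε y * b ε y := by
    intro ε hε
    rw [Measure.volume_eq_prod, integral_prod_symm _ (hK.integrable_mul
      (LocallyIntegrable.mul_prod (haLI ε hε) (hbLI ε hε)))]
    refine integral_congr_ae (ae_of_all _ fun y => ?_)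
    dsimp only
    rw [hG, ← integral_mul_const]
    refine integral_congr_ae (ae_of_all _ fun x => ?_)
    dsimp only
    ring
  have hlim : ∫ q : Rd d × Rd d, K q * (A * B) = A * (B * ∫ y, h y) := by
    rw [Measure.volume_eq_prod, integral_prod_symm _ (hK.integrable.mul_const (A * B))]
    simp_rw [integral_mul_const]
    ring
  have hmain : Tendsto (fun ε => A * ∫ y, h y * b ε y) (𝓝[>] 0) (𝓝 (A * (B * ∫ y, h y))) :=
    (hb h hhT).const_mul A
  rw [hlim]
  suffices hdiff : Tendsto (fun ε => ∫ y, (G ε y - A * h y) * b ε y) (𝓝[>] 0) (𝓝 0) by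
    have h2 := hdiff.add hmain
    rw [zero_add] at h2
    refine h2.congr' ?_
    filter_upwards [self_mem_nhdsWithin] with ε hε
    rw [hfub ε hε, ← integral_const_mul]
    have hi1 : Integrable fun y => G ε y * b ε y := by
      have h3 := (hK.integrable_mul (LocallyIntegrable.mul_prod (haLI ε hε)
        (hbLI ε hε))).swap.integral_prod_left
      refine h3.congr (ae_of_all _ fun y => ?_)
      simp only [hG, ← integral_mul_const, mul_assoc]
      rfl
    have hi2 : Integrable fun y => A * (h y * b ε y) :=
      (hhT.integrable_mul (hbLI ε hε)).const_mul A
    have hi3 : Integrable fun y => (G ε y - A * h y) * b ε y :=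
      (hi1.sub hi2).congr (ae_of_all _ fun y => by simp only [Pi.sub_apply]; ring)
    rw [← integral_add hi3 hi2]
    refine integral_congr_ae (ae_of_all _ fun y => ?_)
    dsimp only
    ring
  rw [Metric.tendsto_nhds]
  intro δ hδ
  -- The unbounded factor b is cut at n: b ∧ n is paired with the L¹ convergence of G ε, and the
  -- remaining tail with the uniform bound C'.
  obtain ⟨n, hn⟩ := (hbtail R (δ / 4 / (|C'| + 1)) (by positivity)).exists
  filter_upwards [hn, hGb, (tendsto_order.1 (hL1.mul_const (n : ℝ))).2 (δ / 2) (by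
    rw [zero_mul]; positivity), self_mem_nhdsWithin] with ε h1 h2 h3 hε
  rw [Real.dist_0_eq_abs]
  have hbi : IntegrableOn (b ε) (Metric.closedBall (0 : Rd d) R) volume :=
    (hbLI ε hε).integrableOn_isCompact (isCompact_closedBall 0 R)
  have hti : IntegrableOn (fun y => b ε y - min (b ε y) n) (Metric.closedBall (0 : Rd d) R)
      volume := by
    refine hbi.mono' ((hbm ε).sub ((hbm ε).min measurable_const)).aestronglyMeasurable
      (ae_of_all _ fun y => abs_sub_min_natCast_le (hb0 ε y) n)
  have hDi : Integrable fun y => |G ε y - A * h y| :=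
    hind.mono' ((hGm ε hε).sub (hhT.aemeasurable.aestronglyMeasurable.const_mul A)).norm
      (ae_of_all _ fun y => by rw [Real.norm_eq_abs, abs_abs]; exact h2 y)
  have hti' : Integrable fun y => |C'| *
      (Metric.closedBall (0 : Rd d) R).indicator (fun y => b ε y - min (b ε y) n) y :=
    ((integrable_indicator_iff hball).2 hti).const_mul _
  have ht0 : ∀ y, 0 ≤ b ε y - min (b ε y) n := fun y => sub_nonneg.2 (min_le_left _ _)
  have hbound : |∫ y, (G ε y - A * h y) * b ε y| ≤
      ∫ y, (|G ε y - A * h y| * n + |C'| *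
        (Metric.closedBall (0 : Rd d) R).indicator (fun y => b ε y - min (b ε y) n) y) := by
    refine norm_integral_le_of_norm_le (G := ℝ) ((hDi.mul_const _).add hti')
      (ae_of_all _ fun y => ?_)
    rw [norm_mul, Real.norm_eq_abs, Real.norm_eq_abs, abs_of_nonneg (hb0 ε y)]
    have hsplit : |G ε y - A * h y| * b ε y = |G ε y - A * h y| * min (b ε y) n +
        |G ε y - A * h y| * (b ε y - min (b ε y) n) := by ring
    rw [hsplit]
    refine add_le_add (mul_le_mul_of_nonneg_left (min_le_right _ _) (abs_nonneg _)) ?_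
    have h4 := h2 y
    by_cases hy : y ∈ Metric.closedBall (0 : Rd d) R
    · rw [Set.indicator_of_mem hy] at h4 ⊢
      exact mul_le_mul_of_nonneg_right (h4.trans (le_abs_self _)) (ht0 y)
    · rw [Set.indicator_of_notMem hy] at h4 ⊢
      rw [le_antisymm h4 (abs_nonneg _), zero_mul, mul_zero]
  rw [integral_add (hDi.mul_const _) hti', integral_mul_const, integral_const_mul,
    integral_indicator hball] at hbound
  have h5 : |C'| * ∫ y in Metric.closedBall (0 : Rd d) R, (b ε y - min (b ε y) n) ≤ δ / 4 := by
    calc _ ≤ |C'| * (δ / 4 / (|C'| + 1)) := by gcongr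
      _ = δ / 4 * (|C'| / (|C'| + 1)) := by ring
      _ ≤ δ / 4 := by
        refine mul_le_of_le_one_right (by positivity) ?_
        rw [div_le_one (by positivity)]
        linarith
  linarith

/-! ### From iterated integrals over the cone to integrals over pairs. -/

section IteratedIntegrals

variable {d : ℕ}

theorem jumpKernel_mul (f g : Rd d → ℝ) (s : ℝ) (T : Set (Rd d)) (φ : Rd d × Rd d → ℝ) :
    (fun q => jumpKernel f g s T q * φ q) = {q : Rd d × Rd d | q.2 ∈ T}.indicator fun q =>
      (f (q.1 + q.2) - f q.1) * (g (q.1 + q.2) - g q.1) / ‖q.2‖ ^ s * φ q := by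
  ext q
  unfold jumpKernel
  by_cases hq : q ∈ {q : Rd d × Rd d | q.2 ∈ T}
  · rw [Set.indicator_of_mem hq, Set.indicator_of_mem hq]
  · rw [Set.indicator_of_notMem hq, Set.indicator_of_notMem hq, zero_mul]

theorem integrableOn_iff_integrable_jumpKernel_mul {f g : Rd d → ℝ} {s : ℝ} {T : Set (Rd d)}
    (hT : MeasurableSet T) {φ : Rd d × Rd d → ℝ} :
    IntegrableOn (fun q : Rd d × Rd d =>
      (f (q.1 + q.2) - f q.1) * (g (q.1 + q.2) - g q.1) / ‖q.2‖ ^ s * φ q) {q | q.2 ∈ T} volume ↔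
      Integrable fun q => jumpKernel f g s T q * φ q := by
  rw [jumpKernel_mul]
  exact (integrable_indicator_iff (measurable_snd hT)).symm

theorem integral_jumpKernel_mul {f g : Rd d → ℝ} {s : ℝ} {T : Set (Rd d)}
    (hT : MeasurableSet T) {φ : Rd d × Rd d → ℝ}
    (hi : Integrable fun q => jumpKernel f g s T q * φ q) :
    ∫ x, ∫ z in T, (f (x + z) - f x) * (g (x + z) - g x) / ‖z‖ ^ s * φ (x, z) =
      ∫ q, jumpKernel f g s T q * φ q := by
  rw [Measure.volume_eq_prod, integral_prod _ hi]
  refine integral_congr_ae (ae_of_all _ fun x => ?_)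
  dsimp only
  rw [← integral_indicator hT]
  refine integral_congr_ae (ae_of_all _ fun z => ?_)
  exact (congr_fun (jumpKernel_mul f g s T φ) (x, z)).symm

theorem jumpKernel_swap_sub_mul (f g : Rd d → ℝ) (s : ℝ) (T : Set (Rd d))
    (φ : Rd d × Rd d → ℝ) :
    (fun q : Rd d × Rd d => jumpKernel f g s T (q.2, q.1 - q.2) * φ q) =
      {q : Rd d × Rd d | q.1 - q.2 ∈ T}.indicator fun q =>
        (f q.2 - f q.1) * (g q.2 - g q.1) / ‖q.1 - q.2‖ ^ s * φ q := by
  ext q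
  unfold jumpKernel
  by_cases hq : q.1 - q.2 ∈ T
  · rw [Set.indicator_of_mem (by exact hq), Set.indicator_of_mem (by exact hq),
      add_sub_cancel, ← neg_sub (f q.2), ← neg_sub (g q.2), neg_mul_neg]
  · rw [Set.indicator_of_notMem (by exact hq), Set.indicator_of_notMem (by exact hq), zero_mul]

theorem integrableOn_iff_integrable_jumpKernel_swap_sub_mul {f g : Rd d → ℝ} {s : ℝ}
    {T : Set (Rd d)} (hT : MeasurableSet T) {φ : Rd d × Rd d → ℝ} :
    IntegrableOn (fun q : Rd d × Rd d =>
      (f q.2 - f q.1) * (g q.2 - g q.1) / ‖q.1 - q.2‖ ^ s * φ q) {q | q.1 - q.2 ∈ T} volume ↔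
      Integrable fun q : Rd d × Rd d => jumpKernel f g s T (q.2, q.1 - q.2) * φ q := by
  rw [jumpKernel_swap_sub_mul]
  exact (integrable_indicator_iff ((measurable_fst.sub measurable_snd) hT)).symm

theorem integral_jumpKernel_swap_sub_mul {f g : Rd d → ℝ} {s : ℝ} {T : Set (Rd d)}
    (hT : MeasurableSet T) {φ : Rd d × Rd d → ℝ}
    (hi : Integrable fun q : Rd d × Rd d => jumpKernel f g s T (q.2, q.1 - q.2) * φ q) :
    ∫ y, ∫ x in {x | x - y ∈ T},
        (f y - f x) * (g y - g x) / ‖x - y‖ ^ s * φ (x, y) =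
      ∫ q : Rd d × Rd d, jumpKernel f g s T (q.2, q.1 - q.2) * φ q := by
  rw [Measure.volume_eq_prod, integral_prod_symm _ hi]
  refine integral_congr_ae (ae_of_all _ fun y => ?_)
  dsimp only
  have hTy : MeasurableSet {x | x - y ∈ T} := (measurable_id.sub_const y) hT
  rw [← integral_indicator hTy]
  refine integral_congr_ae (ae_of_all _ fun x => ?_)
  exact (congr_fun (jumpKernel_swap_sub_mul f g s T φ) (x, y)).symm

end IteratedIntegrals

/-! ### Convergence of both coefficients and conclusion. -/

section Homogenization

variable {d : ℕ} {Ω : Type*} [MeasurableSpace Ω] {P : Measure Ω} [IsProbabilityMeasure P]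
  {τ : Rd d → Ω → Ω}

/-- The second summand of κ is the first one evaluated at the reversed jump, so its integral against
K is that of the first against K composed with `reverseJump`. In the limit the same reversal
produces `νbar (-z)`. -/
theorem SummationForm.ae_tendsto_coefficient {κ : Rd d → Rd d → Ω → ℝ} {ν : Rd d → Ω → ℝ}
    {νbar : Rd d → ℝ} {Λ : Ω → ℝ} (hd : 1 ≤ d) (hτ : IsStationaryErgodicGroup P τ)
    (hs : SummationForm P τ κ ν νbar) (hΛm : Measurable Λ) (hΛ0 : ∀ ω, 0 ≤ Λ ω)
    (hΛi : Integrable Λ P) (hbd : ∀ ω x y, κ x y ω ≤ Λ (τ x ω) + Λ (τ y ω)) :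
    ∀ᵐ ω ∂P, ∀ K : Rd d × Rd d → ℝ, IsBoundedTest K volume →
      (∀ ε : ℝ, 0 < ε →
        Integrable fun q : Rd d × Rd d => K q * κ (ε⁻¹ • q.1) (ε⁻¹ • (q.1 + q.2)) ω) ∧
      (Integrable fun q : Rd d × Rd d => K q * (νbar q.2 + νbar (-q.2))) ∧
      Tendsto (fun ε : ℝ => ∫ q : Rd d × Rd d, K q * κ (ε⁻¹ • q.1) (ε⁻¹ • (q.1 + q.2)) ω) (𝓝[>] 0)
        (𝓝 (∫ q : Rd d × Rd d, K q * (νbar q.2 + νbar (-q.2)))) := by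
  filter_upwards [hs.ae_tendsto hd hτ hΛm hΛ0 hΛi hbd, hs.representation] with ω hω hrep K hK
  have hKr := hK.comp_reverseJump
  obtain ⟨hi1, ht1⟩ := hω K hK
  obtain ⟨hi2, ht2⟩ := hω _ hKr
  have hκ : ∀ (ε : ℝ) (q : Rd d × Rd d), K q * κ (ε⁻¹ • q.1) (ε⁻¹ • (q.1 + q.2)) ω =
      K q * ν (ε⁻¹ • q.2) (τ (ε⁻¹ • q.1) ω) + K (reverseJump (reverseJump q)) *
        ν (ε⁻¹ • (reverseJump q).2) (τ (ε⁻¹ • (reverseJump q).1) ω) := by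
    intro ε q
    rw [hrep, reverseJump_reverseJump, ← smul_sub, ← smul_sub, add_sub_cancel_left,
      sub_add_cancel_left, mul_add]
    rfl
  have hi2' : ∀ ε : ℝ, 0 < ε → Integrable fun q : Rd d × Rd d =>
      K (reverseJump (reverseJump q)) *
        ν (ε⁻¹ • (reverseJump q).2) (τ (ε⁻¹ • (reverseJump q).1) ω) := fun ε hε =>
    integrable_comp_reverseJump.2 (hi2 ε hε)
  have hν1 : Integrable fun q : Rd d × Rd d => K q * νbar q.2 :=
    hK.integrable_mul (LocallyIntegrable.comp_snd hs.mean_converges.locallyIntegrable_limit)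
  have hν2 : Integrable fun q : Rd d × Rd d => K (reverseJump q) * νbar q.2 :=
    hKr.integrable_mul (LocallyIntegrable.comp_snd hs.mean_converges.locallyIntegrable_limit)
  have hν2' : Integrable fun q : Rd d × Rd d =>
      K (reverseJump (reverseJump q)) * νbar (reverseJump q).2 :=
    integrable_comp_reverseJump.2 hν2
  have hνeq : ∀ q : Rd d × Rd d, K q * (νbar q.2 + νbar (-q.2)) =
      K q * νbar q.2 + K (reverseJump (reverseJump q)) * νbar (reverseJump q).2 := fun q => by
    rw [reverseJump_reverseJump, mul_add]
    rfl
  refine ⟨fun ε hε => ?_, ?_, ?_⟩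
  · simp_rw [hκ]
    exact (hi1 ε hε).add (hi2' ε hε)
  · simp_rw [hνeq]
    exact hν1.add hν2'
  · simp_rw [hνeq]
    rw [integral_add hν1 hν2',
      integral_reverseJump fun q : Rd d × Rd d => K (reverseJump q) * νbar q.2]
    refine (ht1.add ht2).congr' ?_
    filter_upwards [self_mem_nhdsWithin] with ε hε
    simp_rw [hκ]
    rw [integral_add (hi1 ε hε) (hi2' ε hε), integral_reverseJump fun q : Rd d × Rd d =>
      K (reverseJump q) * ν (ε⁻¹ • q.2) (τ (ε⁻¹ • q.1) ω)]

/-- The factors play different roles: from ν₁ local boundedness of the integrals is needed, from ν₂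
uniformly small tails. Integrability and the ergodic theorem give both. -/
theorem IsStationaryErgodicGroup.ae_tendsto_tensor (hτ : IsStationaryErgodicGroup P τ)
    {ν₁ ν₂ : Ω → ℝ} (hm₁ : Measurable ν₁) (hm₂ : Measurable ν₂) (h₁ : ∀ ω, 0 ≤ ν₁ ω)
    (h₂ : ∀ ω, 0 ≤ ν₂ ω) (hi₁ : Integrable ν₁ P) (hi₂ : Integrable ν₂ P) :
    ∀ᵐ ω ∂P, ∀ K : Rd d × Rd d → ℝ, IsBoundedTest K volume →
      (∀ ε : ℝ, 0 < ε → Integrable fun q : Rd d × Rd d =>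
        K q * (ν₁ (τ (ε⁻¹ • q.1) ω) * ν₂ (τ (ε⁻¹ • q.2) ω))) ∧
      Tendsto (fun ε : ℝ => ∫ q : Rd d × Rd d,
        K q * (ν₁ (τ (ε⁻¹ • q.1) ω) * ν₂ (τ (ε⁻¹ • q.2) ω))) (𝓝[>] 0)
        (𝓝 (∫ q : Rd d × Rd d, K q * ((∫ ω', ν₁ ω' ∂P) * ∫ ω', ν₂ ω' ∂P))) := by
  filter_upwards [hτ.ae_locallyIntegrable hm₁ hi₁, hτ.ae_locallyIntegrable hm₂ hi₂,
    hτ.ae_tendsto_orbitAverage hm₁ hi₁ h₁, hτ.ae_tendsto_orbitAverage hm₂ hi₂ h₂,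
    hτ.ae_eventually_bounded hm₁ hi₁ h₁, hτ.ae_eventually_tail_le hm₂ hi₂ h₂]
    with ω hl1 hl2 ht1 ht2 hbd htail K hK
  have hL1 : ∀ ε : ℝ, 0 < ε → LocallyIntegrable (fun x : Rd d => ν₁ (τ (ε⁻¹ • x) ω)) volume :=
    fun ε hε => LocallyIntegrable.comp_smul hl1 (inv_ne_zero hε.ne')
  have hL2 : ∀ ε : ℝ, 0 < ε → LocallyIntegrable (fun x : Rd d => ν₂ (τ (ε⁻¹ • x) ω)) volume :=
    fun ε hε => LocallyIntegrable.comp_smul hl2 (inv_ne_zero hε.ne')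
  exact ⟨fun ε hε => hK.integrable_mul (LocallyIntegrable.mul_prod (hL1 ε hε) (hL2 ε hε)),
    tendsto_integral_tensor (a := fun ε x => ν₁ (τ (ε⁻¹ • x) ω))
      (b := fun ε x => ν₂ (τ (ε⁻¹ • x) ω)) (fun ε x => h₁ _) (fun ε x => h₂ _) hL1
      (fun ε => hm₂.comp ((hτ.measurable_orbit ω).comp (measurable_const_smul _))) hL2
      ht1 ht2 hbd htail hK⟩

end Homogenization

theorem integrable_of_integrable_rpow {Ω : Type*} [MeasurableSpace Ω] {P : Measure Ω}
    [IsFiniteMeasure P] {F : Ω → ℝ} (hFm : Measurable F) (hF : ∀ ω, 0 ≤ F ω) {p : ℝ} (hp : 1 ≤ p)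
    (h : Integrable (fun ω => F ω ^ p) P) : Integrable F P := by
  refine ((integrable_const (1 : ℝ)).add h).mono' hFm.aestronglyMeasurable
    (ae_of_all _ fun ω => ?_)
  have h0 : 0 ≤ F ω ^ p := Real.rpow_nonneg (hF ω) p
  rw [Real.norm_eq_abs, abs_of_nonneg (hF ω), Pi.add_apply]
  rcases le_total (F ω) 1 with h1 | h1
  · linarith
  · have := Real.self_le_rpow_of_one_le h1 hp
    linarith

theorem proposition3p3 {d : ℕ} (hd : 1 ≤ d) {Ω : Type*} [MeasurableSpace Ω]
    (P : Measure Ω) [IsProbabilityMeasure P] (τ : Rd d → Ω → Ω)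
    (hτ : IsStationaryErgodicGroup P τ) (Γ : Set (Rd d)) (hΓ : IsSymmetricOpenCone Γ)
    (α : ℝ) (hα : α ∈ Set.Ioo (0 : ℝ) 2) :
    (∀ (κ : Rd d → Rd d → Ω → ℝ) (ν : Rd d → Ω → ℝ) (νbar : Rd d → ℝ) (Λ : Ω → ℝ) (p : ℝ),
      IsRandomCoefficient τ κ → SummationForm P τ κ ν νbar →
      1 < p → Measurable Λ → (∀ ω, 0 ≤ Λ ω) → Integrable (fun ω => Λ ω ^ p) P →
      (∀ ω x y, κ x y ω ≤ Λ (τ x ω) + Λ (τ y ω)) →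
      ∀ᵐ ω ∂P, ∀ (η : ℝ) (f g : Rd d → ℝ), 0 < η →
        IsLocallyBoundedMeasurable f → IsBoundedCompactlySupported g →
        (∀ ε : ℝ, 0 < ε → IntegrableOn (fun q : Rd d × Rd d =>
          (f (q.1 + q.2) - f q.1) * (g (q.1 + q.2) - g q.1) / ‖q.2‖ ^ ((d : ℝ) + α)
            * κ (ε⁻¹ • q.1) (ε⁻¹ • (q.1 + q.2)) ω) {q | q.2 ∈ truncatedCone Γ η} volume) ∧
        IntegrableOn (fun q : Rd d × Rd d =>
          (f (q.1 + q.2) - f q.1) * (g (q.1 + q.2) - g q.1) / ‖q.2‖ ^ ((d : ℝ) + α)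
            * (νbar q.2 + νbar (-q.2))) {q | q.2 ∈ truncatedCone Γ η} volume ∧
        Tendsto (fun ε : ℝ => ∫ x, ∫ z in truncatedCone Γ η,
            (f (x + z) - f x) * (g (x + z) - g x) / ‖z‖ ^ ((d : ℝ) + α)
              * κ (ε⁻¹ • x) (ε⁻¹ • (x + z)) ω)
          (𝓝[>] 0)
          (𝓝 (∫ x, ∫ z in truncatedCone Γ η,
            (f (x + z) - f x) * (g (x + z) - g x) / ‖z‖ ^ ((d : ℝ) + α)
              * (νbar z + νbar (-z))))) ∧
    (∀ (ν₁ ν₂ : Ω → ℝ) (p : ℝ),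
      1 < p → Measurable ν₁ → Measurable ν₂ → (∀ ω, 0 ≤ ν₁ ω) → (∀ ω, 0 ≤ ν₂ ω) →
      Integrable (fun ω => ν₁ ω ^ p + ν₂ ω ^ p) P →
      ∀ᵐ ω ∂P, ∀ (η : ℝ) (f g : Rd d → ℝ), 0 < η →
        IsLocallyBoundedMeasurable f → IsBoundedCompactlySupported g →
        (∀ ε : ℝ, 0 < ε → IntegrableOn (fun q : Rd d × Rd d =>
          (f q.2 - f q.1) * (g q.2 - g q.1) / ‖q.1 - q.2‖ ^ ((d : ℝ) + α)
            * (ν₁ (τ (ε⁻¹ • q.1) ω) * ν₂ (τ (ε⁻¹ • q.2) ω)))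
          {q | q.1 - q.2 ∈ truncatedCone Γ η} volume) ∧
        IntegrableOn (fun q : Rd d × Rd d =>
          (f q.2 - f q.1) * (g q.2 - g q.1) / ‖q.1 - q.2‖ ^ ((d : ℝ) + α)
            * ((∫ ω', ν₁ ω' ∂P) * (∫ ω', ν₂ ω' ∂P)))
          {q | q.1 - q.2 ∈ truncatedCone Γ η} volume ∧
        Tendsto (fun ε : ℝ => ∫ y, ∫ x in {x | x - y ∈ truncatedCone Γ η},
            (f y - f x) * (g y - g x) / ‖x - y‖ ^ ((d : ℝ) + α)
              * (ν₁ (τ (ε⁻¹ • x) ω) * ν₂ (τ (ε⁻¹ • y) ω)))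
          (𝓝[>] 0)
          (𝓝 (∫ y, ∫ x in {x | x - y ∈ truncatedCone Γ η},
            (f y - f x) * (g y - g x) / ‖x - y‖ ^ ((d : ℝ) + α)
              * ((∫ ω', ν₁ ω' ∂P) * (∫ ω', ν₂ ω' ∂P))))) := by

  have hs : 0 ≤ (d : ℝ) + α := add_nonneg (Nat.cast_nonneg d) hα.1.le
  refine ⟨fun κ ν νbar Λ p _ hsum hp hΛm hΛ0 hΛp hbd => ?_,
    fun ν₁ ν₂ p hp hm₁ hm₂ h₁ h₂ hνp => ?_⟩
  · have hΛi : Integrable Λ P := integrable_of_integrable_rpow hΛm hΛ0 hp.le hΛp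
    filter_upwards [hsum.ae_tendsto_coefficient hd hτ hΛm hΛ0 hΛi hbd] with ω hω η f g hη hf hg
    have hT : MeasurableSet (truncatedCone Γ η) := measurableSet_truncatedCone hΓ.isOpen η
    -- The parameters η, f and g enter only through the test function, of which the event is
    -- independent.
    obtain ⟨hi, hil, hlim⟩ := hω _ (isBoundedTest_jumpKernel hf hg hs hΓ.isOpen hη)
    refine ⟨fun ε hε => (integrableOn_iff_integrable_jumpKernel_mul hT).2 (hi ε hε),
      (integrableOn_iff_integrable_jumpKernel_mul hT).2 hil, ?_⟩
    rw [integral_jumpKernel_mul hT (φ := fun q => νbar q.2 + νbar (-q.2)) hil]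
    refine hlim.congr' ?_
    filter_upwards [self_mem_nhdsWithin] with ε hε
    exact (integral_jumpKernel_mul hT (hi ε hε)).symm
  · have hp₁ : Integrable (fun ω => ν₁ ω ^ p) P := hνp.mono' (hm₁.pow_const p).aestronglyMeasurable
      (ae_of_all _ fun ω => by
        rw [Real.norm_eq_abs, abs_of_nonneg (Real.rpow_nonneg (h₁ ω) p)]
        exact le_add_of_nonneg_right (Real.rpow_nonneg (h₂ ω) p))
    have hp₂ : Integrable (fun ω => ν₂ ω ^ p) P := hνp.mono' (hm₂.pow_const p).aestronglyMeasurable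
      (ae_of_all _ fun ω => by
        rw [Real.norm_eq_abs, abs_of_nonneg (Real.rpow_nonneg (h₂ ω) p)]
        exact le_add_of_nonneg_left (Real.rpow_nonneg (h₁ ω) p))
    filter_upwards [hτ.ae_tendsto_tensor hm₁ hm₂ h₁ h₂
      (integrable_of_integrable_rpow hm₁ h₁ hp.le hp₁)
      (integrable_of_integrable_rpow hm₂ h₂ hp.le hp₂)] with ω hω η f g hη hf hg
    have hT : MeasurableSet (truncatedCone Γ η) := measurableSet_truncatedCone hΓ.isOpen η
    have hK := (isBoundedTest_jumpKernel hf hg hs hΓ.isOpen hη).comp_swap_sub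
    obtain ⟨hi, hlim⟩ := hω _ hK
    have hil := hK.integrable.mul_const ((∫ ω', ν₁ ω' ∂P) * ∫ ω', ν₂ ω' ∂P)
    refine ⟨fun ε hε => (integrableOn_iff_integrable_jumpKernel_swap_sub_mul hT).2 (hi ε hε),
      (integrableOn_iff_integrable_jumpKernel_swap_sub_mul hT).2 hil, ?_⟩
    rw [integral_jumpKernel_swap_sub_mul hT
      (φ := fun _ => (∫ ω', ν₁ ω' ∂P) * ∫ ω', ν₂ ω' ∂P) hil]
    refine hlim.congr' ?_
    filter_upwards [self_mem_nhdsWithin] with ε hε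
    exact (integral_jumpKernel_swap_sub_mul hT (hi ε hε)).symm
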